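/- Theorem (symmetric tactical decomposition of $\mathrm{PG}(3,3^{2e})$). Let $e$ be a positive integer and $q=3^{2e}$. A tactical decomposition of $\mathrm{PG}(d,q)$ (as a point-line structure) is a partition of the points and a partition of the lines into nonempty classes such that the number of points of a given point class on a line depends only on the class of the line, and the number of lines of a given line class through a point depends only on the class of the point; it is symmetric if there are as many point classes as line classes. For a point $p$ and a subspace $\pi$, let $\mathrm{star}(p)$ be the set of lines through $p$ and $\mathrm{line}(\pi)$ the set of lines contained in $\pi$. There are a point $p$ and a plane $\pi\not\ni p$ of $\mathrm{PG}(3,q)$ and two sets of lines $\mathcal L_1,\mathcal L_2$ such that the four distinct line classes $\mathrm{star}(p)$, $\mathrm{line}(\pi)$, $\mathcal L_1$, $\mathcal L_2$ and the four distinct point classes $\{p\}$, $\pi$, $$\mathcal P_1=\Big\{r : |\mathrm{star}(r)\cap\mathcal L_1|=\tfrac12(3^{2e}+1)(3^{2e}-3^e)\Big\},\qquad \mathcal P_2=\Big\{r : |\mathrm{star}(r)\cap\mathcal L_1|=\tfrac12(3^{2e}+1)(3^{2e}+3^e)\Big\}$$ form a symmetric tactical decomposition of $\mathrm{PG}(3,q)$.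 Explicitly, the following choice works. Let $E=\mathbb F_{q^3}$ with trace $T$ and norm $N$ to $F=\mathbb F_q$, let $\alpha$ be any primitive element of $E$, and put $\mu=\alpha^{q-1}$, $\omega=\alpha^{q^2+q+1}$. Let $Q^+(5,q)$ be the quadric $T(uv)=0$ in the projective space of the $F$-space $E\times E$, and let $G$ be the group generated by $(u,v)\mapsto(\mu u,\mu^{-1}v)$ and $(u,v)\mapsto(u,\omega^4v)$. The set $S=\{a\in E: N(a)=1,\ T(a^2)=0\}$ is nonempty. Fix any $a_1\in S$, and let $X_1$ (resp. $X_2$) be the set of $a\in S$ such that $2T(a_1a)$ is zero or a nonzero square (resp. a nonsquare). Put $$\mathcal T_1=\bigcup_{a\in X_1}\big((1,a^2)^G\cup(1,\omega a^2)^G\big)\ \cup\bigcup_{a\in X_2}\big((1,\omega^2a^2)^G\cup(1,\omega^3a^2)^G\big),$$ and let $\mathcal T_2$ be given by the same formula with $X_1$ and $X_2$ interchanged. In the model $F\times E$ of the vector space underlying $\mathrm{PG}(3,q)$, let $p=\langle(1,0)\rangle$, let $\pi$ be the plane $0\times E$, and let $\mathcal L_i$ be the set of lines whose image under the Klein correspondence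 $$\langle(a,x),(b,y)\rangle\longmapsto\big\langle(ay-bx,\ x^{q}y^{q^2}-x^{q^2}y^{q})\big\rangle\in Q^+(5,q)$$ lies in $\mathcal T_i$. Consequently, for every $e\ge1$, $\mathrm{PG}(3,3^{2e})$ is a counterexample to the Cameron–Liebler conjecture that a symmetric tactical decomposition of $\mathrm{PG}(d,q)$ always consists of (i) a single point class and a single line class, or (ii) the point classes $\{r\}$ and its complement and the line classes $\mathrm{star}(r)$ and its complement, for some point $r$, or (iii) the point classes $H$ and its complement and the line classes $\mathrm{line}(H)$ and its complement, for some hyperplane $H$. -/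

import Mathlib

/-! ### Tactical decompositions of incidence structures -/

/-- A tactical decomposition of the incidence structure with points `X`, blocks `Y` and incidence
relation `I`: a partition `PC` of the points and a partition `BC` of the blocks into nonempty classes,
such that the number of points of a given point class on a block depends only on the class of the
block, and the number of blocks of a given block class through a point depends only on the class of
the point. -/
structure IsTacticalDecomposition {X Y : Type*} (I : X → Y → Prop)
    (PC : Set (Set X)) (BC : Set (Set Y)) : Prop where
  point_partition : Setoid.IsPartition PC
  block_partition : Setoid.IsPartition BC
  block_tactical : ∀ P ∈ PC, ∀ B ∈ BC, ∃ n : ℕ, ∀ b ∈ B, {x ∈ P | I x b}.encard = n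
  point_tactical : ∀ P ∈ PC, ∀ B ∈ BC, ∃ n : ℕ, ∀ x ∈ P, {b ∈ B | I x b}.encard = n

/-- A tactical decomposition is symmetric if it has as many point classes as block classes. -/
structure IsSymmetricTacticalDecomposition {X Y : Type*} (I : X → Y → Prop)
    (PC : Set (Set X)) (BC : Set (Set Y)) : Prop extends IsTacticalDecomposition I PC BC where
  card_eq : PC.encard = BC.encard

/-! ### Points, lines and hyperplanes of a projective space -/

/-- The points of the projective space of `V`. -/
abbrev PGPoint (F V : Type*) [Field F] [AddCommGroup V] [Module F V] : Type _ :=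
  Projectivization F V

/-- The lines of the projective space of `V`: the two-dimensional subspaces of `V`. -/
abbrev PGLine (F V : Type*) [Field F] [AddCommGroup V] [Module F V] : Type _ :=
  {ℓ : Submodule F V // Module.finrank F ℓ = 2}

section Geometry

variable {F V : Type*} [Field F] [AddCommGroup V] [Module F V]

/-- Incidence of points and lines. -/
def PGIncident (r : PGPoint F V) (ℓ : PGLine F V) : Prop := r.submodule ≤ ℓ.1

/-- The set of lines through the point `r`. -/
def pgStar (r : PGPoint F V) : Set (PGLine F V) := {ℓ | PGIncident r ℓ}

/-- The set of lines contained in the subspace `H`. -/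
def pgLinesIn (H : Submodule F V) : Set (PGLine F V) := {ℓ | ℓ.1 ≤ H}

/-- The set of points contained in the subspace `H`. -/
def pgPointsIn (H : Submodule F V) : Set (PGPoint F V) := {r | r.submodule ≤ H}

end Geometry

/-- The Cameron-Liebler conjecture on symmetric tactical decompositions, for the projective space
of `V`: every symmetric tactical decomposition of its points and lines has a single point class and
a single line class, or is given by a point, or is given by a hyperplane. -/
def CameronLieblerSTDConjecture (F V : Type*) [Field F] [AddCommGroup V] [Module F V] : Prop :=
  ∀ (PC : Set (Set (PGPoint F V))) (BC : Set (Set (PGLine F V))),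
    IsSymmetricTacticalDecomposition PGIncident PC BC →
      (PC = {Set.univ} ∧ BC = {Set.univ}) ∨
      (∃ r : PGPoint F V, PC = {{r}, {r}ᶜ} ∧ BC = {pgStar r, (pgStar r)ᶜ}) ∨
      (∃ H : Submodule F V, Module.finrank F H + 1 = Module.finrank F V ∧
        PC = {pgPointsIn H, (pgPointsIn H)ᶜ} ∧ BC = {pgLinesIn H, (pgLinesIn H)ᶜ})

/-- The set of points `r` such that twice the number of lines of `L` through `r` is `n`. -/
def pointsOfHalfDegree {F V : Type*} [Field F] [AddCommGroup V] [Module F V]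
    (L : Set (PGLine F V)) (n : ℕ) : Set (PGPoint F V) :=
  {r | 2 * (pgStar r ∩ L).ncard = n}

/-- The points on exactly `(q + 1) * (q - √q) / 2` lines of `L`, where `q = 3 ^ (2 * e)`. -/
def pointClass₁ {F V : Type*} [Field F] [AddCommGroup V] [Module F V] (e : ℕ)
    (L : Set (PGLine F V)) : Set (PGPoint F V) :=
  pointsOfHalfDegree L ((3 ^ (2 * e) + 1) * (3 ^ (2 * e) - 3 ^ e))

/-- The points on exactly `(q + 1) * (q + √q) / 2` lines of `L`, where `q = 3 ^ (2 * e)`. -/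
def pointClass₂ {F V : Type*} [Field F] [AddCommGroup V] [Module F V] (e : ℕ)
    (L : Set (PGLine F V)) : Set (PGPoint F V) :=
  pointsOfHalfDegree L ((3 ^ (2 * e) + 1) * (3 ^ (2 * e) + 3 ^ e))

/-- The point `p` is not in the plane `π`, and the four line classes `star(p)`, `line(π)`, `L₁`,
`L₂` together with the four point classes `{p}`, `π`, `P₁`, `P₂` form a symmetric tactical
decomposition of `PG(3, 3 ^ (2 * e))`, where `P₁` and `P₂` are determined by the number of lines of
`L₁` through a point. -/
structure IsFourClassDecomposition {F V : Type*} [Field F] [AddCommGroup V] [Module F V] (e : ℕ)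
    (p : PGPoint F V) (π : Submodule F V) (L₁ L₂ : Set (PGLine F V)) : Prop where
  finrank_plane : Module.finrank F π = 3
  not_mem_plane : p ∉ pgPointsIn π
  card_pointClasses :
    ({{p}, pgPointsIn π, pointClass₁ e L₁, pointClass₂ e L₁} : Set (Set (PGPoint F V))).ncard = 4
  card_lineClasses : ({pgStar p, pgLinesIn π, L₁, L₂} : Set (Set (PGLine F V))).ncard = 4
  symmetric_tactical : IsSymmetricTacticalDecomposition PGIncident
    {{p}, pgPointsIn π, pointClass₁ e L₁, pointClass₂ e L₁} {pgStar p, pgLinesIn π, L₁, L₂}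

/-! ### The line classes

`E` is the cubic extension of the field `F` with `q` elements and `α` is a primitive element of `E`.
The hyperbolic quadric `Q⁺(5, q)` is the quadric `T(uv) = 0` in the projective space of the
`F`-space `E × E`, where `T` is the trace from `E` to `F`. The space `PG(3, q)` is modelled on the
`F`-space `F × E`. -/

noncomputable section Construction

variable (F : Type*) {E : Type*} [Field F] [Field E] [Algebra F E]

/-- The primitive element `ω = α ^ (q ^ 2 + q + 1)` of `F`, that is, the norm of `α`. -/
def omegaUnit (α : Eˣ) : Fˣ := Units.map (Algebra.norm F) α

/-- The element `μ = α ^ (q - 1)`, of order `q ^ 2 + q + 1`. -/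
def muUnit (α : Eˣ) : Eˣ := α ^ (Nat.card F - 1)

/-- The map `(u, v) ↦ (μ u, μ⁻¹ v)`. -/
def mapC (α : Eˣ) : (E × E) ≃ₗ[F] (E × E) :=
  LinearEquiv.prodCongr (DistribMulAction.toLinearEquiv F E (muUnit F α))
    (DistribMulAction.toLinearEquiv F E (muUnit F α)⁻¹)

/-- The map `(u, v) ↦ (u, ω ^ 4 v)`. -/
def mapZ (α : Eˣ) : (E × E) ≃ₗ[F] (E × E) :=
  LinearEquiv.prodCongr (LinearEquiv.refl F E)
    (DistribMulAction.toLinearEquiv F E (omegaUnit F α ^ 4))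

/-- The group generated by the two maps `mapC` and `mapZ`. -/
def groupG (α : Eˣ) : Subgroup ((E × E) ≃ₗ[F] (E × E)) :=
  Subgroup.closure {mapC F α, mapZ F α}

/-- The elements `a` of `E` with norm `1` such that `a ^ 2` has trace `0`. -/
def setS : Set E := {a | Algebra.norm F a = 1 ∧ Algebra.trace F E (a ^ 2) = 0}

/-- The elements `a` of `setS` such that `2 T(a₁ a)` is zero or a nonzero square. -/
def setX₁ (a₁ : E) : Set E := {a ∈ setS F | IsSquare (2 * Algebra.trace F E (a₁ * a))}

/-- The elements `a` of `setS` such that `2 T(a₁ a)` is a nonsquare. -/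
def setX₂ (a₁ : E) : Set E := {a ∈ setS F | ¬ IsSquare (2 * Algebra.trace F E (a₁ * a))}

/-- The point `⟨(1, ω ^ s a ^ 2)⟩` of the quadric. -/
def orbitRep (α : Eˣ) (s : ℕ) (a : E) : PGPoint F (E × E) :=
  Projectivization.mk F ((1, (omegaUnit F α : F) ^ s • a ^ 2) : E × E)
    (fun h => one_ne_zero (congrArg Prod.fst h))

/-- The union of the orbits of the points `⟨(1, ω ^ s a ^ 2)⟩` under the group `groupG`, for
`a ∈ X` and `s ∈ {0, 1}`, and for `a ∈ Y` and `s ∈ {2, 3}`. -/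
def orbitUnion (α : Eˣ) (X Y : Set E) : Set (PGPoint F (E × E)) :=
  (⋃ a ∈ X, MulAction.orbit (groupG F α) (orbitRep F α 0 a) ∪
      MulAction.orbit (groupG F α) (orbitRep F α 1 a)) ∪
  (⋃ a ∈ Y, MulAction.orbit (groupG F α) (orbitRep F α 2 a) ∪
      MulAction.orbit (groupG F α) (orbitRep F α 3 a))

/-- The tight set `𝒯₁` of the quadric. -/
def tightSet₁ (α : Eˣ) (a₁ : E) : Set (PGPoint F (E × E)) :=
  orbitUnion F α (setX₁ F a₁) (setX₂ F a₁)

/-- The tight set `𝒯₂` of the quadric. -/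
def tightSet₂ (α : Eˣ) (a₁ : E) : Set (PGPoint F (E × E)) :=
  orbitUnion F α (setX₂ F a₁) (setX₁ F a₁)

/-- Plücker coordinates: for vectors `v = (a, x)` and `w = (b, y)` of `F × E` this is
`(a y - b x, x ^ q y ^ (q ^ 2) - x ^ (q ^ 2) y ^ q)`, which is `v ∧ w` after identifying `⋀²(F × E)`
with `E × ⋀²E` and `⋀²E` with `E` by the cross product. It is a vector `(u, v)` with
`T(u v) = 0`. -/
def pluckerVector (v w : F × E) : E × E :=
  (v.1 • w.2 - w.1 • v.2,
    v.2 ^ Nat.card F * w.2 ^ (Nat.card F ^ 2) - v.2 ^ (Nat.card F ^ 2) * w.2 ^ Nat.card F)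

/-- The set of lines of `PG(3, q)` whose image under the Klein correspondence is in `𝒯`. -/
def kleinPreimage (𝒯 : Set (PGPoint F (E × E))) : Set (PGLine F (F × E)) :=
  {ℓ | ∃ v w : F × E, ℓ.1 = Submodule.span F {v, w} ∧
    ∃ h : pluckerVector F v w ≠ 0, Projectivization.mk F (pluckerVector F v w) h ∈ 𝒯}

variable (E)

/-- The point `⟨(1, 0)⟩` of `PG(3, q)`; the lines through it correspond to the generator
`{(x, 0)}` of the quadric. -/
def basePoint : PGPoint F (F × E) :=
  Projectivization.mk F ((1, 0) : F × E) (fun h => one_ne_zero (congrArg Prod.fst h))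

/-- The plane `0 × E` of `PG(3, q)`; its lines correspond to the generator `{(0, y)}` of the
quadric. -/
def basePlane : Submodule F (F × E) := LinearMap.range (LinearMap.inr F F E)

end Construction

/-! Identify the points off `π` with `E`, so that `p` becomes the origin. Let ψ be the quartic
character of F with ψ(ω) = i, and put r(x) = Re ψ(N x) − Im ψ(N x), which is ±1 off the origin.
Everything rests on one fact: r has sum 0 on the lines through the origin and sum √q or −√q on every
other affine line. Given this, `IsTwoLineSum.isFourClassDecomposition` is linear counting. The two
line classes are the two values of the line sum, the two affine point classes are the two signs of
r, the points of a class on a line are read off its line sum, and the lines of a class through a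
point come from adding up the line sums over the star of that point.

The line sums are found from Plücker coordinates (`exists_sum_line`). On a line x + sy write y = ln
with l in F and N(n) = 1, and put z = x/y. Dividing by y reduces the sum of ψ∘N to one over z + F,
and z modulo F is determined by σz − σ²z. This element has trace zero, hence is an F-multiple of a²
for some a in S. The set S is a conic: for θ with σθ = θ + 1 it consists of 1 and of elements d⁻¹(1
+ φ²), φ = θ − y' with y' in F. After an affine substitution, N on z + F becomes s³ − s + τ when a =
1, and u³ − u² + D² with D = (t² + 1)²/t³ otherwise, where φ³ = φ + t. By `sum_cubic` the quartic
sums of these two kinds of cubics differ only by the factor ψ(t). So the sum of ψ∘N on the line is w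
· `conicSign` ψ a · conj ψ(c), where w is real, w² = q, and the second Plücker coordinate is l c a²
n⁻¹. The pair (a, ψ(c)) is also what separates the orbits of G (`mem_orbit_orbitRep`), so the sign
of the line sum tells 𝒯₁ from 𝒯₂ (`kleinPreimage_eq`).

For `sum_cubic`, the invariance ζ(x³) = ζ(x) turns Gauss sum times cubic sum into a real twisted
Kloosterman sum K, and K is expressed by the exponential sum of a quadratic form over 𝔽₃, whose
absolute value is known from its radical. Since K is real and ζ(D) is a primitive cube root of
unity, K satisfies a quadratic equation with roots 2G, −G or 0, G, where G² = q. Finally K² is the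
squared modulus of a sum of an odd number of fourth roots of unity, hence an odd integer, and only
±G survives. -/

open scoped ComplexConjugate

set_option linter.unusedSectionVars false

/-! ### Character sums over finite fields of characteristic three -/



/-- `ψ` is a quartic character with `ψ (-1) = 1` whose square detects squares, and `ζ` is a
primitive additive character that is invariant under the Frobenius map. -/
structure IsQuarticPair {F : Type*} [Field F] (ψ : MulChar F ℂ) (ζ : AddChar F ℂ) : Prop where
  neg_one : ψ (-1) = 1
  sq_of_isSquare : ∀ x : F, x ≠ 0 → IsSquare x → ψ x ^ 2 = 1
  sq_of_not_isSquare : ∀ x : F, ¬ IsSquare x → ψ x ^ 2 = -1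
  primitive : ζ.IsPrimitive
  cube : ∀ x, ζ (x ^ 3) = ζ x

namespace IsQuarticPair

variable {F : Type*} [Field F] [Fintype F] [CharP F 3] {ψ : MulChar F ℂ} {ζ : AddChar F ℂ}

lemma mulChar_zero (ψ : MulChar F ℂ) : ψ 0 = 0 := ψ.map_nonunit not_isUnit_zero

lemma pow_four (h : IsQuarticPair ψ ζ) {x : F} (hx : x ≠ 0) : ψ x ^ 4 = 1 := by
  by_cases hs : IsSquare x
  · rw [show 4 = 2 * 2 from rfl, pow_mul, h.sq_of_isSquare x hx hs]; norm_num
  · rw [show 4 = 2 * 2 from rfl, pow_mul, h.sq_of_not_isSquare x hs]; norm_num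

lemma pow_five (h : IsQuarticPair ψ ζ) (x : F) : ψ x ^ 5 = ψ x := by
  rcases eq_or_ne x 0 with rfl | hx
  · simp [mulChar_zero]
  · rw [pow_succ, h.pow_four hx, one_mul]

lemma conj_mulChar (h : IsQuarticPair ψ ζ) (x : F) : conj (ψ x) = ψ x ^ 3 := by
  rcases eq_or_ne x 0 with rfl | hx
  · simp [mulChar_zero]
  · have h4 := h.pow_four hx
    have hn : ‖ψ x‖ = 1 := Complex.norm_eq_one_of_pow_eq_one h4 (by norm_num)
    rw [← Complex.inv_eq_conj hn]
    have h0 : ψ x ≠ 0 := by intro h0; rw [h0] at h4; norm_num at h4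
    field_simp
    rw [← h4]

lemma neg (h : IsQuarticPair ψ ζ) (x : F) : ψ (-x) = ψ x := by
  rw [← neg_one_mul, map_mul, h.neg_one, one_mul]

lemma mulChar_cases (h : IsQuarticPair ψ ζ) {x : F} (hx : x ≠ 0) :
    ψ x = 1 ∨ ψ x = -1 ∨ ψ x = Complex.I ∨ ψ x = -Complex.I := by
  have h4 := h.pow_four hx
  have : (ψ x - 1) * ((ψ x + 1) * ((ψ x - Complex.I) * (ψ x + Complex.I))) = 0 := by
    have hI := Complex.I_sq
    linear_combination h4 + (1 - ψ x ^ 2) * hI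
  rcases mul_eq_zero.1 this with h1 | h1
  · exact Or.inl (sub_eq_zero.1 h1)
  rcases mul_eq_zero.1 h1 with h1 | h1
  · exact Or.inr (Or.inl (eq_neg_of_add_eq_zero_left h1))
  rcases mul_eq_zero.1 h1 with h1 | h1
  · exact Or.inr (Or.inr (Or.inl (sub_eq_zero.1 h1)))
  · exact Or.inr (Or.inr (Or.inr (eq_neg_of_add_eq_zero_left h1)))

lemma conj_addChar (x : F) : conj (ζ x) = ζ (-x) := (AddChar.map_neg_eq_conj ζ x).symm

lemma three_eq_zero : (3 : F) = 0 := by exact_mod_cast CharP.cast_eq_zero F 3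

lemma two_eq_neg_one : (2 : F) = -1 := by linear_combination (three_eq_zero : (3 : F) = 0)

lemma addChar_pow_three (ζ : AddChar F ℂ) (x : F) : ζ x ^ 3 = 1 := by
  rw [← AddChar.map_nsmul_eq_pow]; simp [three_eq_zero]

lemma addChar_eq_one_of_sq {x : F} (hx : ζ x ^ 2 = 1) : ζ x = 1 := by
  have := addChar_pow_three ζ x
  rw [pow_succ, hx, one_mul] at this; exact this

lemma exists_cubeRoot (x : F) : ∃ y : F, y ^ 3 = x := by
  obtain ⟨y, hy⟩ := (frobeniusEquiv F 3).surjective x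
  exact ⟨y, by simpa [frobenius_def] using hy⟩

lemma cube_injective {x y : F} (hxy : x ^ 3 = y ^ 3) : x = y :=
  (frobenius_inj F 3) (by simpa [frobenius_def] using hxy)

lemma sum_cube (f : F → ℂ) : ∑ x, f (x ^ 3) = ∑ x, f x :=
  Fintype.sum_equiv (frobeniusEquiv F 3).toEquiv _ _ fun x => by simp [frobenius_def]

lemma sum_addChar_mul (h : IsQuarticPair ψ ζ) {a : F} (ha : a ≠ 0) : ∑ x, ζ (a * x) = 0 := by
  classical
  have := AddChar.sum_mulShift a h.primitive
  rw [if_neg ha] at this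
  simpa [mul_comm] using this

lemma card_sqrt (h : IsQuarticPair ψ ζ) [DecidableEq F] (hF : (2 : F) ≠ 0) (y : F) :
    (((Finset.univ.filter fun r : F => r ^ 2 = y).card : ℕ) : ℂ) = 1 + ψ y ^ 2 := by
  have hc : ringChar F ≠ 2 := by
    intro hc; apply hF
    have := ringChar.Nat.cast_ringChar (R := F)
    rw [hc] at this; exact_mod_cast this
  have := quadraticChar_card_sqrts hc y
  have h2 : (((Finset.univ.filter fun r : F => r ^ 2 = y).card : ℕ) : ℤ) = quadraticChar F y + 1 := by
    rw [← this]; congr 2; ext; simp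
  have h3 : ((quadraticChar F y : ℤ) : ℂ) = ψ y ^ 2 := by
    rcases eq_or_ne y 0 with rfl | hy
    · simp [mulChar_zero]
    by_cases hs : IsSquare y
    · rw [(quadraticChar_one_iff_isSquare hy).2 hs, h.sq_of_isSquare y hy hs]; simp
    · rw [quadraticChar_neg_one_iff_not_isSquare.2 hs, h.sq_of_not_isSquare y hs]; simp
  have h4 : ((((Finset.univ.filter fun r : F => r ^ 2 = y).card : ℕ) : ℤ) : ℂ) =
      ((quadraticChar F y + 1 : ℤ) : ℂ) := by rw [h2]
  push_cast at h4
  rw [h4, h3]; ring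

lemma two_ne_zero' : (2 : F) ≠ 0 := by rw [two_eq_neg_one]; simp

lemma sum_sq (h : IsQuarticPair ψ ζ) (f : F → ℂ) : ∑ r, f (r ^ 2) = ∑ y, (1 + ψ y ^ 2) * f y := by
  classical
  rw [← Finset.sum_fiberwise (s := Finset.univ) (g := fun r : F => r ^ 2)]
  refine Finset.sum_congr rfl fun y _ => ?_
  rw [← h.card_sqrt two_ne_zero' y, ← nsmul_eq_mul, ← Finset.sum_const]
  exact Finset.sum_congr rfl fun r hr => by rw [(Finset.mem_filter.1 hr).2]

/-- At a = 0 both sides vanish because ψ is nontrivial. Hence ψ of a polynomial can be expanded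
through the Gauss sum without treating its zeros separately. -/
lemma sum_mulChar_addChar (h : IsQuarticPair ψ ζ) (hne : ψ ≠ 1) (a : F) :
    ∑ z, ψ z * ζ (z * a) = conj (ψ a) * gaussSum ψ ζ := by
  rcases eq_or_ne a 0 with rfl | ha
  · simp [MulChar.sum_eq_zero_of_ne_one hne, mulChar_zero]
  · have h4 := h.pow_four ha
    rw [gaussSum, h.conj_mulChar, Finset.mul_sum]
    refine Fintype.sum_equiv (Equiv.mulRight₀ a ha) _ _ fun z => ?_
    simp only [Equiv.mulRight₀_apply, map_mul]
    linear_combination (-ψ z * ζ (z * a)) * h4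

/-- The sum of `ζ (x ^ 2)`. -/
noncomputable def quadSum (ζ : AddChar F ℂ) : ℂ := ∑ x, ζ (x ^ 2)

lemma sum_quad_monomial (h : IsQuarticPair ψ ζ) {A : F} (hA : A ≠ 0) :
    ∑ x, ζ (A * x ^ 2) = ψ A ^ 2 * quadSum ζ := by
  have h4 := h.pow_four hA
  have key : ∀ c : F, c ≠ 0 → ∑ x, ζ (c * x ^ 2) = ∑ y, ψ y ^ 2 * ζ (c * y) := by
    intro c hc
    rw [h.sum_sq (fun y => ζ (c * y))]
    simp only [add_mul, one_mul, Finset.sum_add_distrib, h.sum_addChar_mul hc, zero_add]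
  have h1 : quadSum ζ = ∑ y, ψ y ^ 2 * ζ y := by
    have := key 1 one_ne_zero
    simpa [quadSum] using this
  rw [key A hA, h1, Finset.mul_sum]
  refine Fintype.sum_equiv (Equiv.mulLeft₀ A hA) _ _ fun z => ?_
  simp only [Equiv.mulLeft₀_apply, map_mul]
  linear_combination (-ψ z ^ 2 * ζ (A * z)) * h4

lemma conj_quadSum (h : IsQuarticPair ψ ζ) : conj (quadSum ζ) = quadSum ζ := by
  have := h.sum_quad_monomial (A := -1) (by simp)
  rw [h.neg_one] at this
  rw [quadSum, map_sum]
  simp only [conj_addChar]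
  simpa [quadSum] using this

/-- The sum is real since −1 is a square, so its square is its squared modulus; a shift of x then
makes the exponent linear in y and orthogonality applies. -/
lemma quadSum_sq (h : IsQuarticPair ψ ζ) : quadSum ζ ^ 2 = Fintype.card F := by
  have h1 : quadSum ζ ^ 2 = ∑ x : F, ∑ y : F, ζ (-y ^ 2 + x ^ 2) := by
    rw [sq]; nth_rw 1 [← h.conj_quadSum]
    rw [quadSum, map_sum, Finset.sum_mul_sum, Finset.sum_comm]
    simp only [conj_addChar, AddChar.map_add_eq_mul]
  have h2 : ∀ y : F, ∑ x : F, ζ (-y ^ 2 + x ^ 2) = ∑ x : F, ζ (x ^ 2 - x * y) := by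
    intro y
    refine Fintype.sum_equiv (Equiv.subRight y) _ _ fun x => ?_
    simp only [Equiv.subRight_apply]
    congr 1
    linear_combination (-y ^ 2 + x * y) * (three_eq_zero : (3 : F) = 0)
  rw [h1, Finset.sum_comm, Finset.sum_congr rfl fun y _ => h2 y, Finset.sum_comm,
    Finset.sum_eq_single 0]
  · simp
  · intro x _ hx
    have : ∀ y, ζ (x ^ 2 - x * y) = ζ (x ^ 2) * ζ (-x * y) := fun y => by
      rw [← AddChar.map_add_eq_mul]; congr 1; ring
    simp only [this, ← Finset.mul_sum, h.sum_addChar_mul (neg_ne_zero.2 hx), mul_zero]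
  · simp

lemma quadSum_ne_zero (h : IsQuarticPair ψ ζ) : quadSum ζ ≠ 0 := by
  intro h0
  have := h.quadSum_sq
  rw [h0, zero_pow two_ne_zero] at this
  exact Nat.cast_ne_zero.2 Fintype.card_ne_zero this.symm

/-- Completing the square. -/
lemma sum_quad (h : IsQuarticPair ψ ζ) {A : F} (hA : A ≠ 0) (B : F) :
    ∑ u, ζ (A * u ^ 2 + B * u) = ψ A ^ 2 * quadSum ζ * ζ (-(B ^ 2 / A)) := by
  rw [← h.sum_quad_monomial hA, Finset.sum_mul]
  refine Fintype.sum_equiv (Equiv.subRight (B / A)) _ _ fun u => ?_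
  simp only [Equiv.subRight_apply, ← AddChar.map_add_eq_mul]
  congr 1
  field_simp
  linear_combination (A * u * B) * (three_eq_zero : (3 : F) = 0)

/-- Frobenius invariance gives ζ(w³s³) = ζ(ws), so the summand is the character ζ((w − w³)s),
nontrivial unless w lies in 𝔽₃. -/
lemma sum_artinSchreier (h : IsQuarticPair ψ ζ) (w : F) (hw : w ^ 3 ≠ w) :
    ∑ s, ζ (w ^ 3 * (s ^ 3 - s)) = 0 := by
  rw [← h.sum_addChar_mul (sub_ne_zero.2 hw.symm)]
  refine Finset.sum_congr rfl fun s _ => ?_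
  rw [mul_sub, sub_eq_add_neg, AddChar.map_add_eq_mul, ← mul_pow, h.cube,
    ← AddChar.map_add_eq_mul]
  congr 1; ring

end IsQuarticPair

/-! ### Artin–Schreier sums, Kloosterman sums and a quadratic form over 𝔽₃ -/

namespace IsQuarticPair

variable {F : Type*} [Field F] [Fintype F] [CharP F 3] {ψ : MulChar F ℂ} {ζ : AddChar F ℂ}

lemma ne_one (h : IsQuarticPair ψ ζ) : ψ ≠ 1 := by
  have hc : ringChar F ≠ 2 := by rw [ringChar.eq F 3]; norm_num
  obtain ⟨a, ha⟩ := FiniteField.exists_nonsquare hc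
  rintro rfl
  have h0 : a ≠ 0 := by rintro rfl; exact ha IsSquare.zero
  have := h.sq_of_not_isSquare a ha
  rw [MulChar.one_apply h0.isUnit] at this
  norm_num at this

lemma sum_mul_artinSchreier (h : IsQuarticPair ψ ζ) (c : F → ℂ) :
    ∑ z, c z * ∑ s, ζ (z ^ 3 * (s ^ 3 - s)) = Fintype.card F * (c 0 + c 1 + c (-1)) := by
  classical
  have h01 : (0 : F) ∉ ({1, -1} : Finset F) := by simp
  have h11 : (1 : F) ∉ ({-1} : Finset F) := by
    rw [Finset.mem_singleton, ← two_eq_neg_one]; intro h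
    apply one_ne_zero (α := F); linear_combination h.symm
  rw [← Finset.sum_subset (Finset.subset_univ {0, 1, -1}), Finset.sum_insert h01,
    Finset.sum_insert h11, Finset.sum_singleton]
  · have h1 : ∑ s : F, ζ (1 ^ 3 * (s ^ 3 - s)) = Fintype.card F := by
      have : ∀ s : F, ζ (1 ^ 3 * (s ^ 3 - s)) = 1 := fun s => by
        rw [show 1 ^ 3 * (s ^ 3 - s) = s ^ 3 + -s by ring, AddChar.map_add_eq_mul, h.cube,
          ← AddChar.map_add_eq_mul]; simp
      simp only [this]; simp
    have h2 : ∑ s : F, ζ ((-1) ^ 3 * (s ^ 3 - s)) = Fintype.card F := by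
      have : ∀ s : F, ζ ((-1) ^ 3 * (s ^ 3 - s)) = 1 := fun s => by
        rw [show (-1) ^ 3 * (s ^ 3 - s) = s + (-s) ^ 3 by ring, AddChar.map_add_eq_mul, h.cube,
          ← AddChar.map_add_eq_mul]; simp
      simp [this]
    have h0 : ∑ s : F, ζ (0 ^ 3 * (s ^ 3 - s)) = Fintype.card F := by simp
    rw [h0, h1, h2]; ring
  · intro z _ hz
    rw [h.sum_artinSchreier z, mul_zero]
    intro hz3
    apply hz
    have : z * ((z - 1) * (z + 1)) = 0 := by linear_combination hz3
    rcases mul_eq_zero.1 this with h0 | h0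
    · simp [h0]
    rcases mul_eq_zero.1 h0 with h0 | h0
    · simp [sub_eq_zero.1 h0]
    · simp [eq_neg_of_add_eq_zero_left h0]

lemma addChar_add_neg {τ : F} (hτ : ζ τ ≠ 1) : ζ τ + ζ (-τ) = -1 := by
  have h1 : ζ τ * ζ (-τ) = 1 := by rw [← AddChar.map_add_eq_mul]; simp
  have h3 := addChar_pow_three ζ τ
  have h2 : ζ (-τ) = ζ τ ^ 2 := by linear_combination (-ζ (-τ)) * h3 + ζ τ ^ 2 * h1
  have : (ζ τ - 1) * (ζ τ ^ 2 + ζ τ + 1) = 0 := by linear_combination h3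
  rw [h2]
  linear_combination (mul_eq_zero.1 this).resolve_left (sub_ne_zero.2 hτ)

/-- Elements on which the additive character is trivial are of the form `s ^ 3 - s`. -/
lemma exists_artinSchreier (h : IsQuarticPair ψ ζ) {τ : F} (hτ : ζ τ = 1) :
    ∃ s, s ^ 3 - s = τ := by
  by_contra! hs
  -- Without a solution every inner sum vanishes by orthogonality. Replacing z by z³ and summing
  -- over s first leaves only z in 𝔽₃, and these three terms contribute 3q.
  have h1 : ∑ s : F, ∑ z : F, ζ ((s ^ 3 - s - τ) * z) = 0 :=
    Finset.sum_eq_zero fun s _ => h.sum_addChar_mul (sub_ne_zero.2 (hs s))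
  have h2 : ∀ s : F, ∑ z : F, ζ ((s ^ 3 - s - τ) * z) =
      ∑ z : F, ζ (-(z ^ 3 * τ)) * ζ (z ^ 3 * (s ^ 3 - s)) := fun s => by
    rw [← sum_cube]
    refine Finset.sum_congr rfl fun z _ => ?_
    rw [← AddChar.map_add_eq_mul]; congr 1; ring
  rw [Finset.sum_congr rfl fun s _ => h2 s, Finset.sum_comm] at h1
  simp only [← Finset.mul_sum] at h1
  rw [h.sum_mul_artinSchreier (fun z => ζ (-(z ^ 3 * τ)))] at h1
  have h3 : ζ (-τ) = 1 := by rw [AddChar.map_neg_eq_inv, hτ, inv_one]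
  have h4 : (-((-1 : F) ^ 3 * τ)) = τ := by ring
  simp only [h4, hτ] at h1
  simp [h3] at h1
  norm_num at h1

/-- The character sum of an irreducible Artin-Schreier polynomial. -/
lemma gaussSum_mul_artinSchreier (h : IsQuarticPair ψ ζ) {τ : F} (hτ : ζ τ ≠ 1) :
    gaussSum ψ ζ * conj (∑ s, ψ (s ^ 3 - s + τ)) = -Fintype.card F := by
  have h1 : gaussSum ψ ζ * conj (∑ s, ψ (s ^ 3 - s + τ)) =
      ∑ s : F, ∑ z : F, ψ z * ζ (z * (s ^ 3 - s + τ)) := by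
    rw [map_sum, Finset.mul_sum]
    exact Finset.sum_congr rfl fun s _ => by rw [h.sum_mulChar_addChar h.ne_one, mul_comm]
  have h2 : ∀ s : F, ∑ z : F, ψ z * ζ (z * (s ^ 3 - s + τ)) =
      ∑ z : F, (ψ (z ^ 3) * ζ (z ^ 3 * τ)) * ζ (z ^ 3 * (s ^ 3 - s)) := fun s => by
    rw [← sum_cube]
    refine Finset.sum_congr rfl fun z _ => ?_
    rw [mul_assoc, ← AddChar.map_add_eq_mul]; congr 2; ring
  rw [h1, Finset.sum_congr rfl fun s _ => h2 s, Finset.sum_comm]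
  simp only [← Finset.mul_sum]
  rw [h.sum_mul_artinSchreier (fun z => ψ (z ^ 3) * ζ (z ^ 3 * τ))]
  have h3 : ((-1 : F) ^ 3) = -1 := by ring
  simp only [h3, h.neg_one]
  -- The surviving terms z = ±1 contribute ζ(τ) + ζ(−τ), the sum of the two primitive cube roots of
  -- unity.
  have := addChar_add_neg hτ
  simp [mulChar_zero]
  linear_combination (Fintype.card F : ℂ) * this

/-- Expanding ψ and replacing z by z³ puts z³u³ into the exponent, which ζ does not distinguish from
zu. The exponent is then quadratic in u, and completing the square yields the term z⁻¹. -/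
lemma gaussSum_mul_cubic (h : IsQuarticPair ψ ζ) (C : F) :
    gaussSum ψ ζ * conj (∑ u, ψ (u ^ 3 - u ^ 2 + C)) =
      quadSum ζ * ∑ z, conj (ψ z) * ζ (z * C + z⁻¹) := by
  have h1 : gaussSum ψ ζ * conj (∑ u, ψ (u ^ 3 - u ^ 2 + C)) =
      ∑ u : F, ∑ z : F, ψ z * ζ (z * (u ^ 3 - u ^ 2 + C)) := by
    rw [map_sum, Finset.mul_sum]
    exact Finset.sum_congr rfl fun s _ => by rw [h.sum_mulChar_addChar h.ne_one, mul_comm]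
  rw [h1, Finset.sum_comm, ← sum_cube, ← sum_cube (fun z => conj (ψ z) * ζ (z * C + z⁻¹)),
    Finset.mul_sum]
  refine Finset.sum_congr rfl fun z _ => ?_
  rcases eq_or_ne z 0 with rfl | hz
  · simp [mulChar_zero]
  have h2 : ∀ u : F, ψ (z ^ 3) * ζ (z ^ 3 * (u ^ 3 - u ^ 2 + C)) =
      ψ (z ^ 3) * ζ (z ^ 3 * C) * ζ (-z ^ 3 * u ^ 2 + z * u) := fun u => by
    have : ζ (-z ^ 3 * u ^ 2 + z * u) = ζ (-z ^ 3 * u ^ 2 + (z * u) ^ 3) := by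
      rw [AddChar.map_add_eq_mul, AddChar.map_add_eq_mul, h.cube]
    rw [this, mul_assoc, ← AddChar.map_add_eq_mul]; congr 2; ring
  rw [Finset.sum_congr rfl fun u _ => h2 u, ← Finset.mul_sum,
    h.sum_quad (neg_ne_zero.2 (pow_ne_zero 3 hz)), h.conj_mulChar, h.neg]
  have h3 : -(z ^ 2 / -z ^ 3) = z⁻¹ := by field_simp
  have h4 : ζ ((z ^ 3)⁻¹) = ζ z⁻¹ := by rw [← h.cube z⁻¹, inv_pow]
  rw [h3, AddChar.map_add_eq_mul, h4, map_pow]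
  ring

/-- The twisted Kloosterman sum. -/
noncomputable def kloosterman (ψ : MulChar F ℂ) (ζ : AddChar F ℂ) (D : F) : ℂ :=
  ∑ z, ψ z * ζ (D * (z + z⁻¹))

lemma mulChar_inv (h : IsQuarticPair ψ ζ) (x : F) : ψ x⁻¹ = conj (ψ x) := by
  rcases eq_or_ne x 0 with rfl | hx
  · simp [mulChar_zero]
  have h1 : ψ x⁻¹ * ψ x = 1 := by rw [← map_mul, inv_mul_cancel₀ hx, map_one]
  rw [h.conj_mulChar]
  linear_combination (-ψ x⁻¹) * h.pow_four hx + ψ x ^ 3 * h1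

/-- The substitution z ↦ (Dz)⁻¹ makes the exponent symmetric; this is where it matters that the
constant of the cubic is a square. -/
lemma sum_conj_kloosterman (h : IsQuarticPair ψ ζ) {D : F} (hD : D ≠ 0) :
    ∑ z, conj (ψ z) * ζ (z * D ^ 2 + z⁻¹) = ψ D * kloosterman ψ ζ D := by
  rw [kloosterman, Finset.mul_sum]
  symm
  refine Fintype.sum_equiv ((Equiv.mulLeft₀ D hD).trans (Equiv.inv F)) _ _ fun z => ?_
  simp only [Equiv.trans_apply, Equiv.mulLeft₀_apply, Equiv.inv_apply, inv_inv]
  rw [← h.mulChar_inv, inv_inv, map_mul ψ, mul_assoc]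
  congr 3
  rcases eq_or_ne z 0 with rfl | hz
  · simp
  · field_simp
    ring

/-- Substitute z ↦ −z⁻¹ and use ψ(−1) = 1. Reality of the sum later supplies a second equation for
it. -/
lemma conj_kloosterman (h : IsQuarticPair ψ ζ) (D : F) :
    conj (kloosterman ψ ζ D) = kloosterman ψ ζ D := by
  rw [kloosterman, map_sum]
  refine Fintype.sum_equiv ((Equiv.neg F).trans (Equiv.inv F)) _ _ fun z => ?_
  simp only [Equiv.trans_apply, Equiv.neg_apply, Equiv.inv_apply, inv_inv, map_mul]
  rw [conj_addChar, h.mulChar_inv, h.neg]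
  congr 2
  rw [inv_neg]; ring

/-- Inversion exchanges ψ and ψ³, and ψ + ψ³ = (1 + ψ²)ψ, where 1 + ψ² counts square roots. -/
lemma two_mul_kloosterman (h : IsQuarticPair ψ ζ) (D : F) :
    2 * kloosterman ψ ζ D = ∑ r, ψ r ^ 2 * ζ (D * (r ^ 2 + (r ^ 2)⁻¹)) := by
  have h1 : kloosterman ψ ζ D = ∑ z, ψ z ^ 3 * ζ (D * (z + z⁻¹)) := by
    refine Fintype.sum_equiv (Equiv.inv F) _ _ fun z => ?_
    simp only [Equiv.inv_apply, inv_inv]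
    rw [h.mulChar_inv, h.conj_mulChar, add_comm z]
    linear_combination (-(1 + ψ z ^ 4) * ζ (D * (z⁻¹ + z))) * h.pow_five z
  have h2 := h.sum_sq (fun z => ψ z * ζ (D * (z + z⁻¹)))
  simp only [map_pow] at h2
  rw [h2, two_mul]; nth_rw 2 [h1]
  rw [kloosterman, ← Finset.sum_add_distrib]
  exact Finset.sum_congr rfl fun z _ => by ring

/-- In characteristic 3 the equation r + r⁻¹ = p reads (r + p)² = p² − 1, which has 1 + ψ(p² − 1)²
solutions. Moreover (r + 1)² = r(p − 1) and (r − 1)² = r(p + 1), so r has the quadratic character of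
p − 1, or of p + 1 when p = 1. -/
lemma sum_fiber_add_inv (h : IsQuarticPair ψ ζ) [DecidableEq F] (p : F) :
    ∑ r ∈ Finset.univ.filter (fun r : F => r + r⁻¹ = p), ψ r ^ 2 =
      ψ (p - 1) ^ 2 + ψ (p + 1) ^ 2 := by
  have h3 := (three_eq_zero : (3 : F) = 0)
  have e1 : ∑ r ∈ Finset.univ.filter (fun r : F => r + r⁻¹ = p), ψ r ^ 2 =
      ∑ r ∈ Finset.univ.filter (fun r : F => (r + p) ^ 2 = p ^ 2 - 1), ψ r ^ 2 := by
    symm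
    refine Finset.sum_subset_zero_on_sdiff ?_ ?_ fun _ _ => rfl
    · intro r hr
      simp only [Finset.mem_filter, Finset.mem_univ, true_and] at hr ⊢
      have hr0 : r ≠ 0 := by
        rintro rfl
        apply one_ne_zero (α := F); linear_combination hr
      field_simp
      linear_combination hr - p * r * h3
    · intro r hr
      simp only [Finset.mem_sdiff, Finset.mem_filter, Finset.mem_univ, true_and] at hr
      rcases eq_or_ne r 0 with rfl | hr0
      · simp [mulChar_zero]
      · exfalso; apply hr.2
        have := hr.1
        field_simp at this
        linear_combination this + p * r * h3
  have e2 : (((Finset.univ.filter fun r : F => (r + p) ^ 2 = p ^ 2 - 1).card : ℕ) : ℂ) =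
      1 + ψ (p ^ 2 - 1) ^ 2 := by
    rw [← h.card_sqrt two_ne_zero']
    congr 1
    refine Finset.card_equiv (Equiv.addRight p) fun r => ?_
    simp
  have e3 : ∀ c : F, c ≠ 0 → ∀ b : F, ∀ r : F, r ≠ 0 → b ^ 2 = r * c → ψ r ^ 2 = ψ c ^ 2 := by
    intro c hc b r hr hb
    have hb0 : b ≠ 0 := by
      rintro rfl
      exact mul_ne_zero hr hc (by rw [← hb]; ring)
    have h4 := h.pow_four hb0
    have h5 : ψ r ^ 2 * ψ c ^ 2 = 1 := by
      rw [← mul_pow, ← map_mul, ← hb, map_pow, ← pow_mul, h4]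
    linear_combination (ψ c ^ 2) * h5 - ψ r ^ 2 * h.pow_four hc
  have e4 : ∀ x : F, (x + p) ^ 2 = p ^ 2 - 1 → x ≠ 0 := by
    rintro x hx rfl
    apply one_ne_zero (α := F); linear_combination hx
  rw [e1, show p ^ 2 - 1 = (p - 1) * (p + 1) by ring] at *
  rcases eq_or_ne p 1 with rfl | hp
  · have : ∀ r ∈ Finset.univ.filter (fun r : F => (r + 1) ^ 2 = (1 - 1) * (1 + 1)),
        ψ r ^ 2 = ψ (1 + 1) ^ 2 := by
      intro r hr
      simp only [Finset.mem_filter, Finset.mem_univ, true_and] at hr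
      refine e3 _ (by rw [one_add_one_eq_two]; exact two_ne_zero') (r - 1) r ?_ ?_
      · rintro rfl; norm_num at hr
      · linear_combination hr - 2 * r * h3
    rw [Finset.sum_congr rfl this, Finset.sum_const, nsmul_eq_mul, e2]
    simp [mulChar_zero]
  · have hp1 := sub_ne_zero.2 hp
    have : ∀ r ∈ Finset.univ.filter (fun r : F => (r + p) ^ 2 = (p - 1) * (p + 1)),
        ψ r ^ 2 = ψ (p - 1) ^ 2 := by
      intro r hr
      simp only [Finset.mem_filter, Finset.mem_univ, true_and] at hr
      refine e3 _ hp1 (r + 1) r (e4 r (by linear_combination hr)) ?_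
      linear_combination hr + (r - p * r) * h3
    rw [Finset.sum_congr rfl this, Finset.sum_const, nsmul_eq_mul, e2, map_mul]
    linear_combination (ψ (p + 1) ^ 2) * h.pow_four hp1

/-- Group r by p = r + r⁻¹, so that r² + r⁻² = p² + 1. The two resulting sums have the same value,
after the substitutions p ↦ 1 − p and p ↦ p + 1. -/
lemma kloosterman_eq_sum (h : IsQuarticPair ψ ζ) (D : F) :
    kloosterman ψ ζ D = ∑ p, ψ p ^ 2 * ζ (D * (p ^ 2 + p - 1)) := by
  classical
  have h3 := (three_eq_zero : (3 : F) = 0)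
  have h1 : 2 * kloosterman ψ ζ D = ∑ p, (ψ (p - 1) ^ 2 + ψ (p + 1) ^ 2) * ζ (D * (p ^ 2 + 1)) := by
    rw [h.two_mul_kloosterman,
      ← Finset.sum_fiberwise (s := Finset.univ) (g := fun r : F => r + r⁻¹)]
    refine Finset.sum_congr rfl fun p _ => ?_
    rw [← h.sum_fiber_add_inv, Finset.sum_mul]
    refine Finset.sum_congr rfl fun r hr => ?_
    simp only [Finset.mem_filter, Finset.mem_univ, true_and] at hr
    rcases eq_or_ne r 0 with rfl | hr0
    · simp [mulChar_zero]
    congr 3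
    rw [← hr]
    field_simp
    linear_combination (-r ^ 2) * h3
  have h2 : ∑ p, ψ (p - 1) ^ 2 * ζ (D * (p ^ 2 + 1)) =
      ∑ p, ψ p ^ 2 * ζ (D * (p ^ 2 + p - 1)) := by
    refine Fintype.sum_equiv ((Equiv.subRight 1).trans (Equiv.neg F)) _ _ fun p => ?_
    simp only [Equiv.trans_apply, Equiv.subRight_apply, Equiv.neg_apply, h.neg]
    congr 2
    linear_combination D * (p) * h3
  have h4 : ∑ p, ψ (p + 1) ^ 2 * ζ (D * (p ^ 2 + 1)) =
      ∑ p, ψ p ^ 2 * ζ (D * (p ^ 2 + p - 1)) := by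
    refine Fintype.sum_equiv (Equiv.addRight 1) _ _ fun p => ?_
    simp only [Equiv.coe_addRight]
    congr 2
    linear_combination (-D * (p)) * h3
  simp only [add_mul, Finset.sum_add_distrib] at h1
  rw [h2, h4] at h1
  linear_combination h1 / 2

/-- The exponential sum of the quadratic form `x ^ 2 - x ^ 4 / D` over the prime field. -/
noncomputable def quarticSum (ζ : AddChar F ℂ) (D : F) : ℂ := ∑ x, ζ (x ^ 2 - x ^ 4 / D)

/-- Write ψ(p)² times the quadratic Gauss sum as ∑ₓ ζ(px²) and sum over p first by completing the
square. The term p = 0 does not fit this pattern and causes the correction q ζ(−D). -/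
lemma quadSum_mul_kloosterman (h : IsQuarticPair ψ ζ) {D : F} (hD : D ≠ 0) :
    quadSum ζ * kloosterman ψ ζ D =
      ψ D ^ 2 * ζ D * quadSum ζ * quarticSum ζ D - Fintype.card F * ζ (-D) := by
  classical
  have h3 := (three_eq_zero : (3 : F) = 0)
  have h1 : ∑ p : F, ∑ x : F, ζ (p * x ^ 2) * ζ (D * (p ^ 2 + p - 1)) =
      quadSum ζ * kloosterman ψ ζ D + Fintype.card F * ζ (-D) := by
    have : ∀ p : F, ∑ x : F, ζ (p * x ^ 2) * ζ (D * (p ^ 2 + p - 1)) =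
        quadSum ζ * (ψ p ^ 2 * ζ (D * (p ^ 2 + p - 1))) +
          if p = 0 then Fintype.card F * ζ (-D) else 0 := by
      intro p
      rw [← Finset.sum_mul]
      split_ifs with hp
      · subst hp; simp [mulChar_zero]
      · rw [h.sum_quad_monomial hp]; ring
    rw [Finset.sum_congr rfl fun p _ => this p, Finset.sum_add_distrib, ← Finset.mul_sum,
      ← h.kloosterman_eq_sum]
    simp
  have h2 : ∀ x : F, ∑ p : F, ζ (p * x ^ 2) * ζ (D * (p ^ 2 + p - 1)) =
      ψ D ^ 2 * ζ D * quadSum ζ * ζ (x ^ 2 - x ^ 4 / D) := by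
    intro x
    have : ∀ p : F, ζ (p * x ^ 2) * ζ (D * (p ^ 2 + p - 1)) =
        ζ (D * p ^ 2 + (D + x ^ 2) * p) * ζ (-D) := fun p => by
      simp only [← AddChar.map_add_eq_mul]; congr 1; ring
    rw [Finset.sum_congr rfl fun p _ => this p, ← Finset.sum_mul, h.sum_quad hD]
    have e : ζ (-((D + x ^ 2) ^ 2 / D)) * ζ (-D) = ζ D * ζ (x ^ 2 - x ^ 4 / D) := by
      simp only [← AddChar.map_add_eq_mul]; congr 1; field_simp
      linear_combination (-(D ^ 2) - D * x ^ 2) * h3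
    linear_combination (ψ D ^ 2 * quadSum ζ) * e
  rw [Finset.sum_comm, Finset.sum_congr rfl fun x _ => h2 x, ← Finset.mul_sum] at h1
  rw [quarticSum]
  linear_combination -h1

/-- Since x⁴ = x · x³, the exponent is, under ζ, a quadratic form over 𝔽₃. The squared modulus of
its exponential sum is q times the size of the radical, provided that ζ of the form is 1 there. -/
lemma quarticSum_mul_conj (h : IsQuarticPair ψ ζ) [DecidableEq F] {D : F} (hD : D ≠ 0) :
    quarticSum ζ D * conj (quarticSum ζ D) = Fintype.card F *
      (Finset.univ.filter fun x : F => x ^ 9 + D ^ 3 * x ^ 3 + D ^ 2 * x = 0).card := by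
  have h3 := (three_eq_zero : (3 : F) = 0)
  -- With the cube root c(x) of x/D, ζ(y³x/D) = ζ(y c(x)), so the polar form becomes linear in y;
  -- cubing the radical condition removes c.
  choose c hc using fun x : F => exists_cubeRoot (x / D)
  have e1 : quarticSum ζ D * conj (quarticSum ζ D) =
      ∑ y : F, ∑ x : F, ζ (x ^ 2 - x ^ 4 / D + -(y ^ 2 - y ^ 4 / D)) := by
    rw [quarticSum, map_sum, Finset.sum_mul_sum, Finset.sum_comm]
    simp only [conj_addChar, AddChar.map_add_eq_mul]
  have e2 : ∀ x y : F, ζ (-(y ^ 3 * x / D)) = ζ (-(y * c x)) := fun x y => by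
    rw [← h.cube (-(y * c x))]; congr 1
    rw [neg_pow, mul_pow, hc]; ring
  have e3 : ∀ y : F, ∑ x : F, ζ (x ^ 2 - x ^ 4 / D + -(y ^ 2 - y ^ 4 / D)) =
      ∑ x : F, ζ (x ^ 2 - x ^ 4 / D) * ζ ((2 * x - x ^ 3 / D - c x) * y) := by
    intro y
    refine Fintype.sum_equiv (Equiv.subRight y) _ _ fun x => ?_
    simp only [Equiv.subRight_apply]
    generalize hz : x - y = z
    obtain rfl : x = z + y := by rw [← hz]; ring
    rw [show (2 * z - z ^ 3 / D - c z) * y = (2 * z * y - z ^ 3 * y / D) + -(y * c z) by ring,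
      AddChar.map_add_eq_mul (x := 2 * z * y - z ^ 3 * y / D), ← e2, ← AddChar.map_add_eq_mul,
      ← AddChar.map_add_eq_mul]
    congr 1
    field_simp
    linear_combination (-(z ^ 3 * y + 2 * z ^ 2 * y ^ 2 + z * y ^ 3)) * h3
  have e4 : ∀ x : F, 2 * x - x ^ 3 / D - c x = 0 ↔ x ^ 9 + D ^ 3 * x ^ 3 + D ^ 2 * x = 0 := by
    intro x
    rw [sub_eq_zero]
    have e5 : (2 * x - x ^ 3 / D) ^ 3 - c x ^ 3 =
        -(x ^ 9 + D ^ 3 * x ^ 3 + D ^ 2 * x) / D ^ 3 := by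
      rw [hc]; field_simp
      linear_combination (3 * D ^ 3 * x ^ 3 - 4 * D ^ 2 * x ^ 5 + 2 * D * x ^ 7) * h3
    constructor
    · intro hx
      rw [hx, sub_self] at e5
      have := (div_eq_zero_iff.1 e5.symm).resolve_right (pow_ne_zero 3 hD)
      exact neg_eq_zero.1 this
    · intro hx
      rw [hx, neg_zero, zero_div, sub_eq_zero] at e5
      exact cube_injective e5
  rw [e1, Finset.sum_congr rfl fun y _ => e3 y, Finset.sum_comm]
  simp only [← Finset.mul_sum]
  rw [Finset.card_filter, Nat.cast_sum, Finset.mul_sum]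
  refine Finset.sum_congr rfl fun x _ => ?_
  split_ifs with hx
  · rw [← e4] at hx
    -- On the diagonal the polar form is twice the quadratic form, and a cube root of unity with
    -- square 1 is 1.
    have : ζ (x ^ 2 - x ^ 4 / D) = 1 := by
      apply addChar_eq_one_of_sq
      have h1 : ζ ((2 * x - x ^ 3 / D - c x) * x) = 1 := by rw [hx]; simp
      rw [show (2 * x - x ^ 3 / D - c x) * x = (2 * x * x - x ^ 3 * x / D) + -(x * c x) by ring,
        AddChar.map_add_eq_mul, ← e2, ← AddChar.map_add_eq_mul] at h1
      rw [← h1, sq, ← AddChar.map_add_eq_mul]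
      congr 1; ring
    simp [hx, this]
  · rw [h.sum_addChar_mul (fun h0 => hx ((e4 x).1 h0))]; simp

end IsQuarticPair

/-! ### Evaluation of the cubic character sum -/

namespace IsQuarticPair

variable {F : Type*} [Field F] [Fintype F] [CharP F 3] {ψ : MulChar F ℂ} {ζ : AddChar F ℂ}

lemma mulChar_sq_sq (h : IsQuarticPair ψ ζ) {x : F} (hx : x ≠ 0) : ψ x ^ 2 = 1 ∨ ψ x ^ 2 = -1 := by
  have h4 := h.pow_four hx
  have : (ψ x ^ 2 - 1) * (ψ x ^ 2 + 1) = 0 := by linear_combination h4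
  exact (mul_eq_zero.1 this).imp sub_eq_zero.1 eq_neg_of_add_eq_zero_left

lemma addChar_ne_one_ne_zero {t : F} (ht : ζ t ≠ 1) : t ≠ 0 := by
  rintro rfl; exact ht (AddChar.map_zero_eq_one ζ)

/-- If t² = −1 then t³ = −t, so ζ(−t) = ζ(t), which forces ζ(t) = 1. -/
lemma addChar_ne_one_sq_add_one_ne_zero (h : IsQuarticPair ψ ζ) {t : F} (ht : ζ t ≠ 1) :
    t ^ 2 + 1 ≠ 0 := by
  intro h0
  apply ht
  apply addChar_eq_one_of_sq
  have h1 : ζ (-t) = ζ t := by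
    rw [← h.cube t]; congr 1; linear_combination (-t) * h0
  rw [sq]; nth_rw 1 [← h1]
  rw [← AddChar.map_add_eq_mul]; simp

/-- The parameter equals t + (t⁻³ − t⁻¹), and ζ kills the bracket. -/
lemma addChar_param (h : IsQuarticPair ψ ζ) {t : F} (ht : t ≠ 0) :
    ζ ((t ^ 2 + 1) ^ 2 / t ^ 3) = ζ t := by
  have h1 : (t ^ 2 + 1) ^ 2 / t ^ 3 = t + (-t⁻¹ + (t⁻¹) ^ 3) := by
    field_simp
    linear_combination (t ^ 2) * (three_eq_zero : (3 : F) = 0)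
  rw [h1, AddChar.map_add_eq_mul, AddChar.map_add_eq_mul, h.cube, ← AddChar.map_add_eq_mul]
  simp

/-- For x ≠ 0 and Z = x²t³/(t² + 1) the equation factors as (Z + 1)(Z(Z + 1)² + t⁶) = 0. A zero of
the second factor gives t³ = v − v³ with v = t³/(Z + 1), hence ζ(t) = 1. Only Z = −1 is left, and it
is a condition on x². -/
lemma card_radical (h : IsQuarticPair ψ ζ) [DecidableEq F] {t : F} (ht : ζ t ≠ 1) :
    (((Finset.univ.filter fun x : F => x ^ 9 + ((t ^ 2 + 1) ^ 2 / t ^ 3) ^ 3 * x ^ 3 +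
      ((t ^ 2 + 1) ^ 2 / t ^ 3) ^ 2 * x = 0).card : ℕ) : ℂ) = 2 + ψ (t * (t ^ 2 + 1)) ^ 2 := by
  have h3 := (three_eq_zero : (3 : F) = 0)
  have ht0 := addChar_ne_one_ne_zero ht
  have ht1 := h.addChar_ne_one_sq_add_one_ne_zero ht
  have key : (Finset.univ.filter fun x : F => x ^ 9 + ((t ^ 2 + 1) ^ 2 / t ^ 3) ^ 3 * x ^ 3 +
      ((t ^ 2 + 1) ^ 2 / t ^ 3) ^ 2 * x = 0) =
      insert 0 (Finset.univ.filter fun x : F => x ^ 2 = -((t ^ 2 + 1) / t ^ 3)) := by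
    ext x
    simp only [Finset.mem_filter, Finset.mem_univ, true_and, Finset.mem_insert]
    rcases eq_or_ne x 0 with rfl | hx
    · simp
    simp only [hx, false_or]
    set Z : F := x ^ 2 * t ^ 3 / (t ^ 2 + 1) with hZ
    have e1 : x ^ 9 + ((t ^ 2 + 1) ^ 2 / t ^ 3) ^ 3 * x ^ 3 + ((t ^ 2 + 1) ^ 2 / t ^ 3) ^ 2 * x =
        x * (t ^ 2 + 1) ^ 4 / t ^ 12 * ((Z + 1) * (Z * (Z + 1) ^ 2 + t ^ 6)) := by
      have e0 : x ^ 9 + ((t ^ 2 + 1) ^ 2 / t ^ 3) ^ 3 * x ^ 3 +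
          ((t ^ 2 + 1) ^ 2 / t ^ 3) ^ 2 * x =
          x * (t ^ 2 + 1) ^ 4 / t ^ 12 * (Z ^ 4 + Z * (t ^ 2 + 1) ^ 3 + t ^ 6) := by
        rw [hZ]; field_simp
      rw [e0]
      linear_combination (x * (t ^ 2 + 1) ^ 4 / t ^ 12 * (Z * (t ^ 4 + t ^ 2) - Z ^ 3 - Z ^ 2)) * h3
    have e2 : Z + 1 = 0 ↔ x ^ 2 = -((t ^ 2 + 1) / t ^ 3) := by
      rw [hZ]
      constructor
      · intro h0; field_simp at h0 ⊢; linear_combination h0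
      · intro h0; rw [h0]; field_simp; ring
    rw [e1, ← e2, mul_eq_zero, mul_eq_zero]
    constructor
    · rintro (h0 | h0 | h0)
      · exfalso
        exact div_ne_zero (mul_ne_zero hx (pow_ne_zero _ ht1)) (pow_ne_zero _ ht0) h0
      · exact h0
      · exfalso
        apply ht
        have hZ1 : Z + 1 ≠ 0 := by
          intro h1; rw [h1] at h0
          exact pow_ne_zero 6 ht0 (by linear_combination h0)
        have e3 : t ^ 3 = t ^ 3 / (Z + 1) - (t ^ 3 / (Z + 1)) ^ 3 := by
          field_simp
          linear_combination h0
        rw [← h.cube t, e3, sub_eq_add_neg, AddChar.map_add_eq_mul,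
          ← Odd.neg_pow (by decide : Odd 3), h.cube, ← AddChar.map_add_eq_mul]
        simp
    · exact fun h0 => Or.inr (Or.inl h0)
  rw [key, Finset.card_insert_of_notMem, Nat.cast_add, h.card_sqrt two_ne_zero', h.neg]
  · have e : ψ ((t ^ 2 + 1) / t ^ 3) ^ 2 = ψ (t * (t ^ 2 + 1)) ^ 2 := by
      have : t * (t ^ 2 + 1) = (t ^ 2 + 1) / t ^ 3 * t ^ 4 := by field_simp
      rw [this, map_mul, map_pow ψ, h.pow_four ht0, mul_one]
    rw [e]; push_cast; ring
  · simp only [Finset.mem_filter, Finset.mem_univ, true_and]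
    intro h0
    have : (t ^ 2 + 1) / t ^ 3 = 0 := by
      rw [zero_pow two_ne_zero] at h0
      exact neg_eq_zero.1 h0.symm
    exact div_ne_zero ht1 (pow_ne_zero _ ht0) this

lemma exists_int_sum (h : IsQuarticPair ψ ζ) {ι : Type*} (s : Finset ι) (f : ι → F)
    (hf : ∀ i ∈ s, f i ≠ 0) :
    ∃ a b : ℤ, ∑ i ∈ s, ψ (f i) = a + b * Complex.I ∧ (2 : ℤ) ∣ a + b - s.card := by
  classical
  induction s using Finset.induction_on with
  | empty => exact ⟨0, 0, by simp⟩
  | insert i s hi ih =>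
    obtain ⟨a, b, hab, hd⟩ := ih fun j hj => hf j (Finset.mem_insert_of_mem hj)
    rw [Finset.sum_insert hi, Finset.card_insert_of_notMem hi, hab]
    rcases h.mulChar_cases (hf i (Finset.mem_insert_self i s)) with h1 | h1 | h1 | h1
    · exact ⟨a + 1, b, by rw [h1]; push_cast; ring, by push_cast; omega⟩
    · exact ⟨a - 1, b, by rw [h1]; push_cast; ring, by push_cast; omega⟩
    · exact ⟨a, b + 1, by rw [h1]; push_cast; ring, by push_cast; omega⟩
    · exact ⟨a, b - 1, by rw [h1]; push_cast; ring, by push_cast; omega⟩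

/-- The norm a² + b² of a Gaussian integer has the parity of a + b, and each fourth root of unity
changes a + b by ±1. This parity rules out the spurious roots of the quadratic equation for the
Kloosterman sum. -/
lemma sum_mul_conj_odd (h : IsQuarticPair ψ ζ) {ι : Type*} (s : Finset ι) (f : ι → F)
    (hf : ∀ i ∈ s, f i ≠ 0) (hs : Odd s.card) :
    ∃ n : ℤ, Odd n ∧ (∑ i ∈ s, ψ (f i)) * conj (∑ i ∈ s, ψ (f i)) = n := by
  obtain ⟨a, b, hab, hd⟩ := h.exists_int_sum s f hf
  refine ⟨a ^ 2 + b ^ 2, ?_, ?_⟩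
  · obtain ⟨k, hk⟩ := hs
    have : Odd (a + b) := by
      obtain ⟨m, hm⟩ := hd
      exact ⟨m + k, by rw [hk] at hm; push_cast at hm; linarith⟩
    rw [show a ^ 2 + b ^ 2 = (a + b) ^ 2 - 2 * (a * b) by ring]
    exact this.pow.sub_even (even_two_mul _)
  · rw [hab, map_add, map_mul, Complex.conj_I, map_intCast, map_intCast]
    push_cast
    linear_combination (-(b : ℂ) ^ 2) * Complex.I_sq

lemma gaussSum_mul_conj (h : IsQuarticPair ψ ζ) :
    gaussSum ψ ζ * conj (gaussSum ψ ζ) = Fintype.card F := by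
  have := star_gaussSum_eq ψ ζ
  rw [starRingEnd_apply, this]
  exact gaussSum_mul_gaussSum_eq_card h.ne_one h.primitive

lemma odd_card : Odd (Fintype.card F) := by
  obtain ⟨n, _, hn⟩ := FiniteField.card F 3
  rw [hn]; exact Odd.pow (by decide)

/-- The evaluation of the quartic character sums of cubic polynomials with a linear factor of the
derivative. -/
theorem sum_cubic (h : IsQuarticPair ψ ζ) {t τ : F} (ht : ζ t ≠ 1) (hτ : ζ τ ≠ 1)
    (hf : ∀ u : F, u ^ 3 - u ^ 2 + ((t ^ 2 + 1) ^ 2 / t ^ 3) ^ 2 ≠ 0) :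
    ∑ u, ψ (u ^ 3 - u ^ 2 + ((t ^ 2 + 1) ^ 2 / t ^ 3) ^ 2) =
      ψ t * ∑ s, ψ (s ^ 3 - s + τ) := by
  classical
  have ht0 := addChar_ne_one_ne_zero ht
  have ht1 := h.addChar_ne_one_sq_add_one_ne_zero ht
  set D : F := (t ^ 2 + 1) ^ 2 / t ^ 3 with hD
  have hD0 : D ≠ 0 := div_ne_zero (pow_ne_zero _ ht1) (pow_ne_zero _ ht0)
  set K := kloosterman ψ ζ D
  set G := quadSum ζ
  have hG0 : G ≠ 0 := h.quadSum_ne_zero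
  have hG : G ^ 2 = Fintype.card F := h.quadSum_sq
  have hGc : conj G = G := h.conj_quadSum
  have hKc : conj K = K := h.conj_kloosterman D
  set W := ∑ u, ψ (u ^ 3 - u ^ 2 + D ^ 2) with hW
  have hgW : gaussSum ψ ζ * conj W = G * (ψ D * K) := by
    rw [hW, h.gaussSum_mul_cubic, h.sum_conj_kloosterman hD0]
  have hg := h.gaussSum_mul_conj
  have hq0 : (Fintype.card F : ℂ) ≠ 0 := Nat.cast_ne_zero.2 Fintype.card_ne_zero
  have hg0 : gaussSum ψ ζ ≠ 0 := by
    intro h0; rw [h0, zero_mul] at hg; exact hq0 hg.symm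
  -- the quadratic equation for `K`
  have hz : ζ t ^ 2 + ζ t + 1 = 0 := by
    have h3 := addChar_pow_three ζ t
    have : (ζ t - 1) * (ζ t ^ 2 + ζ t + 1) = 0 := by linear_combination h3
    exact (mul_eq_zero.1 this).resolve_left (sub_ne_zero.2 ht)
  have hzc : conj (ζ t) = ζ t ^ 2 := by
    have h1 : ζ t * ζ (-t) = 1 := by rw [← AddChar.map_add_eq_mul]; simp
    rw [conj_addChar]
    linear_combination (-ζ (-t)) * addChar_pow_three ζ t + ζ t ^ 2 * h1
  set A := ψ D ^ 2 * quarticSum ζ D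
  have hA : A * conj A = G ^ 2 * (2 + ψ (t * (t ^ 2 + 1)) ^ 2) := by
    have h1 := h.quarticSum_mul_conj hD0
    rw [hD, h.card_radical ht, ← hD, ← hG] at h1
    rw [← h1]
    simp only [A, map_mul, map_pow, h.conj_mulChar]
    linear_combination (quarticSum ζ D * conj (quarticSum ζ D) * (1 + ψ D ^ 4)) * h.pow_four hD0
  have hK : K = ζ t * A - G * ζ t ^ 2 := by
    have h1 := h.quadSum_mul_kloosterman hD0
    have h2 : ζ (-D) = ζ t ^ 2 := by
      rw [← conj_addChar, ← hzc, hD, h.addChar_param ht0]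
    rw [h2, ← hG] at h1
    have h3 : ζ D = ζ t := by rw [hD, h.addChar_param ht0]
    rw [h3] at h1
    apply mul_left_cancel₀ hG0
    linear_combination h1
  have hKc' : K = ζ t ^ 2 * conj A - G * ζ t := by
    have := congrArg conj hK
    rw [hKc] at this
    rw [this]
    simp only [map_sub, map_mul, map_pow, hGc, hzc]
    linear_combination (-G * ζ t) * addChar_pow_three ζ t
  -- Multiply ζ(t)A = K + Gζ(t)² by its conjugate ζ(t)²·conj A = K + Gζ(t), use ζ(t) + ζ(t)² = −1
  -- and insert the value of A·conj A.
  have hquad : K ^ 2 - K * G - G ^ 2 * (1 + ψ (t * (t ^ 2 + 1)) ^ 2) = 0 := by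
    linear_combination (K + G * ζ t) * hK + ζ t * A * hKc' + ζ t ^ 3 * hA - K * G * hz +
      G ^ 2 * (1 + ψ (t * (t ^ 2 + 1)) ^ 2) * addChar_pow_three ζ t
  obtain ⟨n, hn, hnW⟩ := h.sum_mul_conj_odd Finset.univ
    (fun u : F => u ^ 3 - u ^ 2 + D ^ 2) (fun u _ => hf u) (by rw [Finset.card_univ]; exact odd_card)
  -- The Gauss sum and G both have squared modulus q, so the relation `hgW` gives |W|² = K².
  have hnK : (n : ℂ) = K ^ 2 := by
    have h1 := congrArg conj hgW
    simp only [map_mul, Complex.conj_conj, hGc, hKc, h.conj_mulChar] at h1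
    apply mul_left_cancel₀ hq0
    rw [← hnW]
    linear_combination (-(W * conj W)) * hg + conj W * gaussSum ψ ζ * h1 +
      G * ψ D ^ 3 * K * hgW + K ^ 2 * hG + G ^ 2 * K ^ 2 * h.pow_four hD0
  have hne : ∀ m : ℤ, K ^ 2 ≠ ((2 * m : ℤ) : ℂ) := by
    intro m hm
    rw [← hnK] at hm
    have : n = 2 * m := by exact_mod_cast hm
    exact (Int.not_even_iff_odd.2 hn) ⟨m, by rw [this]; ring⟩
  -- The roots are 2G and −G when t(t² + 1) is a square, and 0 and G otherwise. The roots 2G and 0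
  -- would make K² equal to 4q or 0, both even.
  have hKG : K = -ψ (t * (t ^ 2 + 1)) ^ 2 * G := by
    rcases h.mulChar_sq_sq (mul_ne_zero ht0 ht1) with h1 | h1
    · rw [h1] at hquad ⊢
      have : (K - 2 * G) * (K + G) = 0 := by linear_combination hquad
      rcases mul_eq_zero.1 this with h2 | h2
      · exfalso
        apply hne (2 * Fintype.card F)
        rw [sub_eq_zero.1 h2, mul_pow, hG]; push_cast; ring
      · linear_combination h2
    · rw [h1] at hquad ⊢
      have : K * (K - G) = 0 := by linear_combination hquad
      rcases mul_eq_zero.1 this with h2 | h2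
      · exfalso
        apply hne 0
        rw [h2]; simp
      · linear_combination h2
  have hDψ : ψ D = ψ (t ^ 2 + 1) ^ 2 * ψ t := by
    have h1 : D * t ^ 3 = (t ^ 2 + 1) ^ 2 := by rw [hD]; field_simp
    have h2 : ψ D * ψ t ^ 3 = ψ (t ^ 2 + 1) ^ 2 := by rw [← map_pow, ← map_mul, h1, map_pow]
    linear_combination ψ t * h2 - ψ D * h.pow_four ht0
  have hfin : conj W = conj (ψ t) * conj (∑ s, ψ (s ^ 3 - s + τ)) := by
    apply mul_left_cancel₀ hg0
    rw [hgW, hKG, hDψ, map_mul, h.conj_mulChar]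
    have h1 := h.gaussSum_mul_artinSchreier hτ
    linear_combination (-ψ t ^ 3) * h1 - ψ t ^ 3 * ψ (t ^ 2 + 1) ^ 4 * hG -
      ψ t ^ 3 * Fintype.card F * h.pow_four ht1
  rw [← map_mul] at hfin
  exact (starRingEnd ℂ).injective hfin

end IsQuarticPair

/-! ### Reality of the Artin–Schreier sum and existence of the characters -/

namespace IsQuarticPair

variable {F : Type*} [Field F] [Fintype F] [CharP F 3] {ψ : MulChar F ℂ} {ζ : AddChar F ℂ}

/-- The quartic sum of an irreducible Artin-Schreier polynomial is plus or minus `√q`. -/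
lemma artinSchreier_eq_real (h : IsQuarticPair ψ ζ) {τ : F} (hτ : ζ τ ≠ 1) :
    ∃ w : ℝ, ∑ s, ψ (s ^ 3 - s + τ) = w ∧ w ^ 2 = Fintype.card F := by
  set W := ∑ s, ψ (s ^ 3 - s + τ) with hW
  have hc : conj W = W := by
    -- The permutation s ↦ s³ + τ cubes the value of the polynomial, and ψ³ is the conjugate of ψ.
    rw [hW, map_sum]
    refine Fintype.sum_equiv ((frobeniusEquiv F 3).toEquiv.trans (Equiv.addRight τ)) _ _
      fun s => ?_
    simp only [Equiv.trans_apply, RingEquiv.toEquiv_eq_coe, EquivLike.coe_coe,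
      frobeniusEquiv_apply, frobenius_def, Equiv.coe_addRight]
    rw [h.conj_mulChar, ← map_pow]
    congr 1
    linear_combination (-s ^ 7 + s ^ 5 - 2 * s ^ 4 * τ + s ^ 2 * τ - s * τ ^ 2) *
      (three_eq_zero : (3 : F) = 0)
  have h1 := h.gaussSum_mul_artinSchreier hτ
  rw [← hW, hc] at h1
  have h2 := congrArg conj h1
  simp only [map_mul, map_neg, map_natCast, hc] at h2
  obtain ⟨w, hw⟩ := Complex.conj_eq_iff_real.1 hc
  refine ⟨w, hw, ?_⟩
  have hq0 : (Fintype.card F : ℂ) ≠ 0 := Nat.cast_ne_zero.2 Fintype.card_ne_zero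
  have h3 : W ^ 2 = Fintype.card F := by
    apply mul_left_cancel₀ hq0
    linear_combination (-W ^ 2) * h.gaussSum_mul_conj + conj (gaussSum ψ ζ) * W * h1 -
      Fintype.card F * h2
  rw [hw] at h3
  exact_mod_cast h3

/-- Existence of a quartic pair, with a prescribed value at a primitive element. -/
lemma exists_pair {ω : Fˣ} (hω : ∀ x, x ∈ Subgroup.zpowers ω) (h8 : 8 ∣ Fintype.card F - 1) :
    ∃ (ψ : MulChar F ℂ) (ζ : AddChar F ℂ), IsQuarticPair ψ ζ ∧ ψ (ω : F) = Complex.I := by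
  classical
  have hI4 : Complex.I ^ 4 = 1 := Complex.I_pow_four
  have hmem : Units.mk0 Complex.I Complex.I_ne_zero ∈ rootsOfUnity (Fintype.card Fˣ) ℂ := by
    rw [mem_rootsOfUnity, Fintype.card_units]
    obtain ⟨k, hk⟩ := h8
    ext
    rw [hk]
    simp only [Units.val_pow_eq_pow_val, Units.val_mk0, Units.val_one]
    rw [show 8 * k = 4 * (2 * k) by ring, pow_mul, hI4, one_pow]
  set ψ : MulChar F ℂ := MulChar.ofRootOfUnity hmem hω with hψ
  have hψω : ψ (ω : F) = Complex.I := MulChar.ofRootOfUnity_spec hmem hω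
  have hpow : ∀ x : F, x ≠ 0 → ∃ j : ℕ, x = (ω : F) ^ j := fun x hx => by
    have := hω (Units.mk0 x hx)
    rw [← mem_powers_iff_mem_zpowers] at this
    obtain ⟨j, hj⟩ := this
    refine ⟨j, ?_⟩
    have := congrArg Units.val hj
    simpa using this.symm
  let _ := ZMod.algebra F 3
  -- The absolute trace to 𝔽₃ is unchanged by the cubing automorphism, which yields ζ(x³) = ζ(x).
  set ζ : AddChar F ℂ := (ZMod.stdAddChar (N := 3)).compAddMonoidHom
    (Algebra.trace (ZMod 3) F).toAddMonoidHom with hζ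
  have hζa : ∀ x, ζ x = ZMod.stdAddChar (N := 3) (Algebra.trace (ZMod 3) F x) := fun x => rfl
  refine ⟨ψ, ζ, ⟨?_, ?_, ?_, ?_, ?_⟩, hψω⟩
  -- If −1 = ωʲ then q − 1 divides 2j, so 8 divides 2j and ψ(−1) = iʲ = 1.
  · obtain ⟨j, hj⟩ := hpow (-1) (by simp)
    have h1 : ω ^ (2 * j) = 1 := by
      ext; push_cast; rw [mul_comm, pow_mul, ← hj]; ring
    have h2 := orderOf_dvd_of_pow_eq_one h1
    rw [orderOf_eq_card_of_forall_mem_zpowers hω, Nat.card_eq_fintype_card,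
      Fintype.card_units] at h2
    obtain ⟨k, hk⟩ : 4 ∣ j := by
      have := h8.trans h2
      omega
    rw [hj, map_pow, hψω, hk, pow_mul, hI4, one_pow]
  · rintro x hx ⟨y, rfl⟩
    obtain ⟨j, rfl⟩ := hpow y (left_ne_zero_of_mul hx)
    rw [map_mul, map_pow, hψω]
    rw [show (Complex.I ^ j * Complex.I ^ j) ^ 2 = (Complex.I ^ 4) ^ j by ring, hI4, one_pow]
  · intro x hx
    have hx0 : x ≠ 0 := by rintro rfl; exact hx IsSquare.zero
    obtain ⟨j, rfl⟩ := hpow x hx0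
    rcases Nat.even_or_odd j with hj | ⟨k, rfl⟩
    · exact absurd (hj.isSquare_pow _) hx
    · rw [map_pow, hψω, show (Complex.I ^ (2 * k + 1)) ^ 2 = (Complex.I ^ 4) ^ k * Complex.I ^ 2 by ring,
        hI4, one_pow, Complex.I_sq, one_mul]
  · apply AddChar.IsPrimitive.of_ne_one
    intro h1
    obtain ⟨x, hx⟩ := Algebra.trace_surjective (ZMod 3) F 1
    have h2 := hζa x
    rw [h1, hx, AddChar.one_apply] at h2
    have h3 : (1 : ZMod 3) = 0 := ZMod.injective_stdAddChar (by
      rw [← h2, AddChar.map_zero_eq_one])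
    exact absurd h3 (by decide)
  · intro x
    rw [hζa, hζa]
    congr 1
    have := Algebra.trace_eq_of_algEquiv (FiniteField.frobeniusAlgEquiv (ZMod 3) F 3) x
    simpa using this

end IsQuarticPair

/-! ### The cubic extension and Artin–Schreier generators -/

/-- `σ` generates the Galois group of the cubic extension `E` of `F`, and trace and norm are given by
the usual formulas. -/
structure IsCubicFrobenius {F E : Type*} [Field F] [Field E] [Algebra F E] (σ : E →ₐ[F] E) :
    Prop where
  iterate : ∀ x, σ (σ (σ x)) = x
  fixed : ∀ x, σ x = x → ∃ c, x = algebraMap F E c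
  trace : ∀ x, algebraMap F E (Algebra.trace F E x) = x + σ x + σ (σ x)
  norm : ∀ x, algebraMap F E (Algebra.norm F x) = x * σ x * σ (σ x)

lemma frobenius_isCubicFrobenius {F E : Type*} [Field F] [Field E] [Algebra F E] [Fintype F]
    [Finite E] (h3 : Module.finrank F E = 3) :
    IsCubicFrobenius (FiniteField.frobeniusAlgHom F E) := by
  have hq : Fintype.card F = Nat.card F := Fintype.card_eq_nat_card
  have := Fintype.ofFinite E
  have hE : Fintype.card E = Fintype.card F ^ 3 := by
    rw [Module.card_eq_pow_finrank (K := F) (V := E), h3]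
  refine ⟨fun x => ?_, fun x hx => ?_, fun x => ?_, fun x => ?_⟩
  · simp only [FiniteField.coe_frobeniusAlgHom]
    rw [← pow_mul, ← pow_mul, ← pow_three, ← hE, FiniteField.pow_card]
  · have : x ∈ Set.range (algebraMap F E) := by
      rw [IsGalois.mem_range_algebraMap_iff_fixed]
      intro f
      obtain ⟨n, rfl⟩ := (FiniteField.bijective_frobeniusAlgEquivOfAlgebraic_pow F E).surjective f
      have hfix : Function.IsFixedPt (FiniteField.frobeniusAlgEquivOfAlgebraic F E) x := by
        rw [Function.IsFixedPt, FiniteField.coe_frobeniusAlgEquivOfAlgebraic]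
        simpa [FiniteField.coe_frobeniusAlgHom] using hx
      simp only [AlgEquiv.coe_pow]
      exact hfix.iterate n
    obtain ⟨c, hc⟩ := this
    exact ⟨c, hc.symm⟩
  · rw [FiniteField.algebraMap_trace_eq_sum_pow, h3]
    simp only [Finset.sum_range_succ, Finset.sum_range_zero, FiniteField.coe_frobeniusAlgHom, hq]
    rw [← pow_mul]; ring
  · rw [FiniteField.algebraMap_norm_eq_prod_pow, h3]
    simp only [Finset.prod_range_succ, Finset.prod_range_zero, FiniteField.coe_frobeniusAlgHom, hq]
    rw [← pow_mul]; ring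

namespace IsCubicFrobenius

variable {F E : Type*} [Field F] [Field E] [Algebra F E] [Fintype F] [CharP F 3] [CharP E 3]
  [Finite E] {σ : E →ₐ[F] E}

lemma norm_eq {x : E} {c : F} (h : IsCubicFrobenius σ)
    (hx : x * σ x * σ (σ x) = algebraMap F E c) : Algebra.norm F x = c :=
  (algebraMap F E).injective (by rw [h.norm, hx])

lemma trace_eq {x : E} {c : F} (h : IsCubicFrobenius σ)
    (hx : x + σ x + σ (σ x) = algebraMap F E c) : Algebra.trace F E x = c :=
  (algebraMap F E).injective (by rw [h.trace, hx])

lemma three_eq_zero : (3 : E) = 0 := by exact_mod_cast CharP.cast_eq_zero E 3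

/-- An element on which the Frobenius map acts by translation by one. -/
lemma exists_generator (h : IsCubicFrobenius σ) : ∃ θ : E, σ θ = θ + 1 := by
  have h3 : (3 : E) = 0 := three_eq_zero
  obtain ⟨z, hz⟩ := Algebra.trace_surjective F E 1
  have hz1 : σ z ≠ z := by
    intro h0
    have := h.trace z
    rw [hz, h0, h0, map_one] at this
    exact one_ne_zero (α := E) (by linear_combination this + z * h3)
  -- In characteristic 3, (σ − 1)³ = σ³ − 1 = 0, so (σ − 1)²z lies in F. If it is nonzero, a
  -- multiple of (σ − 1)z serves as θ. Otherwise (σ − 1)z lies in F and is nonzero because z has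
  -- trace 1, and a multiple of z serves.
  have hd : σ (σ (σ z) - 2 * σ z + z) = σ (σ z) - 2 * σ z + z := by
    simp only [map_add, map_sub, map_mul, map_ofNat, h.iterate]
    linear_combination (σ z - σ (σ z)) * h3
  obtain ⟨c, hc⟩ := h.fixed _ hd
  by_cases hc0 : c = 0
  · rw [hc0, map_zero] at hc
    obtain ⟨b, hb⟩ := h.fixed (σ z - z) (by rw [map_sub]; linear_combination hc)
    have hb0 : algebraMap F E b ≠ 0 := by rw [← hb]; exact sub_ne_zero.2 hz1
    refine ⟨z / algebraMap F E b, ?_⟩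
    rw [map_div₀, σ.commutes]
    field_simp
    linear_combination hb
  · have hc' : algebraMap F E c ≠ 0 := (map_ne_zero _).2 hc0
    refine ⟨(σ z - z) / algebraMap F E c, ?_⟩
    rw [map_div₀, σ.commutes, map_sub]
    field_simp
    linear_combination hc

/-- The coefficients are peeled off by the nilpotent operator σ − 1. The second difference of θ² is
2 = −1, hence the sign in front of C. -/
lemma exists_coords (h : IsCubicFrobenius σ) {θ : E} (hθ : σ θ = θ + 1) (z : E) :
    ∃ A B C : F, z = algebraMap F E A + algebraMap F E B * θ + algebraMap F E C * θ ^ 2 := by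
  have h3 : (3 : E) = 0 := three_eq_zero
  obtain ⟨C, hC⟩ := h.fixed (-(σ (σ z) - 2 * σ z + z)) (by
    simp only [map_add, map_sub, map_mul, map_ofNat, h.iterate, map_neg]
    linear_combination -(σ z - σ (σ z)) * h3)
  obtain ⟨B, hB⟩ := h.fixed (σ (z - algebraMap F E C * θ ^ 2) - (z - algebraMap F E C * θ ^ 2)) (by
    simp only [map_sub, map_mul, map_pow, σ.commutes, hθ, map_add, map_one]
    linear_combination -hC - (algebraMap F E C) * h3)
  obtain ⟨A, hA⟩ := h.fixed (z - algebraMap F E C * θ ^ 2 - algebraMap F E B * θ) (by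
    simp only [map_sub, map_mul, map_pow, σ.commutes, hθ] at hB ⊢
    linear_combination hB)
  exact ⟨A, B, C, by linear_combination hA⟩

/-- The Artin-Schreier constant of the generator `θ`. -/
lemma exists_artinSchreier (h : IsCubicFrobenius σ) {θ : E} (hθ : σ θ = θ + 1) :
    ∃ τ : F, θ ^ 3 = θ + algebraMap F E τ ∧ ∀ s : F, s ^ 3 - s ≠ τ := by
  have h3 : (3 : E) = 0 := three_eq_zero
  obtain ⟨τ, hτ⟩ := h.fixed (θ ^ 3 - θ) (by
    simp only [map_sub, map_pow, hθ]
    linear_combination (θ ^ 2 + θ) * h3)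
  refine ⟨τ, by linear_combination hτ, fun s hs => ?_⟩
  have h1 : (θ - algebraMap F E s) * ((θ - algebraMap F E s - 1) * (θ - algebraMap F E s + 1)) =
      0 := by
    have : algebraMap F E s ^ 3 - algebraMap F E s = algebraMap F E τ := by
      rw [← hs, map_sub, map_pow]
    linear_combination hτ - this + (algebraMap F E s ^ 2 * θ - algebraMap F E s * θ ^ 2) * h3
  have key : ∀ c : F, θ ≠ algebraMap F E c := by
    rintro c rfl
    rw [σ.commutes] at hθ
    exact one_ne_zero (α := E) (by linear_combination -hθ)
  rcases mul_eq_zero.1 h1 with h2 | h2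
  · exact key s (by linear_combination h2)
  rcases mul_eq_zero.1 h2 with h2 | h2
  · exact key (s + 1) (by rw [map_add, map_one]; linear_combination h2)
  · exact key (s - 1) (by rw [map_sub, map_one]; linear_combination h2)

/-! Explicit traces and norms in terms of an Artin-Schreier generator `φ`. -/

variable {φ : E} {t : F}

lemma norm_linear (h : IsCubicFrobenius σ) (hφ : σ φ = φ + 1) (hφ3 : φ ^ 3 = φ + algebraMap F E t)
    (s : F) : Algebra.norm F (φ + algebraMap F E s) = s ^ 3 - s + t := by
  have h3 : (3 : E) = 0 := three_eq_zero
  apply h.norm_eq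
  simp only [map_add, map_sub, map_pow, map_one, σ.commutes, hφ]
  generalize algebraMap F E s = s' at *
  generalize algebraMap F E t = t' at *
  grind

lemma norm_quadratic (h : IsCubicFrobenius σ) (hφ : σ φ = φ + 1)
    (hφ3 : φ ^ 3 = φ + algebraMap F E t) (A s : F) :
    Algebra.norm F (φ ^ 2 + algebraMap F E A * φ + algebraMap F E s) =
      s ^ 3 - s ^ 2 + (1 - A ^ 2) * s + t * (A ^ 3 - A + t) := by
  have h3 : (3 : E) = 0 := three_eq_zero
  apply h.norm_eq
  simp only [map_add, map_sub, map_mul, map_pow, map_one, σ.commutes, hφ]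
  generalize algebraMap F E s = s' at *
  generalize algebraMap F E t = t' at *
  generalize algebraMap F E A = A' at *
  grind

lemma norm_conic (h : IsCubicFrobenius σ) (hφ : σ φ = φ + 1)
    (hφ3 : φ ^ 3 = φ + algebraMap F E t) : Algebra.norm F (1 + φ ^ 2) = t ^ 2 + 1 := by
  have := h.norm_quadratic hφ hφ3 0 1
  simp only [map_zero, map_one] at this
  rw [show 1 + φ ^ 2 = φ ^ 2 + 0 * φ + 1 by ring, this]
  ring

lemma trace_conic (h : IsCubicFrobenius σ) (hφ : σ φ = φ + 1) :
    Algebra.trace F E (1 + φ ^ 2) = -1 := by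
  have h3 : (3 : E) = 0 := three_eq_zero
  apply h.trace_eq
  simp only [map_add, map_neg, map_pow, map_one, hφ]
  linear_combination (3 + φ ^ 2 + 2 * φ) * h3

/-- The φ² terms cancel modulo 3, so squares of conic elements are linear in φ. This is what allows
the equation for z with σz − σ²z proportional to a² to be solved explicitly. -/
lemma conic_sq (hφ3 : φ ^ 3 = φ + algebraMap F E t) :
    (1 + φ ^ 2) ^ 2 = 1 + algebraMap F E t * φ := by
  have h3 : (3 : E) = 0 := three_eq_zero
  linear_combination φ * hφ3 + φ ^ 2 * h3

/-- The pairing of two conic elements is minus a square, so its square class is lost and only the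
scalars d will matter when S is split in two. -/
lemma trace_conic_mul (h : IsCubicFrobenius σ) {θ : E} (hθ : σ θ = θ + 1)
    (y z : F) :
    Algebra.trace F E ((1 + (θ - algebraMap F E y) ^ 2) * (1 + (θ - algebraMap F E z) ^ 2)) =
      -(y - z) ^ 2 := by
  have h3 : (3 : E) = 0 := three_eq_zero
  apply h.trace_eq
  simp only [map_add, map_sub, map_mul, map_neg, map_pow, map_one, σ.commutes, hθ]
  generalize algebraMap F E y = y' at *
  generalize algebraMap F E z = z' at *
  grind

lemma trace_sq_coords (h : IsCubicFrobenius σ) {θ : E} (hθ : σ θ = θ + 1)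
    (A B C : F) :
    Algebra.trace F E ((algebraMap F E A + algebraMap F E B * θ + algebraMap F E C * θ ^ 2) ^ 2) =
      -(B ^ 2 - A * C + C ^ 2) := by
  have h3 : (3 : E) = 0 := three_eq_zero
  apply h.trace_eq
  simp only [map_add, map_sub, map_mul, map_neg, map_pow, map_one, σ.commutes, hθ]
  generalize algebraMap F E A = A' at *
  generalize algebraMap F E B = B' at *
  generalize algebraMap F E C = C' at *
  grind

end IsCubicFrobenius

/-! ### The conic S, its two halves, and the sums over lines in direction 1 -/

namespace IsCubicFrobenius

variable {F E : Type*} [Field F] [Field E] [Algebra F E] [Fintype F] [CharP F 3] [CharP E 3]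
  [Finite E] {σ : E →ₐ[F] E}

/-- The elements of `setS` in terms of an Artin-Schreier generator. -/
lemma eq_of_mem_setS (h : IsCubicFrobenius σ) {θ : E} (hθ : σ θ = θ + 1) {τ : F}
    (hτ : θ ^ 3 = θ + algebraMap F E τ) {a : E} (ha : a ∈ (setS F : Set E)) :
    a = 1 ∨ ∃ y d : F, d ≠ 0 ∧ d ^ 3 = (τ - y ^ 3 + y) ^ 2 + 1 ∧
      a = algebraMap F E d⁻¹ * (1 + (θ - algebraMap F E y) ^ 2) := by
  have h3 : (3 : E) = 0 := three_eq_zero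
  have h3' : (3 : F) = 0 := IsQuarticPair.three_eq_zero
  obtain ⟨hN, hT⟩ := ha
  obtain ⟨A, B, C, rfl⟩ := h.exists_coords hθ a
  rw [h.trace_sq_coords hθ] at hT
  -- The trace condition is the conic B² − AC + C² = 0. It has one point with C = 0, which the norm
  -- condition normalises to 1; all others are parametrised by y = B/C, with d = C⁻¹ fixed by the
  -- norm.
  rcases eq_or_ne C 0 with rfl | hC
  · have hB : B = 0 := by
      have : B ^ 2 = 0 := by linear_combination -hT
      exact pow_eq_zero_iff two_ne_zero |>.1 this
    subst hB
    left
    have h1 := h.norm (algebraMap F E A + algebraMap F E 0 * θ + algebraMap F E 0 * θ ^ 2)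
    rw [hN] at h1
    simp only [map_zero, zero_mul, add_zero, σ.commutes, map_one] at h1 ⊢
    have := Fintype.ofFinite E
    exact IsQuarticPair.cube_injective (by rw [one_pow, h1]; ring)
  · right
    set y := B / C
    have hφ : σ (θ - algebraMap F E y) = θ - algebraMap F E y + 1 := by
      rw [map_sub, σ.commutes, hθ]; ring
    have hφ3 : (θ - algebraMap F E y) ^ 3 = θ - algebraMap F E y +
        algebraMap F E (τ - y ^ 3 + y) := by
      simp only [map_add, map_sub, map_pow]
      linear_combination hτ + (algebraMap F E y ^ 2 * θ - algebraMap F E y * θ ^ 2) * h3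
    have hB : B = y * C := by simp only [y]; field_simp
    have hA : A = C * (y ^ 2 + 1) := by
      apply mul_left_cancel₀ hC
      rw [hB] at hT
      linear_combination hT
    have ha : algebraMap F E A + algebraMap F E B * θ + algebraMap F E C * θ ^ 2 =
        algebraMap F E C * (1 + (θ - algebraMap F E y) ^ 2) := by
      rw [hA, hB]
      simp only [map_mul, map_add, map_pow, map_one]
      linear_combination (algebraMap F E C * algebraMap F E y * θ) * h3
    refine ⟨y, C⁻¹, inv_ne_zero hC, ?_, by rw [inv_inv, ha]⟩
    rw [ha] at hN
    have h1 : Algebra.norm F (algebraMap F E C * (1 + (θ - algebraMap F E y) ^ 2)) =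
        C ^ 3 * Algebra.norm F (1 + (θ - algebraMap F E y) ^ 2) := by
      apply h.norm_eq
      rw [map_mul (algebraMap F E), h.norm]
      simp only [map_mul, map_pow, σ.commutes]
      ring
    rw [h1, h.norm_conic hφ hφ3] at hN
    rw [inv_pow]
    exact inv_eq_of_mul_eq_one_right hN

lemma one_mem_setS (h : IsCubicFrobenius σ) : (1 : E) ∈ (setS F : Set E) := by
  refine ⟨map_one _, ?_⟩
  rw [one_pow]
  apply h.trace_eq
  rw [map_one, map_one, map_zero]
  linear_combination (three_eq_zero : (3 : E) = 0)

/-- The sign that separates the two halves of `setS`. -/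
noncomputable def conicSign (ψ : MulChar F ℂ) (a : E) : ℂ :=
  open Classical in if Algebra.trace F E a = 0 then 1 else ψ (Algebra.trace F E a) ^ 2

variable {ψ : MulChar F ℂ} {ζ : AddChar F ℂ}

lemma conicSign_one (h : IsCubicFrobenius σ) : conicSign ψ (1 : E) = 1 := by
  have := h.one_mem_setS.2
  rw [one_pow] at this
  rw [conicSign, if_pos this]

lemma norm_algebraMap_mul (h : IsCubicFrobenius σ) (c : F) (x : E) :
    Algebra.norm F (algebraMap F E c * x) = c ^ 3 * Algebra.norm F x := by
  apply h.norm_eq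
  rw [map_mul (algebraMap F E), h.norm]
  simp only [map_mul, map_pow, σ.commutes]
  ring

lemma trace_algebraMap_mul (c : F) (x : E) :
    Algebra.trace F E (algebraMap F E c * x) = c * Algebra.trace F E x := by
  rw [← Algebra.smul_def, map_smul, smul_eq_mul]

lemma conicSign_conic (h : IsCubicFrobenius σ) (hψ : IsQuarticPair ψ ζ) {φ : E} (hφ : σ φ = φ + 1)
    {d : F} (hd : d ≠ 0) : conicSign ψ (algebraMap F E d⁻¹ * (1 + φ ^ 2)) = ψ d ^ 2 := by
  rw [conicSign, trace_algebraMap_mul, h.trace_conic hφ, if_neg, mul_neg_one, hψ.neg,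
    hψ.mulChar_inv, hψ.conj_mulChar]
  · linear_combination (ψ d ^ 2) * hψ.pow_four hd
  · simpa using hd

lemma isSquare_iff_mulChar (hψ : IsQuarticPair ψ ζ) {x : F} (hx : x ≠ 0) :
    IsSquare x ↔ ψ x ^ 2 = 1 := by
  refine ⟨hψ.sq_of_isSquare x hx, fun h1 => ?_⟩
  by_contra h2
  rw [hψ.sq_of_not_isSquare x h2] at h1
  norm_num at h1

lemma conicSign_eq (hψ : IsQuarticPair ψ ζ) (a : E) :
    conicSign ψ a = 1 ∨ conicSign ψ a = -1 := by
  rw [conicSign]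
  split_ifs with h0
  · exact Or.inl rfl
  · exact hψ.mulChar_sq_sq h0

/-- For two conic elements with scalars d, d' the quantity is (dd')⁻¹(y' − y)², so being a square
depends only on ψ(d)² and ψ(d')². Equal parameters y force d = d', in agreement with zero counting
as a square. -/
lemma isSquare_trace_iff (h : IsCubicFrobenius σ) (hψ : IsQuarticPair ψ ζ) {a b : E}
    (ha : a ∈ (setS F : Set E)) (hb : b ∈ (setS F : Set E)) :
    IsSquare (2 * Algebra.trace F E (b * a)) ↔ conicSign ψ a = conicSign ψ b := by
  have h2 : (2 : F) = -1 := IsQuarticPair.two_eq_neg_one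
  obtain ⟨θ, hθ⟩ := h.exists_generator
  obtain ⟨τ, hτ, -⟩ := h.exists_artinSchreier hθ
  have hφ : ∀ y : F, σ (θ - algebraMap F E y) = θ - algebraMap F E y + 1 := fun y => by
    rw [map_sub, σ.commutes, hθ]; ring
  have key : ∀ (d y : F), d ≠ 0 → (IsSquare (2 * Algebra.trace F E (algebraMap F E d⁻¹ *
      (1 + (θ - algebraMap F E y) ^ 2))) ↔ ψ d ^ 2 = 1) := fun d y hd => by
    rw [trace_algebraMap_mul, h.trace_conic (hφ y), h2,
      isSquare_iff_mulChar hψ (by simpa using hd), show -1 * (d⁻¹ * -1) = d⁻¹ by ring,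
      hψ.mulChar_inv, hψ.conj_mulChar]
    have h4 := hψ.pow_four hd
    constructor <;> intro h5
    · linear_combination h5 - ψ d ^ 2 * h4
    · linear_combination h5 + ψ d ^ 2 * h4
  have h1T : Algebra.trace F E (1 : E) = 0 := by simpa using h.one_mem_setS.2
  rcases h.eq_of_mem_setS hθ hτ ha with rfl | ⟨y, d, hd, hdy, rfl⟩ <;>
  rcases h.eq_of_mem_setS hθ hτ hb with rfl | ⟨y', d', hd', hdy', rfl⟩
  · simp [h1T]
  · rw [mul_one, key _ _ hd', h.conicSign_one, h.conicSign_conic hψ (hφ y') hd', eq_comm]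
  · rw [one_mul, key _ _ hd, h.conicSign_one, h.conicSign_conic hψ (hφ y) hd]
  · rw [h.conicSign_conic hψ (hφ y) hd, h.conicSign_conic hψ (hφ y') hd']
    rw [show algebraMap F E d'⁻¹ * (1 + (θ - algebraMap F E y') ^ 2) *
      (algebraMap F E d⁻¹ * (1 + (θ - algebraMap F E y) ^ 2)) =
      algebraMap F E (d'⁻¹ * d⁻¹) * ((1 + (θ - algebraMap F E y') ^ 2) *
        (1 + (θ - algebraMap F E y) ^ 2)) by rw [map_mul]; ring, trace_algebraMap_mul,
      h.trace_conic_mul hθ, h2]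
    rcases eq_or_ne y' y with rfl | hy
    · have : d = d' := IsQuarticPair.cube_injective (by rw [hdy, hdy'])
      subst this
      simp
    · have hy0 := sub_ne_zero.2 hy
      have e : -1 * (d'⁻¹ * d⁻¹ * -(y' - y) ^ 2) = (d' * d)⁻¹ * (y' - y) ^ 2 := by
        rw [mul_inv]; ring
      rw [e, isSquare_iff_mulChar hψ (mul_ne_zero (inv_ne_zero (mul_ne_zero hd' hd))
        (pow_ne_zero 2 hy0)), map_mul ψ, hψ.mulChar_inv, hψ.conj_mulChar, map_mul ψ, map_pow ψ]
      have h4 := hψ.pow_four hd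
      have h4' := hψ.pow_four hd'
      have h4y := hψ.pow_four hy0
      have e2 : ((ψ d' * ψ d) ^ 3 * ψ (y' - y) ^ 2) ^ 2 = ψ d' ^ 2 * ψ d ^ 2 := by
        have : ((ψ d' * ψ d) ^ 3 * ψ (y' - y) ^ 2) ^ 2 =
          ψ d' ^ 4 * ψ d ^ 4 * ψ (y' - y) ^ 4 * (ψ d' ^ 2 * ψ d ^ 2) := by ring
        rw [this, h4, h4', h4y]; ring
      rw [e2]
      rcases hψ.mulChar_sq_sq hd with h5 | h5 <;> rcases hψ.mulChar_sq_sq hd' with h6 | h6 <;>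
        rw [h5, h6] <;> norm_num

lemma setX₁_eq (h : IsCubicFrobenius σ) (hψ : IsQuarticPair ψ ζ) {b : E}
    (hb : b ∈ (setS F : Set E)) :
    setX₁ F b = {a ∈ (setS F : Set E) | conicSign ψ a = conicSign ψ b} := by
  ext a
  exact and_congr_right fun ha => h.isSquare_trace_iff hψ ha hb

lemma setX₂_eq (h : IsCubicFrobenius σ) (hψ : IsQuarticPair ψ ζ) {b : E}
    (hb : b ∈ (setS F : Set E)) :
    setX₂ F b = {a ∈ (setS F : Set E) | conicSign ψ a = -conicSign ψ b} := by
  ext a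
  refine and_congr_right fun ha => ?_
  rw [h.isSquare_trace_iff hψ ha hb]
  rcases conicSign_eq hψ a with h1 | h1 <;> rcases conicSign_eq hψ b with h2 | h2 <;>
    rw [h1, h2] <;> norm_num

/-! Character sums over affine lines. -/

lemma sum_affine (h : IsCubicFrobenius σ) (ψ : MulChar F ℂ) {e : F} (he : e ≠ 0) (k k₀ : F)
    (x : E) :
    ∑ s : F, ψ (Algebra.norm F (algebraMap F E e * x + algebraMap F E k + algebraMap F E s)) =
      ψ e ^ 3 * ∑ u : F, ψ (Algebra.norm F (x + algebraMap F E (u + k₀))) := by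
  rw [Finset.mul_sum]
  symm
  refine Fintype.sum_equiv (((Equiv.addRight k₀).trans (Equiv.mulLeft₀ e he)).trans
    (Equiv.subRight k)) _ _ fun u => ?_
  simp only [Equiv.trans_apply, Equiv.coe_addRight, Equiv.mulLeft₀_apply, Equiv.subRight_apply]
  rw [← map_pow, ← map_mul, ← h.norm_algebraMap_mul]
  congr 2
  simp only [map_sub, map_mul, map_add]
  ring

/-- The character sum over an affine line in direction `1`. -/
lemma sum_line_one (h : IsCubicFrobenius σ) (hψ : IsQuarticPair ψ ζ) {θ : E} (hθ : σ θ = θ + 1)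
    {τ : F} (hτ : θ ^ 3 = θ + algebraMap F E τ) (hτs : ∀ s : F, s ^ 3 - s ≠ τ) {z a : E} {c : F}
    (hc : c ≠ 0) (ha : a ∈ (setS F : Set E)) (hz : σ z - σ (σ z) = algebraMap F E c * a ^ 2) :
    ∑ s : F, ψ (Algebra.norm F (z + algebraMap F E s)) =
      (∑ s : F, ψ (s ^ 3 - s + τ)) * (conicSign ψ a * conj (ψ c)) := by
  have h3 : (3 : E) = 0 := three_eq_zero
  have h3' : (3 : F) = 0 := IsQuarticPair.three_eq_zero
  -- The kernel of σ − σ² is F, so it suffices to guess one solution; a translation by F does not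
  -- affect the sum.
  have key : ∀ x : E, σ x - σ (σ x) = σ z - σ (σ z) → ∃ k : F, z = x + algebraMap F E k := by
    intro x hx
    obtain ⟨k, hk⟩ := h.fixed (σ (z - x)) (by simp only [map_sub]; linear_combination hx)
    refine ⟨k, ?_⟩
    have := congrArg σ (congrArg σ hk)
    rw [h.iterate, σ.commutes, σ.commutes] at this
    linear_combination this
  have hτ1 : ζ τ ≠ 1 := fun h1 => by
    obtain ⟨s, hs⟩ := hψ.exists_artinSchreier h1
    exact hτs s hs
  rcases h.eq_of_mem_setS hθ hτ ha with rfl | ⟨y, d, hd, hdy, rfl⟩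
  · obtain ⟨k, hk⟩ := key (algebraMap F E (-c) * θ) (by
      rw [hz]
      simp only [map_mul, map_neg, map_add, map_one, σ.commutes, hθ]
      ring)
    rw [hk, h.sum_affine ψ (neg_ne_zero.2 hc) k 0, h.conicSign_one, hψ.neg, hψ.conj_mulChar]
    simp only [add_zero, h.norm_linear hθ hτ]
    ring
  · set φ := θ - algebraMap F E y with hφd
    set t := τ - y ^ 3 + y with ht
    have hφ : σ φ = φ + 1 := by rw [hφd, map_sub, σ.commutes, hθ]; ring
    have hφ3 : φ ^ 3 = φ + algebraMap F E t := by
      rw [hφd, ht]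
      simp only [map_add, map_sub, map_pow]
      linear_combination hτ + (algebraMap F E y ^ 2 * θ - algebraMap F E y * θ ^ 2) * h3
    have hts : ∀ s : F, s ^ 3 - s ≠ t := fun s hs => hτs (s + y) (by
      rw [ht] at hs; linear_combination hs + (s ^ 2 * y + s * y ^ 2) * h3')
    have ht1 : ζ t ≠ 1 := fun h1 => by
      obtain ⟨s, hs⟩ := hψ.exists_artinSchreier h1
      exact hts s hs
    have ht0 := IsQuarticPair.addChar_ne_one_ne_zero ht1
    have ht0' : algebraMap F E t ≠ 0 := (map_ne_zero _).2 ht0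
    have hd' : algebraMap F E d ≠ 0 := (map_ne_zero _).2 hd
    have he : c * t / d ^ 2 ≠ 0 := div_ne_zero (mul_ne_zero hc ht0) (pow_ne_zero 2 hd)
    -- The difference to be matched is c d⁻²(1 + tφ). Since σ − σ² sends φ to −1 and φ² to φ in
    -- characteristic 3, this determines the multiple of φ² − t⁻¹φ.
    obtain ⟨k, hk⟩ := key (algebraMap F E (c * t / d ^ 2) *
      (φ ^ 2 + algebraMap F E (-t⁻¹) * φ)) (by
      rw [hz, mul_pow, conic_sq hφ3]
      simp only [map_mul, map_neg, map_add, map_one, map_pow, map_div₀, map_inv₀, σ.commutes, hφ]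
      field_simp
      linear_combination (-algebraMap F E c * algebraMap F E t * (φ + 1)) * h3)
    -- The shift t⁻² − 1 removes the linear term of the norm polynomial; its constant term is then a
    -- perfect square.
    have hN : ∀ u : F, Algebra.norm F (φ ^ 2 + algebraMap F E (-t⁻¹) * φ +
        algebraMap F E (u + ((t⁻¹) ^ 2 - 1))) =
        u ^ 3 - u ^ 2 + ((t ^ 2 + 1) ^ 2 / t ^ 3) ^ 2 := fun u => by
      rw [h.norm_quadratic hφ hφ3]
      have e : ((t ^ 2 + 1) ^ 2 / t ^ 3) ^ 2 = t ^ 2 + 4 + 6 * (t⁻¹) ^ 2 + 4 * (t⁻¹) ^ 4 +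
          (t⁻¹) ^ 6 := by field_simp; ring
      have e' : t * t⁻¹ = 1 := mul_inv_cancel₀ ht0
      rw [e]
      generalize t⁻¹ = v at *
      clear_value t
      clear * - h3' e'
      grind
    rw [hk, h.sum_affine ψ he k ((t⁻¹) ^ 2 - 1), Finset.sum_congr rfl fun u _ => by rw [hN u],
      hψ.sum_cubic ht1 hτ1, h.conicSign_conic hψ hφ hd, hψ.conj_mulChar]
    · have e : ψ (c * t / d ^ 2) ^ 3 * ψ t = ψ d ^ 2 * ψ c ^ 3 := by
        rw [div_eq_mul_inv, map_mul, map_mul, hψ.mulChar_inv, hψ.conj_mulChar, map_pow ψ]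
        have h4t := hψ.pow_four ht0
        have h4d := hψ.pow_four hd
        calc (ψ c * ψ t * (ψ d ^ 2) ^ 3) ^ 3 * ψ t = (ψ d ^ 4) ^ 4 * ψ t ^ 4 * (ψ d ^ 2 * ψ c ^ 3) := by
              ring
          _ = _ := by rw [h4t, h4d]; ring
      linear_combination (∑ s : F, ψ (s ^ 3 - s + τ)) * e
    · intro u
      rw [← hN u, Algebra.norm_ne_zero_iff]
      -- A quadratic relation for φ over F is impossible: its second difference under σ would be 2 =
      -- 0.
      intro h0
      have h1 := congrArg σ h0
      have h2 := congrArg σ h1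
      simp only [map_add, map_mul, map_pow, map_one, map_zero, σ.commutes, hφ] at h0 h1 h2
      exact one_ne_zero (α := E) (by linear_combination h3 - h0 + 2 * h1 - h2)

end IsCubicFrobenius

/-! ### Counting in projective spaces -/

section Counting

variable {F V : Type*} [Field F] [AddCommGroup V] [Module F V]

lemma existsUnique_line (R : PGPoint F V) {v : V} (hv : v ∉ R.submodule) :
    ∃! ℓ : PGLine F V, PGIncident R ℓ ∧ v ∈ ℓ.1 := by
  induction R using Projectivization.ind with
  | h u hu =>
    simp only [PGIncident, Projectivization.submodule_mk, Submodule.span_singleton_le_iff_mem] at *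
    have hli : LinearIndependent F ![u, v] := by
      rw [LinearIndependent.pair_iff' hu]
      intro a ha
      exact hv (Submodule.mem_span_singleton.2 ⟨a, ha⟩)
    have hfr : Module.finrank F (Submodule.span F {u, v}) = 2 := by
      have := finrank_span_eq_card hli
      rwa [Matrix.range_cons_cons_empty, Fintype.card_fin] at this
    refine ⟨⟨Submodule.span F {u, v}, hfr⟩, ⟨Submodule.subset_span (by simp),
      Submodule.subset_span (by simp)⟩, ?_⟩
    rintro ⟨ℓ, hℓ⟩ ⟨h1, h2⟩
    apply Subtype.ext
    have : FiniteDimensional F ℓ := FiniteDimensional.of_finrank_pos (by rw [hℓ]; norm_num)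
    symm
    apply Submodule.eq_of_le_of_finrank_eq
    · rw [Submodule.span_le]
      rintro x (rfl | rfl)
      · exact h1
      · exact h2
    · rw [hfr, hℓ]

lemma ncard_lines_through_two (R R' : PGPoint F V) (h : R ≠ R') :
    {ℓ : PGLine F V | PGIncident R ℓ ∧ PGIncident R' ℓ}.ncard = 1 := by
  induction R' using Projectivization.ind with
  | h v hv =>
    have hvR : v ∉ R.submodule := by
      intro h1
      apply h
      apply Projectivization.submodule_injective
      have : FiniteDimensional F R.submodule :=
        FiniteDimensional.of_finrank_pos (by rw [Projectivization.finrank_submodule]; norm_num)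
      symm
      apply Submodule.eq_of_le_of_finrank_eq
      · rw [Projectivization.submodule_mk, Submodule.span_singleton_le_iff_mem]; exact h1
      · rw [Projectivization.finrank_submodule, Projectivization.finrank_submodule]
    obtain ⟨ℓ, hℓ, hu⟩ := existsUnique_line R hvR
    rw [Set.ncard_eq_one]
    refine ⟨ℓ, ?_⟩
    ext ℓ'
    simp only [Set.mem_ofPred_eq, Set.mem_singleton_iff]
    have e : ∀ m : PGLine F V, PGIncident (Projectivization.mk F v hv) m ↔ v ∈ m.1 := fun m => by
      rw [PGIncident, Projectivization.submodule_mk, Submodule.span_singleton_le_iff_mem]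
    constructor
    · rintro ⟨h1, h2⟩; exact hu ℓ' ⟨h1, (e _).1 h2⟩
    · rintro rfl; exact ⟨hℓ.1, (e _).2 hℓ.2⟩

/-- The number of points on a line. -/
lemma ncard_points_on_line [Finite F] (ℓ : PGLine F V) :
    {R : PGPoint F V | PGIncident R ℓ}.ncard = Nat.card F + 1 := by
  rw [← Projectivization.card_of_finrank_two F ℓ.1 ℓ.2]
  have : {R : PGPoint F V | PGIncident R ℓ} =
      Set.range (Projectivization.map ℓ.1.subtype ℓ.1.injective_subtype) := by
    ext R
    induction R using Projectivization.ind with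
    | h v hv =>
      simp only [Set.mem_ofPred_eq, PGIncident, Projectivization.submodule_mk,
        Submodule.span_singleton_le_iff_mem, Set.mem_range]
      constructor
      · intro h
        exact ⟨Projectivization.mk F ⟨v, h⟩ (fun h0 => hv (congrArg Subtype.val h0)), rfl⟩
      · rintro ⟨R', hR'⟩
        induction R' using Projectivization.ind with
        | h u hu =>
          rw [Projectivization.map_mk, Projectivization.mk_eq_mk_iff'] at hR'
          obtain ⟨a, ha⟩ := hR'
          by_cases ha0 : a = 0
          · exfalso; apply hu
            rw [ha0, zero_smul] at ha
            exact Subtype.ext ha.symm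
          · have : v = a⁻¹ • (u : V) := by
              rw [eq_inv_smul_iff₀ ha0]; exact ha
            rw [this]; exact ℓ.1.smul_mem _ u.2
  rw [this, ← Set.image_univ, Set.ncard_image_of_injective _ (Projectivization.map_injective _ _),
    Set.ncard_univ]

open Classical in
/-- Every vector outside a point lies on exactly one line through this point. -/
lemma sum_lines_through [Fintype V] [Fintype (PGLine F V)] (R : PGPoint F V) (f : V → ℝ) :
    ∑ ℓ ∈ Finset.univ.filter (fun ℓ : PGLine F V => PGIncident R ℓ),
      ∑ v ∈ Finset.univ.filter (fun v : V => v ∈ ℓ.1 ∧ v ∉ R.submodule), f v =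
    ∑ v ∈ Finset.univ.filter (fun v : V => v ∉ R.submodule), f v := by
  rw [Finset.sum_comm' (t' := Finset.univ.filter (fun v : V => v ∉ R.submodule))
    (s' := fun v => Finset.univ.filter (fun ℓ : PGLine F V => PGIncident R ℓ ∧ v ∈ ℓ.1))]
  · refine Finset.sum_congr rfl fun v hv => ?_
    obtain ⟨ℓ, hℓ, hu⟩ := existsUnique_line R (Finset.mem_filter.1 hv).2
    have : Finset.univ.filter (fun ℓ : PGLine F V => PGIncident R ℓ ∧ v ∈ ℓ.1) = {ℓ} := by
      ext m
      simp only [Finset.mem_filter, Finset.mem_univ, true_and, Finset.mem_singleton]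
      exact ⟨hu m, by rintro rfl; exact hℓ⟩
    rw [this, Finset.sum_singleton]
  · intro ℓ v
    simp only [Finset.mem_filter, Finset.mem_univ, true_and]
    tauto

open Classical in
lemma card_filter_mem [Fintype F] [Fintype V] (W : Submodule F V) :
    (Finset.univ.filter (fun v : V => v ∈ W)).card = Fintype.card F ^ Module.finrank F W := by
  rw [← Module.card_eq_pow_finrank (K := F) (V := W), ← Fintype.card_subtype]

open Classical in
-- The q⁴ − q vectors outside the point are shared out among its lines, q² − q to each.
lemma card_lines_through [Fintype F] [Fintype V] [Fintype (PGLine F V)]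
    (hV : Module.finrank F V = 4) (R : PGPoint F V) :
    ((Finset.univ.filter (fun ℓ : PGLine F V => PGIncident R ℓ)).card : ℝ) =
      (Fintype.card F : ℝ) ^ 2 + Fintype.card F + 1 := by
  have h := sum_lines_through R (fun _ => 1)
  have hR : (Finset.univ.filter (fun v : V => v ∈ R.submodule)).card = Fintype.card F := by
    rw [card_filter_mem, Projectivization.finrank_submodule, pow_one]
  have hVc : Fintype.card V = Fintype.card F ^ 4 := by
    rw [Module.card_eq_pow_finrank (K := F) (V := V), hV]
  have h1 : ((Finset.univ.filter (fun v : V => v ∉ R.submodule)).card : ℝ) =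
      (Fintype.card F : ℝ) ^ 4 - Fintype.card F := by
    have := Finset.card_filter_add_card_filter_not (s := (Finset.univ : Finset V))
      (fun v : V => v ∈ R.submodule)
    rw [hR, Finset.card_univ, hVc] at this
    rw [eq_sub_iff_add_eq, add_comm]
    exact_mod_cast this
  have h2 : ∀ ℓ ∈ Finset.univ.filter (fun ℓ : PGLine F V => PGIncident R ℓ),
      ∑ v ∈ Finset.univ.filter (fun v : V => v ∈ ℓ.1 ∧ v ∉ R.submodule), (1 : ℝ) =
        (Fintype.card F : ℝ) ^ 2 - Fintype.card F := by
    intro ℓ hℓ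
    have hi : PGIncident R ℓ := (Finset.mem_filter.1 hℓ).2
    have := Finset.card_filter_add_card_filter_not
      (s := Finset.univ.filter (fun v : V => v ∈ ℓ.1)) (fun v : V => v ∈ R.submodule)
    rw [Finset.filter_filter, Finset.filter_filter, card_filter_mem, ℓ.2] at this
    have e : Finset.univ.filter (fun v : V => v ∈ ℓ.1 ∧ v ∈ R.submodule) =
        Finset.univ.filter (fun v : V => v ∈ R.submodule) := by
      ext v
      simp only [Finset.mem_filter, Finset.mem_univ, true_and]
      exact ⟨fun h => h.2, fun h => ⟨hi h, h⟩⟩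
    rw [e, hR] at this
    rw [Finset.sum_const, nsmul_eq_mul, mul_one, eq_sub_iff_add_eq, add_comm]
    exact_mod_cast this
  rw [Finset.sum_congr rfl h2, Finset.sum_const, Finset.sum_const, nsmul_eq_mul, nsmul_eq_mul,
    h1, mul_one] at h
  have hq : (1 : ℝ) < Fintype.card F := by exact_mod_cast Fintype.one_lt_card
  have hne : (Fintype.card F : ℝ) ^ 2 - Fintype.card F ≠ 0 := by nlinarith
  apply mul_right_cancel₀ hne
  rw [h]; ring

end Counting

/-! ### Tactical decompositions from counts -/

lemma isPartition_four {X : Type*} {a b c d : Set X} (ha : a.Nonempty) (hb : b.Nonempty)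
    (hc : c.Nonempty) (hd : d.Nonempty) (hcov : ∀ x, x ∈ a ∨ x ∈ b ∨ x ∈ c ∨ x ∈ d)
    (hab : Disjoint a b) (hac : Disjoint a c) (had : Disjoint a d) (hbc : Disjoint b c)
    (hbd : Disjoint b d) (hcd : Disjoint c d) :
    Setoid.IsPartition ({a, b, c, d} : Set (Set X)) ∧ ({a, b, c, d} : Set (Set X)).ncard = 4 := by
  have hpd : ({a, b, c, d} : Set (Set X)).PairwiseDisjoint id := by
    simp only [Set.pairwiseDisjoint_insert, Set.pairwiseDisjoint_singleton, Set.mem_insert_iff,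
      Set.mem_singleton_iff, forall_eq_or_imp, forall_eq, id]
    refine ⟨⟨⟨trivial, ?_⟩, ?_⟩, ?_⟩ <;> simp [*]
  refine ⟨⟨?_, fun x => ?_⟩, ?_⟩
  · simp only [Set.mem_insert_iff, Set.mem_singleton_iff, not_or]
    exact ⟨ha.ne_empty.symm, hb.ne_empty.symm, hc.ne_empty.symm, hd.ne_empty.symm⟩
  · have : ∃ s ∈ ({a, b, c, d} : Set (Set X)), x ∈ s := by simpa using hcov x
    obtain ⟨s, hs, hx⟩ := this
    refine ⟨s, ⟨hs, hx⟩, ?_⟩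
    rintro t ⟨ht, hxt⟩
    by_contra hne
    exact Set.disjoint_left.1 (hpd ht hs hne) hxt hx
  · rw [Set.ncard_insert_of_notMem, Set.ncard_insert_of_notMem, Set.ncard_pair]
    · exact hcd.ne hc.ne_empty
    · simp only [Set.mem_insert_iff, Set.mem_singleton_iff, not_or]
      exact ⟨hbc.ne hb.ne_empty, hbd.ne hb.ne_empty⟩
    · simp only [Set.mem_insert_iff, Set.mem_singleton_iff, not_or]
      exact ⟨hab.ne ha.ne_empty, hac.ne ha.ne_empty, had.ne ha.ne_empty⟩

/-- This lets all counts be given by real formulas containing halves and w, whose integrality never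
has to be checked. An empty class receives the default value 0. -/
lemma exists_encard_eq {X Y : Type*} [Finite Y] {s : Set X} {t : X → Set Y} (c : ℝ)
    (h : ∀ x ∈ s, ((t x).ncard : ℝ) = c) : ∃ n : ℕ, ∀ x ∈ s, (t x).encard = n := by
  rcases s.eq_empty_or_nonempty with rfl | ⟨x₀, h₀⟩
  · exact ⟨0, by simp⟩
  · refine ⟨(t x₀).ncard, fun x hx => ?_⟩
    rw [← (t x).toFinite.cast_ncard_eq]
    congr 1
    have := (h x hx).trans (h x₀ h₀).symm
    exact_mod_cast this

/-! ### Line sums of a function on an affine space -/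

section LineSum

variable {F E V : Type*} [Field F] [AddCommGroup E] [Module F E] [AddCommGroup V] [Module F V]

/-- The point of `PG(V)` with affine coordinates `x`. -/
def affinePoint (g : (F × E) ≃ₗ[F] V) (x : E) : PGPoint F V :=
  Projectivization.mk F (g (1, x)) fun h => one_ne_zero (α := F) (by
    have := g.map_eq_zero_iff.1 h
    exact congrArg Prod.fst this)

/-- The plane at infinity. -/
def infinitePlane (g : (F × E) ≃ₗ[F] V) : Submodule F V :=
  (LinearMap.range (LinearMap.inr F F E)).map (g : (F × E) →ₗ[F] V)

open Classical in
/-- The sum of the function `f` over the affine points of the line `ℓ`. -/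
noncomputable def lineSum [Fintype E] (g : (F × E) ≃ₗ[F] V) (f : E → ℝ) (ℓ : PGLine F V) : ℝ :=
  ∑ z ∈ Finset.univ.filter (fun z : E => g (1, z) ∈ ℓ.1), f z

variable {g : (F × E) ≃ₗ[F] V}

lemma mem_infinitePlane {a : F} {x : E} : g (a, x) ∈ infinitePlane g ↔ a = 0 := by
  simp only [infinitePlane, Submodule.mem_map, LinearMap.mem_range]
  constructor
  · rintro ⟨_, ⟨y, rfl⟩, h⟩
    have := g.injective h
    exact (congrArg Prod.fst this).symm
  · rintro rfl
    exact ⟨_, ⟨x, rfl⟩, rfl⟩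

lemma incident_affinePoint {x : E} {ℓ : PGLine F V} :
    PGIncident (affinePoint g x) ℓ ↔ g (1, x) ∈ ℓ.1 := by
  rw [PGIncident, affinePoint, Projectivization.submodule_mk, Submodule.span_singleton_le_iff_mem]

lemma affinePoint_notMem_infinitePlane (x : E) :
    affinePoint g x ∉ pgPointsIn (infinitePlane g) := by
  rw [pgPointsIn, Set.mem_ofPred_eq, affinePoint, Projectivization.submodule_mk,
    Submodule.span_singleton_le_iff_mem, mem_infinitePlane]
  exact one_ne_zero

lemma affinePoint_injective : Function.Injective (affinePoint g) := by
  intro x y h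
  rw [affinePoint, affinePoint, Projectivization.mk_eq_mk_iff'] at h
  obtain ⟨a, ha⟩ := h
  rw [← map_smul] at ha
  have := g.injective ha
  simp only [Prod.smul_mk, Prod.mk.injEq, smul_eq_mul, mul_one] at this
  rw [← this.2, this.1, one_smul]

lemma exists_affinePoint (R : PGPoint F V) (hR : R ∉ pgPointsIn (infinitePlane g)) :
    ∃ x, R = affinePoint g x := by
  induction R using Projectivization.ind with
  | h v hv =>
    obtain ⟨⟨a, x⟩, rfl⟩ := g.surjective v
    rw [pgPointsIn, Set.mem_ofPred_eq, Projectivization.submodule_mk,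
      Submodule.span_singleton_le_iff_mem, mem_infinitePlane] at hR
    refine ⟨a⁻¹ • x, ?_⟩
    rw [affinePoint, Projectivization.mk_eq_mk_iff']
    exact ⟨a, by rw [← map_smul, Prod.smul_mk, smul_inv_smul₀ hR, smul_eq_mul, mul_one]⟩

lemma exists_mem_of_not_le (ℓ : PGLine F V) (h : ¬ ℓ.1 ≤ infinitePlane g) :
    ∃ x, g (1, x) ∈ ℓ.1 := by
  obtain ⟨v, hv, hvn⟩ := SetLike.not_le_iff_exists.1 h
  obtain ⟨⟨a, x⟩, rfl⟩ := g.surjective v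
  rw [mem_infinitePlane] at hvn
  refine ⟨a⁻¹ • x, ?_⟩
  have := ℓ.1.smul_mem a⁻¹ hv
  rwa [← map_smul, Prod.smul_mk, smul_eq_mul, inv_mul_cancel₀ hvn] at this

lemma finrank_span_affine (x : E) {y : E} (hy : y ≠ 0) :
    Module.finrank F (Submodule.span F {g (1, x), g (0, y)}) = 2 := by
  have hli : LinearIndependent F ![g (1, x), g (0, y)] := by
    rw [LinearIndependent.pair_iff]
    intro s t h
    rw [← map_smul, ← map_smul, ← map_add, g.map_eq_zero_iff] at h
    simp only [Prod.smul_mk, smul_eq_mul, mul_one, mul_zero, Prod.mk_add_mk, add_zero,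
      Prod.mk_eq_zero] at h
    obtain ⟨rfl, h2⟩ := h
    rw [zero_smul, zero_add] at h2
    exact ⟨rfl, (smul_eq_zero.1 h2).resolve_right hy⟩
  have := finrank_span_eq_card hli
  rwa [Matrix.range_cons_cons_empty, Fintype.card_fin] at this

lemma exists_param (ℓ : PGLine F V) (h : ¬ ℓ.1 ≤ infinitePlane g) :
    ∃ x y, y ≠ 0 ∧ ℓ.1 = Submodule.span F {g (1, x), g (0, y)} := by
  obtain ⟨x, hx⟩ := exists_mem_of_not_le ℓ h
  have hfd : FiniteDimensional F ℓ.1 := FiniteDimensional.of_finrank_pos (by rw [ℓ.2]; norm_num)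
  obtain ⟨v, hv, hvn⟩ : ∃ v ∈ ℓ.1, v ∉ Submodule.span F {g (1, x)} := by
    by_contra! hcon
    have h1 := Submodule.finrank_mono (R := F) (s := ℓ.1) (t := Submodule.span F {g (1, x)}) hcon
    have h2 := Projectivization.finrank_submodule (affinePoint g x)
    rw [affinePoint, Projectivization.submodule_mk] at h2
    have := ℓ.2
    omega
  obtain ⟨⟨b, y⟩, rfl⟩ := g.surjective v
  have hy : y - b • x ≠ 0 := by
    intro h0
    apply hvn
    rw [Submodule.mem_span_singleton]
    refine ⟨b, ?_⟩
    rw [← map_smul, Prod.smul_mk, smul_eq_mul, mul_one, ← sub_eq_zero.1 h0]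
  refine ⟨x, y - b • x, hy, ?_⟩
  symm
  apply Submodule.eq_of_le_of_finrank_eq
  · rw [Submodule.span_le]
    rintro _ (rfl | rfl)
    · exact hx
    · have := ℓ.1.sub_mem hv (ℓ.1.smul_mem b hx)
      rw [← map_smul, ← map_sub, Prod.smul_mk, smul_eq_mul, mul_one, Prod.mk_sub_mk, sub_self]
        at this
      exact this
  · rw [finrank_span_affine x hy, ℓ.2]

lemma mem_span_affine {x y z : E} :
    g (1, z) ∈ Submodule.span F {g (1, x), g (0, y)} ↔ ∃ s : F, z = x + s • y := by
  rw [Submodule.mem_span_pair]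
  constructor
  · rintro ⟨a, s, h⟩
    rw [← map_smul, ← map_smul, ← map_add] at h
    have := g.injective h
    simp only [Prod.smul_mk, smul_eq_mul, mul_one, mul_zero, Prod.mk_add_mk, add_zero,
      Prod.mk.injEq] at this
    refine ⟨s, ?_⟩
    rw [← this.2, this.1, one_smul]
  · rintro ⟨s, rfl⟩
    refine ⟨1, s, ?_⟩
    rw [one_smul, ← map_smul, ← map_add]
    simp

variable [Fintype F] [Fintype E]

lemma lineSum_param (f : E → ℝ) {ℓ : PGLine F V} {x y : E} (hy : y ≠ 0)
    (hℓ : ℓ.1 = Submodule.span F {g (1, x), g (0, y)}) :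
    lineSum g f ℓ = ∑ s : F, f (x + s • y) := by
  classical
  have hinj : Function.Injective fun s : F => x + s • y := fun s t h => by
    have : (s - t) • y = 0 := by rw [sub_smul, sub_eq_zero]; exact add_left_cancel h
    exact sub_eq_zero.1 ((smul_eq_zero.1 this).resolve_right hy)
  rw [lineSum, ← Finset.sum_image (f := f) (g := fun s : F => x + s • y) (s := Finset.univ)
    hinj.injOn]
  refine Finset.sum_congr ?_ fun _ _ => rfl
  ext z
  simp only [Finset.mem_filter, Finset.mem_univ, true_and, Finset.mem_image, hℓ, mem_span_affine]
  exact exists_congr fun s => eq_comm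

lemma lineSum_infinite (f : E → ℝ) {ℓ : PGLine F V} (h : ℓ.1 ≤ infinitePlane g) :
    lineSum g f ℓ = 0 := by
  classical
  rw [lineSum]
  apply Finset.sum_eq_zero
  intro z hz
  have := h (Finset.mem_filter.1 hz).2
  rw [mem_infinitePlane] at this
  exact absurd this one_ne_zero

lemma lineSum_one {ℓ : PGLine F V} (h : ¬ ℓ.1 ≤ infinitePlane g) :
    lineSum g (fun _ => 1) ℓ = Fintype.card F := by
  obtain ⟨x, y, hy, hℓ⟩ := exists_param ℓ h
  rw [lineSum_param _ hy hℓ]; simp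

lemma lineSum_through_origin {f : E → ℝ} (hf : ∀ x ≠ 0, ∑ s : F, f (s • x) = 0)
    {ℓ : PGLine F V} (h : PGIncident (affinePoint g 0) ℓ) : lineSum g f ℓ = 0 := by
  rw [incident_affinePoint] at h
  have hn : ¬ ℓ.1 ≤ infinitePlane g := fun hle =>
    one_ne_zero (α := F) (mem_infinitePlane.1 (hle h))
  obtain ⟨x, y, hy, hℓ⟩ := exists_param ℓ hn
  rw [hℓ, mem_span_affine] at h
  obtain ⟨t, ht⟩ := h
  rw [lineSum_param _ hy hℓ, ← hf y hy]
  refine Fintype.sum_equiv (Equiv.subRight t) _ _ fun s => ?_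
  congr 1
  rw [Equiv.subRight_apply, sub_smul, eq_neg_of_add_eq_zero_left ht.symm]
  abel

/-- Sum over all s and x: each of the q − 1 nonzero scalars permutes E, so (q − 1)∑f = 0. -/
lemma sum_eq_zero_of_sum_smul {f : E → ℝ} (h0 : f 0 = 0)
    (hf : ∀ x ≠ 0, ∑ s : F, f (s • x) = 0) : ∑ x, f x = 0 := by
  classical
  have h1 : ∑ s : F, ∑ x, f (s • x) = 0 := by
    rw [Finset.sum_comm]
    refine Finset.sum_eq_zero fun x _ => ?_
    rcases eq_or_ne x 0 with rfl | hx
    · simp [h0]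
    · exact hf x hx
  have h2 : ∀ s : F, s ≠ 0 → ∑ x, f (s • x) = ∑ x, f x := fun s hs =>
    Fintype.sum_equiv (MulAction.toPerm (Units.mk0 s hs)) _ _ fun x => rfl
  have h3 : ∑ x, f ((0 : F) • x) = 0 := by simp [h0]
  rw [← Finset.add_sum_erase _ _ (Finset.mem_univ (0 : F)), h3, zero_add,
    Finset.sum_congr rfl fun s hs => h2 s (Finset.ne_of_mem_erase hs), Finset.sum_const,
    Finset.card_erase_of_mem (Finset.mem_univ _), Finset.card_univ, nsmul_eq_mul] at h1
  refine (mul_eq_zero.1 h1).resolve_left ?_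
  have := Fintype.one_lt_card (α := F)
  exact Nat.cast_ne_zero.2 (by omega)

open Classical in
-- Extending f by zero off the vectors with first coordinate 1 turns counts over vectors into counts
-- over affine points.
lemma sum_affine_vectors [Fintype V] (f : E → ℝ) (P : V → Prop) [DecidablePred P] :
    ∑ v ∈ Finset.univ.filter P, (if (g.symm v).1 = 1 then f (g.symm v).2 else 0) =
      ∑ z ∈ Finset.univ.filter (fun z => P (g (1, z))), f z := by
  rw [Finset.sum_filter, Finset.sum_filter, ← Equiv.sum_comp g.toEquiv, Fintype.sum_prod_type,
    Finset.sum_eq_single 1]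
  · simp
  · intro a _ ha
    refine Finset.sum_eq_zero fun x _ => ?_
    simp [ha]
  · simp

open Classical in
-- The point x is counted on q² + q + 1 lines and every other affine point on one; as f has total 0,
-- the others contribute −f(x).
lemma sum_lineSum_affinePoint [Fintype V] [Fintype (PGLine F V)] (hV : Module.finrank F V = 4)
    {f : E → ℝ} (hf : ∑ x, f x = 0) (x : E) :
    ∑ ℓ ∈ Finset.univ.filter (fun ℓ : PGLine F V => PGIncident (affinePoint g x) ℓ),
      lineSum g f ℓ = ((Fintype.card F : ℝ) ^ 2 + Fintype.card F) * f x := by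
  have h := sum_lines_through (affinePoint g x)
    (fun v => if (g.symm v).1 = 1 then f (g.symm v).2 else 0)
  simp only [sum_affine_vectors] at h
  have hmem : ∀ z, g (1, z) ∈ (affinePoint g x).submodule ↔ z = x := by
    intro z
    rw [affinePoint, Projectivization.submodule_mk, Submodule.mem_span_singleton]
    constructor
    · rintro ⟨a, ha⟩
      rw [← map_smul] at ha
      have := g.injective ha
      simp only [Prod.smul_mk, Prod.mk.injEq, smul_eq_mul, mul_one] at this
      rw [← this.2, this.1, one_smul]
    · rintro rfl; exact ⟨1, one_smul _ _⟩
  simp only [hmem] at h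
  have h1 : ∀ ℓ ∈ Finset.univ.filter (fun ℓ : PGLine F V => PGIncident (affinePoint g x) ℓ),
      ∑ z ∈ Finset.univ.filter (fun z => g (1, z) ∈ ℓ.1 ∧ ¬ z = x), f z = lineSum g f ℓ - f x := by
    intro ℓ hℓ
    rw [lineSum, ← Finset.filter_filter, Finset.filter_ne',
      Finset.sum_erase_eq_sub]
    simpa [incident_affinePoint] using hℓ
  have h2 : ∑ z ∈ Finset.univ.filter (fun z => ¬ z = x), f z = - f x := by
    rw [Finset.filter_ne', Finset.sum_erase_eq_sub (Finset.mem_univ _), hf, zero_sub]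
  rw [Finset.sum_congr rfl h1, h2, Finset.sum_sub_distrib, Finset.sum_const, nsmul_eq_mul,
    card_lines_through hV] at h
  linear_combination h

open Classical in
-- The lines through a point at infinity cover each affine point exactly once.
lemma sum_lineSum_infinite [Fintype V] [Fintype (PGLine F V)] (f : E → ℝ) {R : PGPoint F V}
    (hR : R ∈ pgPointsIn (infinitePlane g)) :
    ∑ ℓ ∈ Finset.univ.filter (fun ℓ : PGLine F V => PGIncident R ℓ), lineSum g f ℓ = ∑ x, f x := by
  have h := sum_lines_through R (fun v => if (g.symm v).1 = 1 then f (g.symm v).2 else 0)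
  simp only [sum_affine_vectors] at h
  have hmem : ∀ z, g (1, z) ∉ R.submodule := fun z hz =>
    one_ne_zero (α := F) (mem_infinitePlane.1 (hR hz))
  simpa [hmem, lineSum] using h

end LineSum

/-! ### The decomposition attached to a function with two line sums -/

/-- The function `r` on an affine space takes the values `1` and `-1` off the origin, has sum zero on
the lines through the origin and sum `w` or `-w` on all other affine lines. -/
structure IsTwoLineSum {F E V : Type*} [Field F] [AddCommGroup E] [Module F E] [AddCommGroup V]
    [Module F V] [Fintype F] [Fintype E] (g : (F × E) ≃ₗ[F] V) (r : E → ℝ) (w : ℝ) : Prop where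
  zero : r 0 = 0
  sign : ∀ x ≠ 0, r x = 1 ∨ r x = -1
  sum_smul : ∀ x ≠ 0, ∑ s : F, r (s • x) = 0
  sq_eq : w ^ 2 = Fintype.card F
  lineSum_eq : ∀ ℓ : PGLine F V, ¬ PGIncident (affinePoint g 0) ℓ → ¬ ℓ.1 ≤ infinitePlane g →
    lineSum g r ℓ = w ∨ lineSum g r ℓ = -w

namespace IsTwoLineSum

variable {F E V : Type*} [Field F] [AddCommGroup E] [Module F E] [AddCommGroup V]
    [Module F V] [Fintype F] [Fintype E] {g : (F × E) ≃ₗ[F] V} {r : E → ℝ} {w : ℝ}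

lemma ne_zero (h : IsTwoLineSum g r w) : w ≠ 0 := by
  rintro rfl
  have := h.sq_eq
  rw [zero_pow two_ne_zero] at this
  exact Nat.cast_ne_zero.2 Fintype.card_ne_zero this.symm

lemma sum_eq_zero (h : IsTwoLineSum g r w) : ∑ x, r x = 0 :=
  sum_eq_zero_of_sum_smul h.zero h.sum_smul

lemma ne_neg (h : IsTwoLineSum g r w) : w ≠ -w := fun h1 =>
  h.ne_zero (by linarith)

lemma origin_notMem {ℓ : PGLine F V} (h : PGIncident (affinePoint g 0) ℓ) :
    ¬ ℓ.1 ≤ infinitePlane g := fun hle =>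
  one_ne_zero (α := F) (mem_infinitePlane.1 (hle (incident_affinePoint.1 h)))

open Classical in
lemma indicator_sum (h : IsTwoLineSum g r w) (ℓ : PGLine F V) :
    (if ℓ ∈ pgStar (affinePoint g 0) then (1 : ℝ) else 0) +
      (if ℓ ∈ pgLinesIn (infinitePlane g) then 1 else 0) +
      (if ℓ ∈ {ℓ | lineSum g r ℓ = w} then 1 else 0) +
      (if ℓ ∈ {ℓ | lineSum g r ℓ = -w} then 1 else 0) = 1 := by
  have hw := h.ne_zero
  have hw' := h.ne_neg
  by_cases h1 : PGIncident (affinePoint g 0) ℓ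
  · have e := lineSum_through_origin h.sum_smul h1
    simp [pgStar, pgLinesIn, e, h1, origin_notMem h1, hw.symm, hw]
  by_cases h2 : ℓ.1 ≤ infinitePlane g
  · have e := lineSum_infinite r h2
    simp [pgStar, pgLinesIn, e, h1, h2, hw.symm, hw]
  rcases h.lineSum_eq ℓ h1 h2 with h3 | h3 <;>
    simp [pgStar, pgLinesIn, h3, h1, h2, hw', hw'.symm]

open Classical in
-- Together with `indicator_sum` this gives, after summing over a star, the difference and the sum
-- of the two unknown degrees of a point.
lemma indicator_diff (h : IsTwoLineSum g r w) (ℓ : PGLine F V) :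
    lineSum g r ℓ = w * ((if ℓ ∈ {ℓ | lineSum g r ℓ = w} then 1 else 0) -
      (if ℓ ∈ {ℓ | lineSum g r ℓ = -w} then 1 else 0)) := by
  have hw := h.ne_zero
  have hw' := h.ne_neg
  by_cases h1 : PGIncident (affinePoint g 0) ℓ
  · have e := lineSum_through_origin h.sum_smul h1
    simp [e, hw.symm, hw]
  by_cases h2 : ℓ.1 ≤ infinitePlane g
  · have e := lineSum_infinite r h2
    simp [e, hw.symm, hw]
  rcases h.lineSum_eq ℓ h1 h2 with h3 | h3 <;> simp [h3, hw', hw'.symm]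

section Lines

variable [Finite V]

open Classical in
lemma ncard_lines [Fintype (PGLine F V)] (R : PGPoint F V) (B : Set (PGLine F V)) :
    ({ℓ ∈ B | PGIncident R ℓ}.ncard : ℝ) =
      ∑ ℓ ∈ Finset.univ.filter (fun ℓ : PGLine F V => PGIncident R ℓ), if ℓ ∈ B then 1 else 0 := by
  rw [Finset.sum_boole, Finset.filter_filter, ← Set.ncard_coe_finset]
  congr 2
  ext ℓ
  simp [and_comm]

lemma ncard_lines_add (h : IsTwoLineSum g r w) (hV : Module.finrank F V = 4) (R : PGPoint F V) :
    ({ℓ ∈ pgStar (affinePoint g 0) | PGIncident R ℓ}.ncard : ℝ) +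
      {ℓ ∈ pgLinesIn (infinitePlane g) | PGIncident R ℓ}.ncard +
      {ℓ ∈ {ℓ | lineSum g r ℓ = w} | PGIncident R ℓ}.ncard +
      {ℓ ∈ {ℓ | lineSum g r ℓ = -w} | PGIncident R ℓ}.ncard =
      (Fintype.card F : ℝ) ^ 2 + Fintype.card F + 1 := by
  classical
  have := Fintype.ofFinite V
  have := Fintype.ofFinite (PGLine F V)
  rw [ncard_lines, ncard_lines, ncard_lines, ncard_lines, ← Finset.sum_add_distrib,
    ← Finset.sum_add_distrib, ← Finset.sum_add_distrib, ← card_lines_through hV R,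
    Finset.sum_congr rfl fun ℓ _ => h.indicator_sum ℓ]
  simp

lemma ncard_lines_sub_affinePoint (h : IsTwoLineSum g r w) (hV : Module.finrank F V = 4) (x : E) :
    ({ℓ ∈ {ℓ | lineSum g r ℓ = w} | PGIncident (affinePoint g x) ℓ}.ncard : ℝ) -
      {ℓ ∈ {ℓ | lineSum g r ℓ = -w} | PGIncident (affinePoint g x) ℓ}.ncard =
      (Fintype.card F + 1) * (w * r x) := by
  classical
  have := Fintype.ofFinite V
  have := Fintype.ofFinite (PGLine F V)
  have h1 := sum_lineSum_affinePoint (g := g) hV h.sum_eq_zero x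
  rw [Finset.sum_congr rfl fun ℓ _ => h.indicator_diff ℓ, ← Finset.mul_sum,
    Finset.sum_sub_distrib, ← ncard_lines, ← ncard_lines] at h1
  apply mul_left_cancel₀ h.ne_zero
  rw [h1, ← h.sq_eq]; ring

lemma ncard_lines_sub_infinite (h : IsTwoLineSum g r w) {R : PGPoint F V}
    (hR : R ∈ pgPointsIn (infinitePlane g)) :
    ({ℓ ∈ {ℓ | lineSum g r ℓ = w} | PGIncident R ℓ}.ncard : ℝ) -
      {ℓ ∈ {ℓ | lineSum g r ℓ = -w} | PGIncident R ℓ}.ncard = 0 := by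
  classical
  have := Fintype.ofFinite V
  have := Fintype.ofFinite (PGLine F V)
  have h1 := sum_lineSum_infinite r hR
  rw [h.sum_eq_zero, Finset.sum_congr rfl fun ℓ _ => h.indicator_diff ℓ, ← Finset.mul_sum,
    Finset.sum_sub_distrib, ← ncard_lines, ← ncard_lines] at h1
  exact (mul_eq_zero.1 h1).resolve_left h.ne_zero

/-- Apply the star sum to the constant 1: the lines through R not at infinity carry q affine points
each and together cover all q³. -/
lemma ncard_infinite_lines (hE : Module.finrank F E = 3) (hV : Module.finrank F V = 4)
    {R : PGPoint F V} (hR : R ∈ pgPointsIn (infinitePlane g)) :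
    ({ℓ ∈ pgLinesIn (infinitePlane g) | PGIncident R ℓ}.ncard : ℝ) = Fintype.card F + 1 := by
  classical
  have := Fintype.ofFinite V
  have := Fintype.ofFinite (PGLine F V)
  have h1 := sum_lineSum_infinite (fun _ => (1 : ℝ)) hR
  have h2 : ∀ ℓ : PGLine F V, lineSum g (fun _ => 1) ℓ =
      Fintype.card F * (1 - if ℓ ∈ pgLinesIn (infinitePlane g) then 1 else 0) := by
    intro ℓ
    by_cases h : ℓ.1 ≤ infinitePlane g
    · rw [lineSum_infinite _ h]; simp [pgLinesIn, h]
    · rw [lineSum_one h]; simp [pgLinesIn, h]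
  rw [Finset.sum_congr rfl fun ℓ _ => h2 ℓ, ← Finset.mul_sum, Finset.sum_sub_distrib,
    ← ncard_lines, Finset.sum_const, Finset.sum_const, nsmul_eq_mul, nsmul_eq_mul, mul_one,
    mul_one, card_lines_through hV, Finset.card_univ, Module.card_eq_pow_finrank (K := F) (V := E),
    hE] at h1
  have hq : (Fintype.card F : ℝ) ≠ 0 := Nat.cast_ne_zero.2 Fintype.card_ne_zero
  apply mul_left_cancel₀ hq
  push_cast at h1
  linear_combination -h1

lemma ncard_infinite_lines_affinePoint (x : E) :
    ({ℓ ∈ pgLinesIn (infinitePlane g) | PGIncident (affinePoint g x) ℓ}.ncard : ℝ) = 0 := by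
  have : {ℓ ∈ pgLinesIn (infinitePlane g) | PGIncident (affinePoint g x) ℓ} = ∅ := by
    ext ℓ
    simp only [Set.mem_ofPred_eq, Set.mem_empty_iff_false, iff_false, not_and]
    intro h1 h2
    exact one_ne_zero (α := F) (mem_infinitePlane.1 (h1 (incident_affinePoint.1 h2)))
  rw [this]; simp

lemma ncard_star_lines {R : PGPoint F V} (hR : R ≠ affinePoint g 0) :
    ({ℓ ∈ pgStar (affinePoint g 0) | PGIncident R ℓ}.ncard : ℝ) = 1 := by
  exact_mod_cast ncard_lines_through_two (affinePoint g 0) R hR.symm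

end Lines

section Points

/-- The affine points where `r` takes the value `ε`. -/
def pointsWithValue (g : (F × E) ≃ₗ[F] V) (r : E → ℝ) (ε : ℝ) : Set (PGPoint F V) :=
  affinePoint g '' {x | r x = ε}

open Classical in
lemma ncard_pointsWithValue (ε : ℝ) (ℓ : PGLine F V) :
    ({R ∈ pointsWithValue g r ε | PGIncident R ℓ}.ncard : ℝ) =
      lineSum g (fun z => if r z = ε then 1 else 0) ℓ := by
  rw [lineSum, Finset.sum_boole, Finset.filter_filter, ← Set.ncard_coe_finset,
    ← Set.ncard_image_of_injective _ (affinePoint_injective (g := g))]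
  congr 2
  ext R
  simp only [pointsWithValue, Set.mem_ofPred_eq, Set.mem_image, Finset.coe_filter, Finset.mem_univ,
    true_and]
  constructor
  · rintro ⟨⟨x, hx, rfl⟩, hR⟩
    exact ⟨x, ⟨incident_affinePoint.1 hR, hx⟩, rfl⟩
  · rintro ⟨x, ⟨h1, h2⟩, rfl⟩
    exact ⟨⟨x, h2, rfl⟩, incident_affinePoint.2 h1⟩

open Classical in
-- The indicator of r = ε is (1 − [z = 0] + ε r(z))/2; sum it over the line.
lemma ncard_pointsWithValue_eq (h : IsTwoLineSum g r w) {ε : ℝ} (hε : ε = 1 ∨ ε = -1)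
    {ℓ : PGLine F V} (hℓ : ¬ ℓ.1 ≤ infinitePlane g) :
    ({R ∈ pointsWithValue g r ε | PGIncident R ℓ}.ncard : ℝ) =
      (Fintype.card F - (if PGIncident (affinePoint g 0) ℓ then 1 else 0) +
        ε * lineSum g r ℓ) / 2 := by
  rw [ncard_pointsWithValue, ← lineSum_one hℓ]
  have h1 : (if PGIncident (affinePoint g 0) ℓ then (1 : ℝ) else 0) =
      lineSum g (fun z => if z = 0 then 1 else 0) ℓ := by
    rw [lineSum, Finset.sum_ite_eq']
    simp [incident_affinePoint]
  rw [h1]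
  simp only [lineSum]
  rw [Finset.mul_sum, ← Finset.sum_sub_distrib, ← Finset.sum_add_distrib, Finset.sum_div]
  refine Finset.sum_congr rfl fun z _ => ?_
  rcases eq_or_ne z 0 with rfl | hz
  · rw [h.zero]
    rcases hε with rfl | rfl <;> norm_num
  · rcases hε with rfl | rfl <;> rcases h.sign z hz with h2 | h2 <;> rw [h2] <;> norm_num [hz]

lemma ncard_infinite_points [Finite V] (ℓ : PGLine F V) :
    ({R ∈ pgPointsIn (infinitePlane g) | PGIncident R ℓ}.ncard : ℝ) =
      Fintype.card F + 1 - lineSum g (fun _ => 1) ℓ := by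
  classical
  have h1 : {R : PGPoint F V | PGIncident R ℓ} =
      {R ∈ pgPointsIn (infinitePlane g) | PGIncident R ℓ} ∪
        affinePoint g '' ↑(Finset.univ.filter fun z : E => g (1, z) ∈ ℓ.1) := by
    ext R
    simp only [Set.mem_ofPred_eq, Set.mem_union, Set.mem_image, Finset.coe_filter, Finset.mem_univ,
      true_and]
    constructor
    · intro hR
      by_cases hp : R ∈ pgPointsIn (infinitePlane g)
      · exact Or.inl ⟨hp, hR⟩
      · obtain ⟨x, rfl⟩ := exists_affinePoint R hp
        exact Or.inr ⟨x, incident_affinePoint.1 hR, rfl⟩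
    · rintro (hR | ⟨x, hx, rfl⟩)
      · exact hR.2
      · exact incident_affinePoint.2 hx
  have h2 := ncard_points_on_line ℓ
  rw [h1, Set.ncard_union_eq, Set.ncard_image_of_injective _ affinePoint_injective,
    Set.ncard_coe_finset, Nat.card_eq_fintype_card] at h2
  · rw [lineSum, Finset.sum_const, nsmul_eq_mul, mul_one, eq_sub_iff_add_eq]
    exact_mod_cast h2
  · rw [Set.disjoint_left]
    rintro _ hR ⟨x, -, rfl⟩
    exact affinePoint_notMem_infinitePlane x hR.1

lemma ncard_origin (ℓ : PGLine F V) [Decidable (PGIncident (affinePoint g 0) ℓ)] :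
    ({R ∈ ({affinePoint g 0} : Set (PGPoint F V)) | PGIncident R ℓ}.ncard : ℝ) =
      if PGIncident (affinePoint g 0) ℓ then 1 else 0 := by
  split_ifs with h
  · have : {R ∈ ({affinePoint g 0} : Set (PGPoint F V)) | PGIncident R ℓ} = {affinePoint g 0} := by
      ext R
      simp only [Set.mem_singleton_iff, Set.mem_ofPred_eq, and_iff_left_iff_imp]
      rintro rfl; exact h
    rw [this]; simp
  · have : {R ∈ ({affinePoint g 0} : Set (PGPoint F V)) | PGIncident R ℓ} = ∅ := by
      ext R
      simp only [Set.mem_singleton_iff, Set.mem_ofPred_eq, Set.mem_empty_iff_false, iff_false,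
        not_and]
      rintro rfl; exact h
    rw [this]; simp

/-- On a line through the origin the values ±1 cancel, so both occur. -/
lemma exists_value (h : IsTwoLineSum g r w) [Nontrivial E] {ε : ℝ} (hε : ε = 1 ∨ ε = -1) :
    ∃ x, r x = ε := by
  obtain ⟨x, hx⟩ := exists_ne (0 : E)
  have hεε : ε * ε = 1 := by rcases hε with rfl | rfl <;> norm_num
  by_contra! hne
  have hle : ∀ s : F, ε * r (s • x) ≤ 0 := by
    intro s
    rcases eq_or_ne (s • x) 0 with h0 | h0
    · rw [h0, h.zero, mul_zero]
    · have h1 := hne (s • x)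
      rcases hε with rfl | rfl <;> rcases h.sign _ h0 with h2 | h2 <;> rw [h2] at h1 ⊢ <;>
        first | exact absurd rfl h1 | norm_num
  have hsum : ∑ s : F, ε * r (s • x) = 0 := by rw [← Finset.mul_sum, h.sum_smul x hx, mul_zero]
  have := (Finset.sum_eq_zero_iff_of_nonpos fun s _ => hle s).1 hsum 1 (Finset.mem_univ _)
  rw [one_smul] at this
  rcases hε with rfl | rfl <;> rcases h.sign _ hx with h2 | h2 <;> rw [h2] at this <;>
    norm_num at this

end Points

end IsTwoLineSum

/-! ### Degrees of the points and assembly of the four classes -/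

namespace IsTwoLineSum

variable {F E V : Type*} [Field F] [AddCommGroup E] [Module F E] [AddCommGroup V]
    [Module F V] [Fintype F] [Fintype E] [Finite V] {g : (F × E) ≃ₗ[F] V} {r : E → ℝ} {w : ℝ}

lemma degree_origin (h : IsTwoLineSum g r w) {c : ℝ} (hc : c ≠ 0) :
    ({ℓ ∈ {ℓ | lineSum g r ℓ = c} | PGIncident (affinePoint g 0) ℓ}.ncard : ℝ) = 0 := by
  have : {ℓ ∈ {ℓ | lineSum g r ℓ = c} | PGIncident (affinePoint g 0) ℓ} = ∅ := by
    ext ℓ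
    simp only [Set.mem_ofPred_eq, Set.mem_empty_iff_false, iff_false, not_and]
    intro h1 h2
    rw [lineSum_through_origin h.sum_smul h2] at h1
    exact hc h1.symm
  rw [this]; simp

lemma degree_affinePoint (h : IsTwoLineSum g r w) (hV : Module.finrank F V = 4) {x : E}
    (hx : x ≠ 0) :
    ({ℓ ∈ {ℓ | lineSum g r ℓ = w} | PGIncident (affinePoint g x) ℓ}.ncard : ℝ) =
      (Fintype.card F + 1) * (Fintype.card F + w * r x) / 2 ∧
    ({ℓ ∈ {ℓ | lineSum g r ℓ = -w} | PGIncident (affinePoint g x) ℓ}.ncard : ℝ) =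
      (Fintype.card F + 1) * (Fintype.card F - w * r x) / 2 := by
  have h1 := h.ncard_lines_add hV (affinePoint g x)
  have h2 := h.ncard_lines_sub_affinePoint hV x
  rw [ncard_star_lines (fun h0 => hx (affinePoint_injective h0)),
    ncard_infinite_lines_affinePoint] at h1
  constructor <;> linarith

lemma degree_infinite (h : IsTwoLineSum g r w) (hE : Module.finrank F E = 3)
    (hV : Module.finrank F V = 4) {R : PGPoint F V} (hR : R ∈ pgPointsIn (infinitePlane g)) :
    ({ℓ ∈ {ℓ | lineSum g r ℓ = w} | PGIncident R ℓ}.ncard : ℝ) =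
      ((Fintype.card F : ℝ) ^ 2 - 1) / 2 ∧
    ({ℓ ∈ {ℓ | lineSum g r ℓ = -w} | PGIncident R ℓ}.ncard : ℝ) =
      ((Fintype.card F : ℝ) ^ 2 - 1) / 2 := by
  have h1 := h.ncard_lines_add hV R
  have h2 := h.ncard_lines_sub_infinite hR
  rw [ncard_star_lines (fun h0 => affinePoint_notMem_infinitePlane 0 (h0 ▸ hR)),
    ncard_infinite_lines hE hV hR] at h1
  constructor <;> linarith

/-- The points on a prescribed number of lines with sum `w`. -/
lemma pointsOfHalfDegree_eq (h : IsTwoLineSum g r w) (hE : Module.finrank F E = 3)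
    (hV : Module.finrank F V = 4) {n : ℕ} {Q σ δ : ℝ} (hQ : 1 < Q) (hσ : σ = 1 ∨ σ = -1)
    (hδ : δ = 1 ∨ δ = -1) (hw : w = δ * Q)
    (hn : (n : ℝ) = (Fintype.card F + 1) * (Fintype.card F + σ * Q)) :
    pointsOfHalfDegree {ℓ | lineSum g r ℓ = w} n = pointsWithValue g r (σ * δ) := by
  have hq : (Fintype.card F : ℝ) = Q ^ 2 := by
    rw [← h.sq_eq, hw]; rcases hδ with rfl | rfl <;> ring
  have hQ2 : Q < Q ^ 2 := by nlinarith
  have hσQ : -Q ≤ σ * Q := by rcases hσ with rfl | rfl <;> linarith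
  have key : ∀ R : PGPoint F V, R ∈ pointsOfHalfDegree {ℓ | lineSum g r ℓ = w} n ↔
      2 * ({ℓ ∈ {ℓ | lineSum g r ℓ = w} | PGIncident R ℓ}.ncard : ℝ) = (Q ^ 2 + 1) * (Q ^ 2 + σ * Q) := by
    intro R
    rw [← hq, ← hn, pointsOfHalfDegree, Set.mem_ofPred_eq,
      show pgStar R ∩ {ℓ | lineSum g r ℓ = w} =
        {ℓ ∈ {ℓ | lineSum g r ℓ = w} | PGIncident R ℓ} from Set.inter_comm _ _]
    exact_mod_cast Iff.rfl
  ext R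
  rw [key]
  by_cases hR : R ∈ pgPointsIn (infinitePlane g)
  · rw [(h.degree_infinite hE hV hR).1, hq]
    constructor
    · intro h1
      exfalso
      -- A point at infinity has twice-degree (Q² + 1)(Q² − 1); equality would need σQ = −1,
      -- excluded by Q > 1.
      have h2 : (Q ^ 2 + 1) * (σ * Q + 1) = 0 := by linear_combination -h1
      rcases mul_eq_zero.1 h2 with h3 | h3
      · nlinarith [sq_nonneg Q]
      · rcases hσ with rfl | rfl <;> linarith
    · rintro ⟨x, -, rfl⟩
      exact absurd hR (affinePoint_notMem_infinitePlane x)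
  · obtain ⟨x, rfl⟩ := exists_affinePoint R hR
    have hmem : affinePoint g x ∈ pointsWithValue g r (σ * δ) ↔ r x = σ * δ := by
      constructor
      · rintro ⟨y, hy, hxy⟩
        rw [← affinePoint_injective hxy]; exact hy
      · exact fun hx => ⟨x, hx, rfl⟩
    rw [hmem]
    rcases eq_or_ne x 0 with rfl | hx
    · rw [h.degree_origin h.ne_zero, h.zero]
      constructor
      · intro h1
        have : 0 < (Q ^ 2 + 1) * (Q ^ 2 + σ * Q) := mul_pos (by positivity) (by linarith)
        linarith
      · intro h1
        rcases hσ with rfl | rfl <;> rcases hδ with rfl | rfl <;> norm_num at h1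
    · rw [(h.degree_affinePoint hV hx).1, hq, hw]
      have hpos : (Q ^ 2 + 1) * Q ≠ 0 := by positivity
      have e : 2 * ((Q ^ 2 + 1) * (Q ^ 2 + δ * Q * r x) / 2) = (Q ^ 2 + 1) * (Q ^ 2 + σ * Q) ↔
          δ * r x = σ := by
        constructor
        · intro h1
          apply mul_left_cancel₀ hpos
          linear_combination h1
        · intro h1
          linear_combination ((Q ^ 2 + 1) * Q) * h1
      rw [e]
      rcases hδ with rfl | rfl
      · simp
      · constructor <;> intro h1 <;> linarith

/-- A function with two line sums gives a symmetric tactical decomposition with four classes. -/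
theorem isFourClassDecomposition (h : IsTwoLineSum g r w) (hE : Module.finrank F E = 3) {e : ℕ}
    (he : 0 < e) (hq : Fintype.card F = 3 ^ (2 * e)) :
    IsFourClassDecomposition e (affinePoint g 0) (infinitePlane g)
      {ℓ | lineSum g r ℓ = w} {ℓ | lineSum g r ℓ = -w} := by
  classical
  have hV : Module.finrank F V = 4 := by
    rw [← g.finrank_eq, Module.finrank_prod, Module.finrank_self, hE]
  have : Nontrivial E := Module.nontrivial_of_finrank_pos (R := F) (by rw [hE]; norm_num)
  have hw0 := h.ne_zero
  have hwn := h.ne_neg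
  have hq1 : (1 : ℝ) < Fintype.card F := by exact_mod_cast Fintype.one_lt_card
  set Q : ℝ := 3 ^ e with hQ
  have hQ1 : 1 < Q := one_lt_pow₀ (by norm_num) he.ne'
  have hqQ : (Fintype.card F : ℝ) = Q ^ 2 := by
    rw [hq, hQ, ← pow_mul, mul_comm]; push_cast; rfl
  -- Only w² = q is known. The sign δ of w decides which value of r belongs to which of the two
  -- point classes.
  obtain ⟨δ, hδ, hwδ⟩ : ∃ δ : ℝ, (δ = 1 ∨ δ = -1) ∧ w = δ * Q := by
    have h1 : (w - Q) * (w + Q) = 0 := by linear_combination h.sq_eq + hqQ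
    rcases mul_eq_zero.1 h1 with h2 | h2
    · exact ⟨1, Or.inl rfl, by linarith⟩
    · exact ⟨-1, Or.inr rfl, by linarith⟩
  have hδ' : -δ = 1 ∨ -δ = -1 := by rcases hδ with rfl | rfl <;> norm_num
  have hc1 : pointClass₁ e {ℓ | lineSum g r ℓ = w} = pointsWithValue g r (-δ) := by
    rw [pointClass₁, h.pointsOfHalfDegree_eq hE hV hQ1 (Or.inr rfl : (-1 : ℝ) = 1 ∨ _) hδ hwδ,
      neg_one_mul]
    have hle : 3 ^ e ≤ 3 ^ (2 * e) := Nat.pow_le_pow_right (by norm_num) (by omega)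
    rw [← hq] at hle ⊢
    push_cast [Nat.cast_sub hle]
    rw [hQ]; ring
  have hc2 : pointClass₂ e {ℓ | lineSum g r ℓ = w} = pointsWithValue g r δ := by
    rw [pointClass₂, h.pointsOfHalfDegree_eq hE hV hQ1 (Or.inl rfl : (1 : ℝ) = 1 ∨ _) hδ hwδ,
      one_mul]
    rw [← hq]
    push_cast
    rw [hQ]; ring
  have hval : ∀ {ε : ℝ}, (ε = 1 ∨ ε = -1) → ∀ {R}, R ∈ pointsWithValue g r ε →
      ∃ x, x ≠ 0 ∧ r x = ε ∧ R = affinePoint g x := by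
    rintro ε hε R ⟨x, hx, rfl⟩
    refine ⟨x, ?_, hx, rfl⟩
    rintro rfl
    rw [Set.mem_ofPred_eq, h.zero] at hx
    rcases hε with rfl | rfl <;> norm_num at hx
  have hinf : (pgPointsIn (infinitePlane g)).Nonempty := by
    obtain ⟨y, hy⟩ := exists_ne (0 : E)
    have hy0 : g (0, y) ≠ 0 := by
      rw [Ne, g.map_eq_zero_iff]; simpa using hy
    refine ⟨Projectivization.mk F (g (0, y)) hy0, ?_⟩
    rw [pgPointsIn, Set.mem_ofPred_eq, Projectivization.submodule_mk,
      Submodule.span_singleton_le_iff_mem, mem_infinitePlane]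
  have hne_of : ∀ {R : PGPoint F V} {B : Set (PGLine F V)},
      0 < ({ℓ ∈ B | PGIncident R ℓ}.ncard : ℝ) → B.Nonempty := by
    intro R B hpos
    obtain ⟨ℓ, hℓ⟩ := Set.nonempty_of_ncard_ne_zero (by exact_mod_cast hpos.ne')
    exact ⟨ℓ, hℓ.1⟩
  -- Nonemptiness of all four line classes can be read off at one point at infinity, since it has
  -- positive degree in each.
  obtain ⟨R₀, hR₀⟩ := hinf
  have hpos : 0 < ((Fintype.card F : ℝ) ^ 2 - 1) / 2 := by nlinarith
  -- the partitions
  obtain ⟨hPP, hPc⟩ := isPartition_four (a := {affinePoint g 0})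
    (b := pgPointsIn (infinitePlane g)) (c := pointsWithValue g r (-δ))
    (d := pointsWithValue g r δ) (Set.singleton_nonempty _) ⟨R₀, hR₀⟩
    (by obtain ⟨x, hx⟩ := h.exists_value hδ'; exact ⟨_, x, hx, rfl⟩)
    (by obtain ⟨x, hx⟩ := h.exists_value hδ; exact ⟨_, x, hx, rfl⟩)
    (by
      intro R
      by_cases hR : R ∈ pgPointsIn (infinitePlane g)
      · exact Or.inr (Or.inl hR)
      · obtain ⟨x, rfl⟩ := exists_affinePoint R hR
        rcases eq_or_ne x 0 with rfl | hx
        · exact Or.inl rfl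
        · have : r x = -δ ∨ r x = δ := by
            rcases hδ with rfl | rfl
            · exact (h.sign x hx).symm
            · rw [neg_neg]; exact h.sign x hx
          rcases this with h1 | h1
          · exact Or.inr (Or.inr (Or.inl ⟨x, h1, rfl⟩))
          · exact Or.inr (Or.inr (Or.inr ⟨x, h1, rfl⟩)))
    (by rw [Set.disjoint_singleton_left]; exact affinePoint_notMem_infinitePlane 0)
    (by
      rw [Set.disjoint_singleton_left]; intro h1
      obtain ⟨x, hx, -, hx2⟩ := hval hδ' h1
      exact hx (affinePoint_injective hx2).symm)
    (by
      rw [Set.disjoint_singleton_left]; intro h1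
      obtain ⟨x, hx, -, hx2⟩ := hval hδ h1
      exact hx (affinePoint_injective hx2).symm)
    (by
      rw [Set.disjoint_right]; rintro _ ⟨x, -, rfl⟩
      exact affinePoint_notMem_infinitePlane x)
    (by
      rw [Set.disjoint_right]; rintro _ ⟨x, -, rfl⟩
      exact affinePoint_notMem_infinitePlane x)
    (by
      rw [Set.disjoint_left]; rintro _ ⟨x, hx, rfl⟩ ⟨y, hy, hxy⟩
      rw [affinePoint_injective hxy] at hy
      rw [Set.mem_ofPred_eq] at hx hy
      rw [hx] at hy
      rcases hδ with rfl | rfl <;> norm_num at hy)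
  obtain ⟨hLP, hLc⟩ := isPartition_four (a := pgStar (affinePoint g 0))
    (b := pgLinesIn (infinitePlane g)) (c := {ℓ | lineSum g r ℓ = w})
    (d := {ℓ | lineSum g r ℓ = -w})
    (hne_of (R := R₀) (by
      rw [ncard_star_lines (fun h0 => affinePoint_notMem_infinitePlane 0 (h0 ▸ hR₀))]; norm_num))
    (hne_of (R := R₀) (by rw [ncard_infinite_lines hE hV hR₀]; positivity))
    (hne_of (R := R₀) (by rw [(h.degree_infinite hE hV hR₀).1]; exact hpos))
    (hne_of (R := R₀) (by rw [(h.degree_infinite hE hV hR₀).2]; exact hpos))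
    (by
      intro ℓ
      by_cases h1 : PGIncident (affinePoint g 0) ℓ
      · exact Or.inl h1
      by_cases h2 : ℓ.1 ≤ infinitePlane g
      · exact Or.inr (Or.inl h2)
      · exact Or.inr (Or.inr (h.lineSum_eq ℓ h1 h2)))
    (by rw [Set.disjoint_left]; exact fun ℓ h1 h2 => origin_notMem h1 h2)
    (by
      rw [Set.disjoint_left]; intro ℓ h1 h2
      rw [Set.mem_ofPred_eq, lineSum_through_origin h.sum_smul h1] at h2
      exact hw0 h2.symm)
    (by
      rw [Set.disjoint_left]; intro ℓ h1 h2
      rw [Set.mem_ofPred_eq, lineSum_through_origin h.sum_smul h1] at h2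
      exact neg_ne_zero.2 hw0 h2.symm)
    (by
      rw [Set.disjoint_left]; intro ℓ h1 h2
      rw [Set.mem_ofPred_eq, lineSum_infinite r h1] at h2
      exact hw0 h2.symm)
    (by
      rw [Set.disjoint_left]; intro ℓ h1 h2
      rw [Set.mem_ofPred_eq, lineSum_infinite r h1] at h2
      exact neg_ne_zero.2 hw0 h2.symm)
    (by
      rw [Set.disjoint_left]; intro ℓ h1 h2
      rw [Set.mem_ofPred_eq] at h1 h2
      exact hwn (h1.symm.trans h2))
  -- the block side
  have hLw : ∀ {c : ℝ}, c ≠ 0 → ∀ ℓ ∈ {ℓ : PGLine F V | lineSum g r ℓ = c},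
      ¬ PGIncident (affinePoint g 0) ℓ ∧ ¬ ℓ.1 ≤ infinitePlane g := by
    intro c hc ℓ hℓ
    rw [Set.mem_ofPred_eq] at hℓ
    constructor <;> intro h1
    · rw [lineSum_through_origin h.sum_smul h1] at hℓ; exact hc hℓ.symm
    · rw [lineSum_infinite r h1] at hℓ; exact hc hℓ.symm
  have hbP : ∀ {ε : ℝ}, (ε = 1 ∨ ε = -1) →
      ∀ B ∈ ({pgStar (affinePoint g 0), pgLinesIn (infinitePlane g), {ℓ | lineSum g r ℓ = w},
        {ℓ | lineSum g r ℓ = -w}} : Set (Set (PGLine F V))),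
      ∃ n : ℕ, ∀ b ∈ B, {x ∈ pointsWithValue g r ε | PGIncident x b}.encard = n := by
    rintro ε hε B (rfl | rfl | rfl | rfl)
    · refine exists_encard_eq ((Fintype.card F - 1 + ε * 0) / 2) fun ℓ hℓ => ?_
      rw [h.ncard_pointsWithValue_eq hε (origin_notMem hℓ),
        lineSum_through_origin h.sum_smul hℓ,
          if_pos (show PGIncident (affinePoint g 0) ℓ from hℓ)]
    · refine exists_encard_eq 0 fun ℓ hℓ => ?_
      rw [ncard_pointsWithValue, lineSum_infinite _ hℓ]
    · refine exists_encard_eq ((Fintype.card F - 0 + ε * w) / 2) fun ℓ hℓ => ?_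
      have h1 := hLw hw0 ℓ hℓ
      rw [h.ncard_pointsWithValue_eq hε h1.2, if_neg h1.1, hℓ]
    · refine exists_encard_eq ((Fintype.card F - 0 + ε * -w) / 2) fun ℓ hℓ => ?_
      have h1 := hLw (neg_ne_zero.2 hw0) ℓ hℓ
      rw [h.ncard_pointsWithValue_eq hε h1.2, if_neg h1.1, hℓ]
  have hb : ∀ P ∈ ({{affinePoint g 0}, pgPointsIn (infinitePlane g), pointsWithValue g r (-δ),
      pointsWithValue g r δ} : Set (Set (PGPoint F V))),
      ∀ B ∈ ({pgStar (affinePoint g 0), pgLinesIn (infinitePlane g), {ℓ | lineSum g r ℓ = w},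
        {ℓ | lineSum g r ℓ = -w}} : Set (Set (PGLine F V))),
      ∃ n : ℕ, ∀ b ∈ B, {x ∈ P | PGIncident x b}.encard = n := by
    rintro P (rfl | rfl | rfl | rfl)
    · rintro B (rfl | rfl | rfl | rfl)
      · refine exists_encard_eq 1 fun ℓ hℓ => ?_
        rw [ncard_origin, if_pos (show PGIncident (affinePoint g 0) ℓ from hℓ)]
      · refine exists_encard_eq 0 fun ℓ hℓ => ?_
        rw [ncard_origin, if_neg fun h1 => origin_notMem h1 hℓ]
      · refine exists_encard_eq 0 fun ℓ hℓ => ?_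
        rw [ncard_origin, if_neg (hLw hw0 ℓ hℓ).1]
      · refine exists_encard_eq 0 fun ℓ hℓ => ?_
        rw [ncard_origin, if_neg (hLw (neg_ne_zero.2 hw0) ℓ hℓ).1]
    · rintro B (rfl | rfl | rfl | rfl)
      · refine exists_encard_eq (Fintype.card F + 1 - Fintype.card F) fun ℓ hℓ => ?_
        rw [ncard_infinite_points, lineSum_one (origin_notMem hℓ)]
      · refine exists_encard_eq (Fintype.card F + 1 - 0) fun ℓ hℓ => ?_
        rw [ncard_infinite_points, lineSum_infinite _ hℓ]
      · refine exists_encard_eq (Fintype.card F + 1 - Fintype.card F) fun ℓ hℓ => ?_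
        rw [ncard_infinite_points, lineSum_one (hLw hw0 ℓ hℓ).2]
      · refine exists_encard_eq (Fintype.card F + 1 - Fintype.card F) fun ℓ hℓ => ?_
        rw [ncard_infinite_points, lineSum_one (hLw (neg_ne_zero.2 hw0) ℓ hℓ).2]
    · exact hbP hδ'
    · exact hbP hδ
  -- the point side
  have hpP : ∀ {ε : ℝ}, (ε = 1 ∨ ε = -1) →
      ∀ B ∈ ({pgStar (affinePoint g 0), pgLinesIn (infinitePlane g), {ℓ | lineSum g r ℓ = w},
        {ℓ | lineSum g r ℓ = -w}} : Set (Set (PGLine F V))),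
      ∃ n : ℕ, ∀ x ∈ pointsWithValue g r ε, {b ∈ B | PGIncident x b}.encard = n := by
    rintro ε hε B (rfl | rfl | rfl | rfl)
    · refine exists_encard_eq 1 fun R hR => ?_
      obtain ⟨x, hx, -, rfl⟩ := hval hε hR
      exact ncard_star_lines fun h0 => hx (affinePoint_injective h0)
    · refine exists_encard_eq 0 fun R hR => ?_
      obtain ⟨x, hx, -, rfl⟩ := hval hε hR
      exact ncard_infinite_lines_affinePoint x
    · refine exists_encard_eq ((Fintype.card F + 1) * (Fintype.card F + w * ε) / 2) fun R hR => ?_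
      obtain ⟨x, hx, rfl, rfl⟩ := hval hε hR
      exact (h.degree_affinePoint hV hx).1
    · refine exists_encard_eq ((Fintype.card F + 1) * (Fintype.card F - w * ε) / 2) fun R hR => ?_
      obtain ⟨x, hx, rfl, rfl⟩ := hval hε hR
      exact (h.degree_affinePoint hV hx).2
  have hp : ∀ P ∈ ({{affinePoint g 0}, pgPointsIn (infinitePlane g), pointsWithValue g r (-δ),
      pointsWithValue g r δ} : Set (Set (PGPoint F V))),
      ∀ B ∈ ({pgStar (affinePoint g 0), pgLinesIn (infinitePlane g), {ℓ | lineSum g r ℓ = w},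
        {ℓ | lineSum g r ℓ = -w}} : Set (Set (PGLine F V))),
      ∃ n : ℕ, ∀ x ∈ P, {b ∈ B | PGIncident x b}.encard = n := by
    rintro P (rfl | rfl | rfl | rfl)
    · intro B _
      refine exists_encard_eq ({b ∈ B | PGIncident (affinePoint g 0) b}.ncard : ℝ) fun R hR => ?_
      rw [Set.mem_singleton_iff.1 hR]
    · rintro B (rfl | rfl | rfl | rfl)
      · exact exists_encard_eq 1 fun R hR =>
          ncard_star_lines fun h0 => affinePoint_notMem_infinitePlane 0 (h0 ▸ hR)
      · exact exists_encard_eq _ fun R hR => ncard_infinite_lines hE hV hR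
      · exact exists_encard_eq _ fun R hR => (h.degree_infinite hE hV hR).1
      · exact exists_encard_eq _ fun R hR => (h.degree_infinite hE hV hR).2
    · exact hpP hδ'
    · exact hpP hδ
  refine ⟨?_, affinePoint_notMem_infinitePlane 0, ?_, hLc, ?_⟩
  · rw [infinitePlane, LinearEquiv.finrank_map_eq, LinearMap.finrank_range_of_inj
      LinearMap.inr_injective, hE]
  · rw [hc1, hc2]; exact hPc
  · rw [hc1, hc2]
    refine ⟨⟨hPP, hLP, hb, hp⟩, ?_⟩
    rw [← (Set.toFinite _).cast_ncard_eq, ← (Set.toFinite _).cast_ncard_eq, hPc, hLc]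

end IsTwoLineSum

/-! ### The sign function and its line sums -/

namespace IsCubicFrobenius

variable {F E : Type*} [Field F] [Field E] [Algebra F E] [Fintype F] [CharP F 3] [CharP E 3]
  [Finite E] {σ : E →ₐ[F] E}

/-- The norm-one elements have order dividing the odd number q² + q + 1 = 2k + 1, so n^(k+1) is a
square root of n. -/
lemma exists_sq_of_norm_eq_one (h3 : Module.finrank F E = 3) {n : E} (hn : Algebra.norm F n = 1) :
    ∃ a, Algebra.norm F a = 1 ∧ a ^ 2 = n := by
  have h1 := FiniteField.algebraMap_norm_eq_pow_sum F E (x := n)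
  rw [hn, map_one, h3] at h1
  simp only [Finset.sum_range_succ, Finset.sum_range_zero, pow_zero, zero_add, pow_one] at h1
  obtain ⟨k, hk⟩ : ∃ k, 1 + Nat.card F + Nat.card F ^ 2 = 2 * k + 1 := by
    obtain ⟨k, hk⟩ := Nat.even_mul_succ_self (Nat.card F)
    exact ⟨k, by linarith [hk]⟩
  refine ⟨n ^ (k + 1), by rw [map_pow, hn, one_pow], ?_⟩
  rw [← pow_mul, show (k + 1) * 2 = (2 * k + 1) + 1 by ring, pow_succ, ← hk, ← h1, one_mul]

/-- Scalars have norm l³, and every element of F is a cube. -/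
lemma exists_smul_norm_one (h : IsCubicFrobenius σ) {u : E} (hu : u ≠ 0) :
    ∃ (l : F) (n : E), l ≠ 0 ∧ Algebra.norm F n = 1 ∧ u = algebraMap F E l * n := by
  obtain ⟨l, hl⟩ := IsQuarticPair.exists_cubeRoot (Algebra.norm F u)
  have hl0 : l ≠ 0 := by
    rintro rfl
    exact Algebra.norm_ne_zero_iff.2 hu (by rw [← hl]; ring)
  refine ⟨l, algebraMap F E l⁻¹ * u, hl0, ?_, ?_⟩
  · rw [h.norm_algebraMap_mul, ← hl, ← mul_pow, inv_mul_cancel₀ hl0, one_pow]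
  · rw [← mul_assoc, ← map_mul, mul_inv_cancel₀ hl0, map_one, one_mul]

variable {ψ : MulChar F ℂ} {ζ : AddChar F ℂ}

/-- The character sum over an affine line, in terms of the Plücker coordinates of the line. -/
lemma exists_sum_line (h : IsCubicFrobenius σ) (h3 : Module.finrank F E = 3)
    (hψ : IsQuarticPair ψ ζ) {θ : E} (hθ : σ θ = θ + 1)
    {τ : F} (hτ : θ ^ 3 = θ + algebraMap F E τ) (hτs : ∀ s : F, s ^ 3 - s ≠ τ) {x y : E}
    (hy : y ≠ 0) (hxy : σ x * σ (σ y) - σ (σ x) * σ y ≠ 0) :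
    ∃ (l c : F) (n a : E), l ≠ 0 ∧ c ≠ 0 ∧ Algebra.norm F n = 1 ∧ a ∈ (setS F : Set E) ∧
      y = algebraMap F E l * n ∧
      σ x * σ (σ y) - σ (σ x) * σ y = algebraMap F E l * (algebraMap F E c * (a ^ 2 * n⁻¹)) ∧
      ∑ s : F, ψ (Algebra.norm F (x + s • y)) =
        (∑ s : F, ψ (s ^ 3 - s + τ)) * (conicSign ψ a * conj (ψ c)) := by
  have hinj := σ.injective
  have hσy : σ y ≠ 0 := (map_ne_zero_iff _ hinj).2 hy
  have hσσy : σ (σ y) ≠ 0 := (map_ne_zero_iff _ hinj).2 hσy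
  have hv : σ x * σ (σ y) - σ (σ x) * σ y =
      σ y * σ (σ y) * (σ (x / y) - σ (σ (x / y))) := by
    simp only [map_div₀]; field_simp
  have hb : σ (x / y) - σ (σ (x / y)) ≠ 0 := fun h0 => hxy (by rw [hv, h0, mul_zero])
  obtain ⟨l, n, hl, hn, hyl⟩ := h.exists_smul_norm_one hy
  obtain ⟨c, m, hc, hm, hbc⟩ := h.exists_smul_norm_one hb
  obtain ⟨a, ha, rfl⟩ := exists_sq_of_norm_eq_one h3 hm
  have hn0 : n ≠ 0 := by rintro rfl; exact hy (by rw [hyl, mul_zero])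
  have hl' : algebraMap F E l ≠ 0 := (map_ne_zero _).2 hl
  have hN := h.norm n
  rw [hn, map_one] at hN
  have haS : a ∈ (setS F : Set E) := by
    refine ⟨ha, ?_⟩
    -- The trace of σz − σ²z telescopes to zero, which puts a into S.
    have h1 : Algebra.trace F E (σ (x / y) - σ (σ (x / y))) = 0 := by
      apply h.trace_eq
      simp only [map_sub, h.iterate, map_zero]
      ring
    rw [hbc, trace_algebraMap_mul] at h1
    exact (mul_eq_zero.1 h1).resolve_left hc
  -- The second coordinate carries l² from σy · σ²y. One factor l is the common projective scalar,
  -- the other is absorbed into c and matches ψ(l)³ = conj ψ(l) in the sum.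
  refine ⟨l, l * c, n, a, hl, mul_ne_zero hl hc, hn, haS, hyl, ?_, ?_⟩
  · rw [hv, hbc, hyl]
    simp only [map_mul, σ.commutes]
    field_simp
    linear_combination -algebraMap F E c * a ^ 2 * hN
  · have h1 : ∀ s : F, ψ (Algebra.norm F (x + s • y)) =
        ψ l ^ 3 * ψ (Algebra.norm F (x / y + algebraMap F E s)) := fun s => by
      have e : x + s • y = algebraMap F E l * (n * (x / y + algebraMap F E s)) := by
        rw [Algebra.smul_def, ← mul_assoc, ← hyl]
        field_simp
      rw [e, h.norm_algebraMap_mul, map_mul (Algebra.norm F), hn, one_mul, map_mul, map_pow]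
    rw [Finset.sum_congr rfl fun s _ => h1 s, ← Finset.mul_sum,
      h.sum_line_one hψ hθ hτ hτs hc haS hbc, map_mul, map_mul, hψ.conj_mulChar l]
    ring

/-- The sign function of the quartic character. -/
noncomputable def quarticSign (ψ : MulChar F ℂ) (x : E) : ℝ :=
  (ψ (Algebra.norm F x)).re - (ψ (Algebra.norm F x)).im

lemma quarticSign_zero (h : IsCubicFrobenius σ) : quarticSign ψ (0 : E) = 0 := by
  have h0 : Algebra.norm F (0 : E) = 0 := h.norm_eq (by simp)
  rw [quarticSign, h0, IsQuarticPair.mulChar_zero]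
  simp

lemma quarticSign_eq (hψ : IsQuarticPair ψ ζ) {x : E} (hx : x ≠ 0) :
    quarticSign ψ x = 1 ∨ quarticSign ψ x = -1 := by
  rw [quarticSign]
  rcases hψ.mulChar_cases (Algebra.norm_ne_zero_iff.2 hx) with h | h | h | h <;> rw [h] <;> simp

/-- N(sx) = s³N(x), and cubing permutes F, so the sum is a multiple of the full sum of ψ. -/
lemma sum_quarticSign_smul (h : IsCubicFrobenius σ) (hψ : IsQuarticPair ψ ζ) (x : E) :
    ∑ s : F, quarticSign ψ (s • x) = 0 := by
  have h1 : ∑ s : F, ψ (Algebra.norm F (s • x)) = 0 := by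
    simp only [Algebra.smul_def, h.norm_algebraMap_mul, map_mul]
    rw [← Finset.sum_mul, IsQuarticPair.sum_cube (fun s => ψ s),
      MulChar.sum_eq_zero_of_ne_one hψ.ne_one, zero_mul]
  simp only [quarticSign, Finset.sum_sub_distrib, ← Complex.re_sum, ← Complex.im_sum, h1]
  simp

/-- Re − Im of a conjugate is Re + Im: positive for z = 1, i and negative for z = −1, −i, just as 𝒯₁
groups the exponents 0, 1 against 2, 3. -/
lemma sum_quarticSign (x y : E) {w : ℝ} {ε z : ℂ} (hε : ε = 1 ∨ ε = -1)
    (hs : ∑ s : F, ψ (Algebra.norm F (x + s • y)) = w * (ε * conj z)) :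
    ∑ s : F, quarticSign ψ (x + s • y) = w * ε.re * (z.re + z.im) := by
  simp only [quarticSign, Finset.sum_sub_distrib, ← Complex.re_sum, ← Complex.im_sum, hs]
  rcases hε with rfl | rfl <;> simp <;> ring

end IsCubicFrobenius

/-! ### The orbits on the Klein quadric -/

section Orbits

variable {F E : Type*} [Field F] [Field E] [Algebra F E]

/-- The map `(u, v) ↦ (n u, n⁻¹ k v)`. -/
def quadricAction : Eˣ × Fˣ →* ((E × E) ≃ₗ[F] (E × E)) where
  toFun p := LinearEquiv.prodCongr (DistribMulAction.toLinearEquiv F E p.1)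
    ((DistribMulAction.toLinearEquiv F E p.2).trans (DistribMulAction.toLinearEquiv F E p.1⁻¹))
  map_one' := by ext x <;> simp
  map_mul' p p' := by
    ext x <;> simp [Units.smul_def, Algebra.smul_def] <;> ring

variable [Finite E]

lemma mem_zpowers_omegaUnit {α : Eˣ} (hα : ∀ x : Eˣ, x ∈ Subgroup.zpowers α) (x : Fˣ) :
    x ∈ Subgroup.zpowers (omegaUnit F α) := by
  obtain ⟨y, rfl⟩ := FiniteField.unitsMap_norm_surjective F E x
  obtain ⟨k, rfl⟩ := Subgroup.mem_zpowers_iff.1 (hα y)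
  exact Subgroup.mem_zpowers_iff.2 ⟨k, (map_zpow _ _ _).symm⟩

/-- αᵏ has norm ωᵏ, which is trivial exactly when q − 1 divides k. -/
lemma zpowers_muUnit {α : Eˣ} (hα : ∀ x : Eˣ, x ∈ Subgroup.zpowers α) :
    Subgroup.zpowers (muUnit F α) = (Units.map (Algebra.norm F (S := E))).ker := by
  have := Finite.of_injective _ (algebraMap F E).injective
  have hord : orderOf (omegaUnit F α) = Nat.card F - 1 := by
    rw [orderOf_eq_card_of_forall_mem_zpowers (mem_zpowers_omegaUnit hα), Nat.card_units]
  apply le_antisymm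
  · rw [Subgroup.zpowers_le, MonoidHom.mem_ker, muUnit, map_pow]
    exact orderOf_dvd_iff_pow_eq_one.1 hord.dvd
  · intro n hn
    obtain ⟨k, rfl⟩ := Subgroup.mem_zpowers_iff.1 (hα n)
    rw [MonoidHom.mem_ker, map_zpow] at hn
    obtain ⟨j, rfl⟩ := orderOf_dvd_iff_zpow_eq_one.2 hn
    refine Subgroup.mem_zpowers_iff.2 ⟨j, ?_⟩
    rw [muUnit, ← hord, zpow_mul, zpow_natCast]
    rfl

lemma groupG_eq {α : Eˣ} (hα : ∀ x : Eˣ, x ∈ Subgroup.zpowers α) :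
    groupG F α = Subgroup.map quadricAction
      ((Units.map (Algebra.norm F (S := E))).ker.prod (Subgroup.zpowers (omegaUnit F α ^ 4))) := by
  have h1 : mapC F α = quadricAction (muUnit F α, 1) := by
    ext x <;> simp [mapC, quadricAction]
  have h2 : mapZ F α = quadricAction (1, omegaUnit F α ^ 4) := by
    ext x <;> simp [mapZ, quadricAction]
  rw [← zpowers_muUnit hα, groupG, h1, h2]
  apply le_antisymm
  · rw [Subgroup.closure_le]
    rintro _ (rfl | rfl)
    · exact ⟨_, ⟨Subgroup.mem_zpowers _, one_mem _⟩, rfl⟩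
    · exact ⟨_, ⟨one_mem _, Subgroup.mem_zpowers _⟩, rfl⟩
  · rintro _ ⟨⟨n, k⟩, ⟨hn, hk⟩, rfl⟩
    obtain ⟨i, rfl⟩ := Subgroup.mem_zpowers_iff.1 hn
    obtain ⟨j, rfl⟩ := Subgroup.mem_zpowers_iff.1 hk
    have : ((muUnit F α ^ i, (omegaUnit F α ^ 4) ^ j) : Eˣ × Fˣ) =
        (muUnit F α, 1) ^ i * (1, omegaUnit F α ^ 4) ^ j := by
      ext <;> simp
    rw [this, map_mul, map_zpow, map_zpow]
    exact mul_mem (zpow_mem (Subgroup.subset_closure (by simp)) i)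
      (zpow_mem (Subgroup.subset_closure (by simp)) j)

/-- Since ψ(ω) = i has order 4, the fourth powers form the kernel of ψ. -/
lemma mem_zpowers_pow_four [Finite F] {ψ : MulChar F ℂ} {ω : Fˣ}
    (hω : ∀ x : Fˣ, x ∈ Subgroup.zpowers ω) (hψω : ψ (ω : F) = Complex.I) (k : Fˣ) :
    k ∈ Subgroup.zpowers (ω ^ 4) ↔ ψ (k : F) = 1 := by
  have hI : Complex.I ^ 4 = 1 := Complex.I_pow_four
  constructor
  · intro hk
    obtain ⟨j, rfl⟩ := (mem_powers_iff_mem_zpowers.2 hk)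
    simp only [Units.val_pow_eq_pow_val, map_pow, hψω, hI, one_pow]
  · intro hk
    obtain ⟨j, rfl⟩ := (mem_powers_iff_mem_zpowers.2 (hω k))
    simp only [Units.val_pow_eq_pow_val, map_pow, hψω] at hk
    have hj : j % 4 = 0 := by
      rw [Complex.I_pow_eq_pow_mod] at hk
      have h4 : j % 4 < 4 := Nat.mod_lt _ (by norm_num)
      interval_cases hm : j % 4
      · rfl
      all_goals
        exfalso
        have := congrArg Complex.re hk
        norm_num [pow_succ] at this
    obtain ⟨i, rfl⟩ := Nat.dvd_of_mod_eq_zero hj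
    exact Subgroup.mem_zpowers_iff.2 ⟨i, by rw [zpow_natCast, ← pow_mul]⟩

lemma mem_orbit_iff {α : Eˣ} (hα : ∀ x : Eˣ, x ∈ Subgroup.zpowers α) {s : ℕ} {a : E} {u v : E}
    (huv : (u, v) ≠ 0) :
    Projectivization.mk F (u, v) huv ∈ MulAction.orbit (groupG F α) (orbitRep F α s a) ↔
      ∃ (n : E) (k : Fˣ) (t : F), t ≠ 0 ∧ Algebra.norm F n = 1 ∧
        k ∈ Subgroup.zpowers (omegaUnit F α ^ 4) ∧ t • u = n ∧
        t • v = n⁻¹ * ((k * (omegaUnit F α : F) ^ s) • a ^ 2) := by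
  constructor
  · rintro ⟨⟨φ, hφ⟩, h⟩
    rw [groupG_eq hα] at hφ
    obtain ⟨⟨n, k⟩, ⟨hn, hk⟩, rfl⟩ := hφ
    replace h : Projectivization.mk F _ _ = Projectivization.mk F _ _ := h
    obtain ⟨t, ht⟩ := (Projectivization.mk_eq_mk_iff F _ _ _ _).1 h
    have h1 : (t : F) • u = (n : E) * 1 := congrArg Prod.fst ht
    have h2 : (t : F) • v = ((n⁻¹ : Eˣ) : E) * ((k : F) • (omegaUnit F α : F) ^ s • a ^ 2) :=
      congrArg Prod.snd ht
    refine ⟨n, k, t, t.ne_zero, congrArg Units.val (MonoidHom.mem_ker.1 hn), hk, ?_, ?_⟩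
    · rw [h1, mul_one]
    · rw [h2, Units.val_inv_eq_inv_val, mul_smul]
  · rintro ⟨n, k, t, ht, hn, hk, h1, h2⟩
    have hn0 : n ≠ 0 := by
      rintro rfl
      exact zero_ne_one (Algebra.norm_zero.symm.trans hn)
    have hker : Units.mk0 n hn0 ∈ (Units.map (Algebra.norm F (S := E))).ker := by
      rw [MonoidHom.mem_ker]; ext; exact hn
    have hG : quadricAction (Units.mk0 n hn0, k) ∈ groupG F α := by
      rw [groupG_eq hα]
      exact ⟨_, ⟨hker, hk⟩, rfl⟩
    refine ⟨⟨_, hG⟩, ?_⟩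
    change Projectivization.mk F _ _ = Projectivization.mk F _ _
    rw [Projectivization.mk_eq_mk_iff']
    refine ⟨t, Prod.ext ?_ ?_⟩
    · change t • u = n * 1
      rw [h1, mul_one]
    · change t • v = ((Units.mk0 n hn0)⁻¹ : Eˣ) * ((k : F) • (omegaUnit F α : F) ^ s • a ^ 2)
      rw [h2, Units.val_inv_eq_inv_val, mul_smul, Units.val_mk0]

end Orbits

/-! ### Orbit membership in terms of the invariants (a, ψ(c)) -/

namespace IsCubicFrobenius

variable {F E : Type*} [Field F] [Field E] [Algebra F E] [Fintype F] [CharP F 3] [CharP E 3]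
  [Finite E] {σ : E →ₐ[F] E} {ψ : MulChar F ℂ} {ζ : AddChar F ℂ} {α : Eˣ}

/-- The other square root −b is excluded because −1 has norm −1. -/
lemma eq_of_sq_eq (h : IsCubicFrobenius σ) {a b : E} (ha : a ∈ (setS F : Set E))
    (hb : b ∈ (setS F : Set E)) (hab : a ^ 2 = b ^ 2) : a = b := by
  refine (sq_eq_sq_iff_eq_or_eq_neg.1 hab).resolve_right fun h1 => ?_
  have h2 := h.norm_algebraMap_mul (-1) b
  rw [map_neg, map_one, neg_one_mul, ← h1, ha.1, hb.1] at h2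
  have h3 : (3 : F) = 0 := IsQuarticPair.three_eq_zero
  exact one_ne_zero (α := F) (by linear_combination h3 - h2)

/-- Norms determine scalars because cubing is injective on F. The first coordinate forces tl = 1,
the second c = kω^s with ψ(k) = 1, and then a² = b² gives a = b. -/
lemma mem_orbit_orbitRep (h : IsCubicFrobenius σ)
    (hα : ∀ x : Eˣ, x ∈ Subgroup.zpowers α) (hω : ψ (omegaUnit F α : F) = Complex.I)
    {l c : F} {n a b : E} (hl : l ≠ 0) (hc : c ≠ 0) (hn : Algebra.norm F n = 1)
    (ha : a ∈ (setS F : Set E)) (hb : b ∈ (setS F : Set E)) {s : ℕ} {u v : E} (huv : (u, v) ≠ 0)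
    (hu : u = algebraMap F E l * n)
    (hv : v = algebraMap F E l * (algebraMap F E c * (a ^ 2 * n⁻¹))) :
    Projectivization.mk F (u, v) huv ∈ MulAction.orbit (groupG F α) (orbitRep F α s b) ↔
      b = a ∧ ψ c = Complex.I ^ s := by
  have hn0 : n ≠ 0 := by
    rintro rfl
    exact zero_ne_one (Algebra.norm_zero.symm.trans hn)
  rw [mem_orbit_iff hα]
  constructor
  · rintro ⟨n', k, t, ht, hn', hk, h1, h2⟩
    rw [hu, Algebra.smul_def, ← mul_assoc, ← map_mul] at h1
    have htl : t * l = 1 := by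
      apply IsQuarticPair.cube_injective
      have := congrArg (Algebra.norm F) h1
      rw [h.norm_algebraMap_mul, hn, hn', mul_one] at this
      rw [this, one_pow]
    rw [htl, map_one, one_mul] at h1
    subst h1
    rw [hv, Algebra.smul_def, ← mul_assoc, ← map_mul, htl, map_one, one_mul, Algebra.smul_def] at h2
    have h3 : algebraMap F E c * a ^ 2 =
        algebraMap F E (k * (omegaUnit F α : F) ^ s) * b ^ 2 := by
      field_simp at h2
      exact h2
    have h4 : c = k * (omegaUnit F α : F) ^ s := by
      apply IsQuarticPair.cube_injective
      have := congrArg (Algebra.norm F) h3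
      rwa [h.norm_algebraMap_mul, h.norm_algebraMap_mul, map_pow, map_pow, ha.1, hb.1, one_pow,
        mul_one, mul_one] at this
    rw [← h4] at h3
    refine ⟨h.eq_of_sq_eq hb ha (mul_left_cancel₀ ((map_ne_zero _).2 hc) h3.symm), ?_⟩
    rw [h4, map_mul, map_pow, hω, (mem_zpowers_pow_four (mem_zpowers_omegaUnit hα) hω k).1 hk,
      one_mul]
  · rintro ⟨rfl, hcs⟩
    set k : Fˣ := Units.mk0 c hc * (omegaUnit F α ^ s)⁻¹ with hkd
    have hk : (k : F) * (omegaUnit F α : F) ^ s = c := by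
      rw [hkd, ← Units.val_pow_eq_pow_val, ← Units.val_mul, inv_mul_cancel_right, Units.val_mk0]
    refine ⟨n, k, l⁻¹, inv_ne_zero hl, hn, ?_, ?_, ?_⟩
    · rw [mem_zpowers_pow_four (mem_zpowers_omegaUnit hα) hω]
      have h1 := congrArg ψ hk
      rw [map_mul, map_pow, hω, hcs] at h1
      exact mul_right_cancel₀ (pow_ne_zero s Complex.I_ne_zero) (by rw [h1, one_mul])
    · rw [hu, Algebra.smul_def, ← mul_assoc, ← map_mul, inv_mul_cancel₀ hl, map_one, one_mul]
    · rw [hv, hk, Algebra.smul_def, Algebra.smul_def, ← mul_assoc, ← map_mul, inv_mul_cancel₀ hl,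
        map_one, one_mul]
      ring

lemma mem_orbitUnion (h : IsCubicFrobenius σ)
    (hα : ∀ x : Eˣ, x ∈ Subgroup.zpowers α) (hω : ψ (omegaUnit F α : F) = Complex.I)
    {l c : F} {n a : E} (hl : l ≠ 0) (hc : c ≠ 0) (hn : Algebra.norm F n = 1)
    (ha : a ∈ (setS F : Set E)) {X Y : Set E} (hX : X ⊆ setS F) (hY : Y ⊆ setS F)
    {u v : E} (huv : (u, v) ≠ 0) (hu : u = algebraMap F E l * n)
    (hv : v = algebraMap F E l * (algebraMap F E c * (a ^ 2 * n⁻¹))) :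
    Projectivization.mk F (u, v) huv ∈ orbitUnion F α X Y ↔
      a ∈ X ∧ (ψ c = 1 ∨ ψ c = Complex.I) ∨ a ∈ Y ∧ (ψ c = -1 ∨ ψ c = -Complex.I) := by
  have key : ∀ b ∈ (setS F : Set E), ∀ s, Projectivization.mk F (u, v) huv ∈
      MulAction.orbit (groupG F α) (orbitRep F α s b) ↔ b = a ∧ ψ c = Complex.I ^ s :=
    fun b hb s => h.mem_orbit_orbitRep hα hω hl hc hn ha hb huv hu hv
  have hI3 : Complex.I ^ 3 = -Complex.I := Complex.I_pow_three
  simp only [orbitUnion, Set.mem_union, Set.mem_iUnion]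
  refine or_congr ?_ ?_
  · constructor
    · rintro ⟨b, hb, h1 | h1⟩ <;> obtain ⟨rfl, h2⟩ := (key b (hX hb) _).1 h1
      · exact ⟨hb, Or.inl (by simpa using h2)⟩
      · exact ⟨hb, Or.inr (by simpa using h2)⟩
    · rintro ⟨h1, h2 | h2⟩
      · exact ⟨a, h1, Or.inl ((key a ha _).2 ⟨rfl, by simpa using h2⟩)⟩
      · exact ⟨a, h1, Or.inr ((key a ha _).2 ⟨rfl, by simpa using h2⟩)⟩
  · constructor
    · rintro ⟨b, hb, h1 | h1⟩ <;> obtain ⟨rfl, h2⟩ := (key b (hY hb) _).1 h1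
      · exact ⟨hb, Or.inl (by simpa using h2)⟩
      · exact ⟨hb, Or.inr (by rw [h2, hI3])⟩
    · rintro ⟨h1, h2 | h2⟩
      · exact ⟨a, h1, Or.inl ((key a ha _).2 ⟨rfl, by simpa using h2⟩)⟩
      · exact ⟨a, h1, Or.inr ((key a ha _).2 ⟨rfl, by rw [h2, hI3]⟩)⟩

/-- This keeps the tight sets off the two generators of the quadric, that is, the lines off the star
of `p` and off `π`. -/
lemma ne_zero_of_mem_orbitUnion (hα : ∀ x : Eˣ, x ∈ Subgroup.zpowers α)
    {X Y : Set E} (hX : X ⊆ setS F) (hY : Y ⊆ setS F) {u v : E} (huv : (u, v) ≠ 0)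
    (hmem : Projectivization.mk F (u, v) huv ∈ orbitUnion F α X Y) : u ≠ 0 ∧ v ≠ 0 := by
  have key : ∀ b ∈ (setS F : Set E), ∀ s, Projectivization.mk F (u, v) huv ∈
      MulAction.orbit (groupG F α) (orbitRep F α s b) → u ≠ 0 ∧ v ≠ 0 := by
    intro b hb s h1
    obtain ⟨n, k, t, ht, hn, -, h1, h2⟩ := (mem_orbit_iff hα _).1 h1
    have hn0 : n ≠ 0 := by
      rintro rfl
      exact zero_ne_one (Algebra.norm_zero.symm.trans hn)
    have hb0 : b ≠ 0 := by
      rintro rfl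
      exact zero_ne_one (Algebra.norm_zero.symm.trans hb.1)
    constructor
    · rintro rfl
      exact hn0 (by rw [← h1, smul_zero])
    · rintro rfl
      rw [smul_zero] at h2
      refine mul_ne_zero (inv_ne_zero hn0) ?_ h2.symm
      exact smul_ne_zero (mul_ne_zero k.ne_zero (pow_ne_zero s (Units.ne_zero _)))
        (pow_ne_zero 2 hb0)
  simp only [orbitUnion, Set.mem_union, Set.mem_iUnion] at hmem
  rcases hmem with ⟨b, hb, h1 | h1⟩ | ⟨b, hb, h1 | h1⟩
  · exact key b (hX hb) _ h1
  · exact key b (hX hb) _ h1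
  · exact key b (hY hb) _ h1
  · exact key b (hY hb) _ h1

end IsCubicFrobenius

/-! ### The Klein correspondence -/

section Klein

variable {F E : Type*} [Field F] [Field E] [Algebra F E]

lemma pluckerVector_eq (x y : E) [Fintype F] :
    pluckerVector F ((1, x) : F × E) (0, y) =
      (y, FiniteField.frobeniusAlgHom F E x *
          FiniteField.frobeniusAlgHom F E (FiniteField.frobeniusAlgHom F E y) -
        FiniteField.frobeniusAlgHom F E (FiniteField.frobeniusAlgHom F E x) *
          FiniteField.frobeniusAlgHom F E y) := by
  simp only [pluckerVector, FiniteField.coe_frobeniusAlgHom, Fintype.card_eq_nat_card, one_smul,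
    zero_smul, sub_zero, ← pow_mul, sq (Nat.card F)]

/-- The Frobenius map fixes F, so both coordinates are F-bilinear and alternating. Hence membership
of a line can be tested on any spanning pair. -/
lemma pluckerVector_combination [Fintype F] (v w : F × E) (a b c d : F) :
    pluckerVector F (a • v + b • w) (c • v + d • w) = (a * d - b * c) • pluckerVector F v w := by
  have hσ : ∀ x : E, x ^ Nat.card F = FiniteField.frobeniusAlgHom F E x := fun x => by
    simp only [FiniteField.coe_frobeniusAlgHom, Fintype.card_eq_nat_card]
  have hσσ : ∀ x : E, x ^ (Nat.card F ^ 2) =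
      FiniteField.frobeniusAlgHom F E (FiniteField.frobeniusAlgHom F E x) := fun x => by
    rw [sq, pow_mul, hσ, hσ]
  obtain ⟨a₁, x⟩ := v
  obtain ⟨b₁, y⟩ := w
  simp only [pluckerVector, hσ, hσσ, Prod.smul_mk, Prod.mk_add_mk, Prod.mk.injEq]
  constructor <;>
  · simp only [Algebra.smul_def, map_add, map_mul, map_sub, AlgHom.commutes,
      Algebra.algebraMap_self, RingHom.id_apply]
    ring

lemma mem_kleinPreimage_iff [Fintype F] {ℓ : PGLine F (F × E)} {v w : F × E}
    (hℓ : ℓ.1 = Submodule.span F {v, w}) {T : Set (PGPoint F (E × E))} :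
    ℓ ∈ kleinPreimage F T ↔ ∃ h : pluckerVector F v w ≠ 0,
      Projectivization.mk F (pluckerVector F v w) h ∈ T := by
  constructor
  · rintro ⟨v', w', hℓ', h', hT⟩
    have hv : v' ∈ Submodule.span F {v, w} := by
      rw [← hℓ, hℓ']; exact Submodule.subset_span (by simp)
    have hw : w' ∈ Submodule.span F {v, w} := by
      rw [← hℓ, hℓ']; exact Submodule.subset_span (by simp)
    obtain ⟨a, b, rfl⟩ := Submodule.mem_span_pair.1 hv
    obtain ⟨c, d, rfl⟩ := Submodule.mem_span_pair.1 hw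
    have e := pluckerVector_combination v w a b c d
    have hne : pluckerVector F v w ≠ 0 := fun h0 => h' (by rw [e, h0, smul_zero])
    refine ⟨hne, ?_⟩
    convert hT using 1
    symm
    rw [Projectivization.mk_eq_mk_iff']
    exact ⟨a * d - b * c, e.symm⟩
  · rintro ⟨h, hT⟩
    exact ⟨v, w, hℓ, h, hT⟩

end Klein

/-! ### Line sums and the Klein preimages of the tight sets -/

namespace IsCubicFrobenius

variable {F E : Type*} [Field F] [Field E] [Algebra F E] [Fintype F] [CharP F 3] [CharP E 3]
  {σ : E →ₐ[F] E} {ψ : MulChar F ℂ} {ζ : AddChar F ℂ}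

/-- The condition says that x/y is fixed by σ; geometrically, the line passes through the origin. -/
lemma exists_smul_of_cross_eq_zero (h : IsCubicFrobenius σ) {x y : E} (hy : y ≠ 0)
    (hxy : σ x * σ (σ y) - σ (σ x) * σ y = 0) : ∃ t : F, x = t • y := by
  have hσy : σ y ≠ 0 := (map_ne_zero_iff _ σ.injective).2 hy
  have hσσy : σ (σ y) ≠ 0 := (map_ne_zero_iff _ σ.injective).2 hσy
  obtain ⟨t, ht⟩ := h.fixed (x / y) (σ.injective (by
    change σ (σ (x / y)) = σ (x / y)
    simp only [map_div₀]
    rw [div_eq_div_iff hσσy hσy]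
    linear_combination -hxy))
  exact ⟨t, by rw [Algebra.smul_def, ← ht, div_mul_cancel₀ _ hy]⟩

lemma incident_origin {V : Type*} [AddCommGroup V] [Module F V] {g : (F × E) ≃ₗ[F] V}
    (h : IsCubicFrobenius σ) {x y : E} (hy : y ≠ 0) {ℓ : PGLine F V}
    (hℓ : ℓ.1 = Submodule.span F {g (1, x), g (0, y)})
    (hxy : σ x * σ (σ y) - σ (σ x) * σ y = 0) : PGIncident (affinePoint g 0) ℓ := by
  obtain ⟨t, rfl⟩ := h.exists_smul_of_cross_eq_zero hy hxy
  rw [incident_affinePoint, hℓ, mem_span_affine]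
  exact ⟨-t, by rw [neg_smul, add_neg_cancel]⟩

variable [Fintype E]

/-- The two line sums of the sign function of a quartic character. -/
lemma isTwoLineSum {V : Type*} [AddCommGroup V] [Module F V] (g : (F × E) ≃ₗ[F] V)
    (h : IsCubicFrobenius σ) (h3 : Module.finrank F E = 3) (hψ : IsQuarticPair ψ ζ) {θ : E}
    (hθ : σ θ = θ + 1) {τ : F} (hτ : θ ^ 3 = θ + algebraMap F E τ) (hτs : ∀ s : F, s ^ 3 - s ≠ τ)
    {w : ℝ} (hw : ∑ s, ψ (s ^ 3 - s + τ) = w) (hw2 : w ^ 2 = Fintype.card F) {δ : ℝ}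
    (hδ : δ = 1 ∨ δ = -1) : IsTwoLineSum g (quarticSign ψ : E → ℝ) (w * δ) where
  zero := h.quarticSign_zero
  sign x hx := quarticSign_eq hψ hx
  sum_smul x _ := h.sum_quarticSign_smul hψ x
  sq_eq := by rcases hδ with rfl | rfl <;> rw [← hw2] <;> ring
  lineSum_eq ℓ h1 h2 := by
    obtain ⟨x, y, hy, hℓ⟩ := exists_param ℓ h2
    have hxy : σ x * σ (σ y) - σ (σ x) * σ y ≠ 0 := fun h0 => h1 (h.incident_origin hy hℓ h0)
    obtain ⟨l, c, n, a, hl, hc, hn, ha, -, -, hsum⟩ := h.exists_sum_line h3 hψ hθ hτ hτs hy hxy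
    rw [hw] at hsum
    rw [lineSum_param _ hy hℓ, sum_quarticSign x y (conicSign_eq hψ a) hsum]
    rcases conicSign_eq hψ a with h4 | h4 <;> rcases hψ.mulChar_cases hc with h5 | h5 | h5 | h5 <;>
      rcases hδ with rfl | rfl <;> rw [h4, h5] <;> simp

/-- The lines whose Klein image lies in one of the two tight sets are given by their line sums. -/
lemma kleinPreimage_eq (h3 : Module.finrank F E = 3) (hψ : IsQuarticPair ψ ζ) {α : Eˣ}
    (hα : ∀ x : Eˣ, x ∈ Subgroup.zpowers α) (hω : ψ (omegaUnit F α : F) = Complex.I) {θ : E}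
    (hθ : FiniteField.frobeniusAlgHom F E θ = θ + 1) {τ : F} (hτ : θ ^ 3 = θ + algebraMap F E τ)
    (hτs : ∀ s : F, s ^ 3 - s ≠ τ) {w : ℝ} (hw : ∑ s, ψ (s ^ 3 - s + τ) = w) (hw0 : w ≠ 0)
    {δ : ℂ} (hδ : δ = 1 ∨ δ = -1) {X Y : Set E}
    (hX : X = {a ∈ (setS F : Set E) | conicSign ψ a = δ})
    (hY : Y = {a ∈ (setS F : Set E) | conicSign ψ a = -δ}) :
    kleinPreimage F (orbitUnion F α X Y) =
      {ℓ | lineSum (LinearEquiv.refl F (F × E)) (quarticSign ψ) ℓ = w * δ.re} := by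
  have h := frobenius_isCubicFrobenius (F := F) (E := E) h3
  set σ := FiniteField.frobeniusAlgHom F E
  have hXS : X ⊆ setS F := by rw [hX]; exact Set.sep_subset _ _
  have hYS : Y ⊆ setS F := by rw [hY]; exact Set.sep_subset _ _
  have hne : w * δ.re ≠ 0 := by rcases hδ with rfl | rfl <;> simpa using hw0
  ext ℓ
  rw [Set.mem_ofPred_eq]
  by_cases h1 : ℓ.1 ≤ infinitePlane (LinearEquiv.refl F (F × E))
  · rw [lineSum_infinite _ h1]
    refine iff_of_false ?_ hne.symm
    rintro ⟨v, v', hℓ, hv, hmem⟩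
    have m1 : v ∈ ℓ.1 := by rw [hℓ]; exact Submodule.subset_span (by simp)
    have m2 : v' ∈ ℓ.1 := by rw [hℓ]; exact Submodule.subset_span (by simp)
    have e1 : v.1 = 0 := mem_infinitePlane (x := v.2).1 (h1 m1)
    have e2 : v'.1 = 0 := mem_infinitePlane (x := v'.2).1 (h1 m2)
    refine (ne_zero_of_mem_orbitUnion hα hXS hYS _ hmem).1 ?_
    rw [e1, e2, zero_smul, zero_smul, sub_zero]
  · obtain ⟨x, y, hy, hℓ⟩ := exists_param ℓ h1
    rw [mem_kleinPreimage_iff (v := ((1, x) : F × E)) (w := ((0, y) : F × E)) hℓ]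
    simp only [pluckerVector_eq]
    by_cases hxy : σ x * σ (σ y) - σ (σ x) * σ y = 0
    · rw [lineSum_through_origin (fun z _ => h.sum_quarticSign_smul hψ z)
        (h.incident_origin hy hℓ hxy)]
      refine iff_of_false ?_ hne.symm
      rintro ⟨hv, hmem⟩
      exact (ne_zero_of_mem_orbitUnion hα hXS hYS _ hmem).2 hxy
    · have hv : (y, σ x * σ (σ y) - σ (σ x) * σ y) ≠ 0 := fun h0 => hy (congrArg Prod.fst h0)
      obtain ⟨l, c, n, a, hl, hc, hn, ha, e1, e2, hsum⟩ := h.exists_sum_line h3 hψ hθ hτ hτs hy hxy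
      rw [hw] at hsum
      rw [exists_prop_of_true hv, h.mem_orbitUnion hα hω hl hc hn ha hXS hYS hv e1 e2,
        lineSum_param _ hy hℓ, sum_quarticSign x y (conicSign_eq hψ a) hsum, mul_assoc,
        mul_right_inj' hw0, hX, hY]
      have hI : Complex.I ≠ 1 := fun h0 => by simpa using congrArg Complex.re h0
      have hI' : Complex.I ≠ -1 := fun h0 => by simpa using congrArg Complex.re h0
      have hI'' : -Complex.I ≠ 1 := fun h0 => by simpa using congrArg Complex.re h0
      have hII : Complex.I ≠ -Complex.I := fun h0 => by
        have := congrArg Complex.im h0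
        norm_num at this
      have h1' : (1 : ℂ) ≠ -1 := by norm_num
      have h2' : (1 : ℝ) ≠ -1 := by norm_num
      have hI1 := hI''.symm
      -- Both sides now depend only on the sign of a, on ψ(c) and on δ, leaving sixteen cases.
      rcases conicSign_eq hψ a with h4 | h4 <;>
        rcases hψ.mulChar_cases hc with h5 | h5 | h5 | h5 <;>
        rcases hδ with rfl | rfl <;>
        simp [h4, h5, ha, hI, hI', hI'', hII, hII.symm, h1', h1'.symm, h2', h2'.symm, hI.symm,
          hI'.symm, hI1, neg_eq_iff_eq_neg]

end IsCubicFrobenius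

/-! ### Assembly in the explicit model and in arbitrary models -/

section Final

variable {F : Type*} [Field F]

lemma basePoint_eq (E : Type*) [Field E] [Algebra F E] :
    basePoint F E = affinePoint (LinearEquiv.refl F (F × E)) 0 := rfl

lemma basePlane_eq (E : Type*) [Field E] [Algebra F E] :
    basePlane F E = infinitePlane (LinearEquiv.refl F (F × E)) := by
  rw [infinitePlane]
  exact (Submodule.map_id _).symm

/-- Each alternative of the conjecture allows at most two point classes, whereas there are four. -/
lemma IsFourClassDecomposition.not_conjecture {V : Type*} [AddCommGroup V] [Module F V] {e : ℕ}
    {p : PGPoint F V} {π : Submodule F V} {L₁ L₂ : Set (PGLine F V)}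
    (h : IsFourClassDecomposition e p π L₁ L₂) : ¬ CameronLieblerSTDConjecture F V := by
  intro hC
  have h4 := h.card_pointClasses
  rcases hC _ _ h.symmetric_tactical with ⟨h1, -⟩ | ⟨r, h1, -⟩ | ⟨H, -, h1, -⟩ <;> rw [h1] at h4
  · rw [Set.ncard_singleton] at h4
    omega
  · have := Set.ncard_insert_le ({r} : Set (PGPoint F V)) {{r}ᶜ}
    rw [Set.ncard_singleton] at this
    omega
  · have := Set.ncard_insert_le (pgPointsIn H) {(pgPointsIn H)ᶜ}
    rw [Set.ncard_singleton] at this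
    omega

lemma charP_three_of_card {e : ℕ} (hF : Nat.card F = 3 ^ (2 * e)) : CharP F 3 := by
  have hfin : Finite F := Nat.finite_of_card_ne_zero (by rw [hF]; positivity)
  have := Fintype.ofFinite F
  obtain ⟨p, hp⟩ := CharP.exists F
  obtain ⟨n, hpp, hn⟩ := FiniteField.card F p
  rw [Fintype.card_eq_nat_card, hF] at hn
  have : p ∣ 3 := hpp.dvd_of_dvd_pow (n := 2 * e) (by rw [hn]; exact dvd_pow_self p n.ne_zero)
  rw [← (Nat.prime_dvd_prime_iff_eq hpp Nat.prime_three).1 this]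
  exact hp

/-- The even exponent enters here: q = 9ᵉ is 1 modulo 8, which makes ψ(−1) = 1 for the quartic
character. -/
lemma eight_dvd_card_sub_one [Fintype F] {e : ℕ} (hF : Nat.card F = 3 ^ (2 * e)) :
    8 ∣ Fintype.card F - 1 := by
  rw [Fintype.card_eq_nat_card, hF, pow_mul]
  simpa using Nat.sub_dvd_pow_sub_pow 9 1 e

section Extension

variable [Fintype F] [CharP F 3] {e : ℕ} {E : Type*} [Field E] [Algebra F E] [CharP E 3]
  [Finite E] {α : Eˣ}

lemma exists_quarticPair (hF : Nat.card F = 3 ^ (2 * e)) (h3 : Module.finrank F E = 3)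
    (hα : ∀ x : Eˣ, x ∈ Subgroup.zpowers α) :
    ∃ (ψ : MulChar F ℂ) (ζ : AddChar F ℂ) (θ : E) (τ : F) (w : ℝ), IsQuarticPair ψ ζ ∧
      ψ (omegaUnit F α : F) = Complex.I ∧ FiniteField.frobeniusAlgHom F E θ = θ + 1 ∧
      θ ^ 3 = θ + algebraMap F E τ ∧ (∀ s : F, s ^ 3 - s ≠ τ) ∧
      ∑ s, ψ (s ^ 3 - s + τ) = w ∧ w ^ 2 = Fintype.card F ∧ w ≠ 0 := by
  have h := frobenius_isCubicFrobenius (F := F) (E := E) h3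
  obtain ⟨ψ, ζ, hψ, hω⟩ := IsQuarticPair.exists_pair (mem_zpowers_omegaUnit (F := F) hα)
    (eight_dvd_card_sub_one hF)
  obtain ⟨θ, hθ⟩ := h.exists_generator
  obtain ⟨τ, hτ, hτs⟩ := h.exists_artinSchreier hθ
  have hτ1 : ζ τ ≠ 1 := fun h1 => by
    obtain ⟨s, hs⟩ := hψ.exists_artinSchreier h1
    exact hτs s hs
  obtain ⟨w, hw, hw2⟩ := hψ.artinSchreier_eq_real hτ1
  refine ⟨ψ, ζ, θ, τ, w, hψ, hω, hθ, hτ, hτs, hw, hw2, ?_⟩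
  rintro rfl
  rw [zero_pow two_ne_zero] at hw2
  exact Nat.cast_ne_zero.2 Fintype.card_ne_zero hw2.symm

lemma isFourClassDecomposition_kleinPreimage (he : 0 < e) (hF : Nat.card F = 3 ^ (2 * e))
    (h3 : Module.finrank F E = 3) (hα : ∀ x : Eˣ, x ∈ Subgroup.zpowers α) {b : E}
    (hb : b ∈ (setS F : Set E)) :
    IsFourClassDecomposition e (basePoint F E) (basePlane F E)
      (kleinPreimage F (tightSet₁ F α b)) (kleinPreimage F (tightSet₂ F α b)) := by
  have := Fintype.ofFinite E
  have h := frobenius_isCubicFrobenius (F := F) (E := E) h3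
  obtain ⟨ψ, ζ, θ, τ, w, hψ, hω, hθ, hτ, hτs, hw, hw2, hw0⟩ := exists_quarticPair hF h3 hα
  have hδ := IsCubicFrobenius.conicSign_eq hψ b
  have hδ' : (IsCubicFrobenius.conicSign ψ b).re = 1 ∨
      (IsCubicFrobenius.conicSign ψ b).re = -1 := by
    rcases hδ with h1 | h1 <;> rw [h1] <;> simp
  have hδn : -IsCubicFrobenius.conicSign ψ b = 1 ∨ -IsCubicFrobenius.conicSign ψ b = -1 := by
    rcases hδ with h1 | h1 <;> rw [h1] <;> simp
  have hX := h.setX₁_eq hψ hb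
  have hY := h.setX₂_eq hψ hb
  rw [basePoint_eq, basePlane_eq, tightSet₁, tightSet₂,
    IsCubicFrobenius.kleinPreimage_eq h3 hψ hα hω hθ hτ hτs hw hw0 hδ hX hY,
    IsCubicFrobenius.kleinPreimage_eq h3 hψ hα hω hθ hτ hτs hw hw0 hδn hY (by rwa [neg_neg]),
    Complex.neg_re, mul_neg]
  exact (h.isTwoLineSum _ h3 hψ hθ hτ hτs hw hw2 hδ').isFourClassDecomposition h3 he
    (by rw [Fintype.card_eq_nat_card, hF])

lemma exists_isFourClassDecomposition (he : 0 < e) (hF : Nat.card F = 3 ^ (2 * e))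
    (h3 : Module.finrank F E = 3) (hα : ∀ x : Eˣ, x ∈ Subgroup.zpowers α)
    {V : Type*} [AddCommGroup V] [Module F V] (hV : Module.finrank F V = 4) :
    ∃ (p : PGPoint F V) (π : Submodule F V) (L₁ L₂ : Set (PGLine F V)),
      IsFourClassDecomposition e p π L₁ L₂ := by
  have := Fintype.ofFinite E
  have h := frobenius_isCubicFrobenius (F := F) (E := E) h3
  obtain ⟨ψ, ζ, θ, τ, w, hψ, -, hθ, hτ, hτs, hw, hw2, -⟩ := exists_quarticPair hF h3 hα
  have hfdE : FiniteDimensional F E := FiniteDimensional.of_finrank_pos (by omega)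
  have hfdV : FiniteDimensional F V := FiniteDimensional.of_finrank_pos (by omega)
  have hfinV : Finite V := Module.finite_of_finite F
  -- Any coordinates will do, since the counting argument was carried out for an arbitrary
  -- isomorphism.
  have g : (F × E) ≃ₗ[F] V := LinearEquiv.ofFinrankEq _ _ (by
    rw [Module.finrank_prod, Module.finrank_self, h3, hV])
  exact ⟨_, _, _, _, (h.isTwoLineSum g h3 hψ hθ hτ hτs hw hw2
    (Or.inl rfl)).isFourClassDecomposition h3 he (by rw [Fintype.card_eq_nat_card, hF])⟩

end Extension

end Final

theorem mainTheorem3 {F : Type*} [Field F] (e : ℕ) (he : 0 < e) (hF : Nat.card F = 3 ^ (2 * e)) :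
    -- the explicit line classes in the model `F × E` of `PG(3, 3 ^ (2 * e))`
    (∀ {E : Type*} [Field E] [Algebra F E], Module.finrank F E = 3 →
      ∀ α : Eˣ, (∀ x : Eˣ, x ∈ Subgroup.zpowers α) →
        (setS F : Set E).Nonempty ∧
        ∀ a₁ ∈ (setS F : Set E),
          IsFourClassDecomposition e (basePoint F E) (basePlane F E)
            (kleinPreimage F (tightSet₁ F α a₁)) (kleinPreimage F (tightSet₂ F α a₁))) ∧
    -- existence in every model of `PG(3, 3 ^ (2 * e))`, and failure of the conjecture
    (∀ {V : Type*} [AddCommGroup V] [Module F V], Module.finrank F V = 4 →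
      (∃ (p : PGPoint F V) (π : Submodule F V) (L₁ L₂ : Set (PGLine F V)),
        IsFourClassDecomposition e p π L₁ L₂) ∧
      ¬ CameronLieblerSTDConjecture F V) := by
  have hfin : Finite F := Nat.finite_of_card_ne_zero (by rw [hF]; positivity)
  have := Fintype.ofFinite F
  have := charP_three_of_card hF
  have : Fact (Nat.Prime 3) := ⟨Nat.prime_three⟩
  refine ⟨fun {E} _ _ h3 α hα => ?_, fun {V} _ _ hV => ?_⟩
  · have hfd : FiniteDimensional F E := FiniteDimensional.of_finrank_pos (by omega)
    have hfin : Finite E := Module.finite_of_finite F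
    have : CharP E 3 := charP_of_injective_algebraMap (algebraMap F E).injective 3
    exact ⟨⟨1, (frobenius_isCubicFrobenius h3).one_mem_setS⟩,
      fun b hb => isFourClassDecomposition_kleinPreimage he hF h3 hα hb⟩
  -- No cubic extension is given in this part, so one is supplied together with a generator of its
  -- unit group.
  · have h3 := FiniteField.finrank_extension F 3 3
    have hfd : FiniteDimensional F (FiniteField.Extension F 3 3) :=
      FiniteDimensional.of_finrank_pos (by omega)
    have hfin : Finite (FiniteField.Extension F 3 3) := Module.finite_of_finite F
    have : CharP (FiniteField.Extension F 3 3) 3 :=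
      charP_of_injective_algebraMap (algebraMap F _).injective 3
    obtain ⟨α, hα⟩ := IsCyclic.exists_generator (α := (FiniteField.Extension F 3 3)ˣ)
    obtain ⟨p, π, L₁, L₂, h⟩ := exists_isFourClassDecomposition he hF h3 hα hV
    exact ⟨⟨p, π, L₁, L₂, h⟩, h.not_conjecture⟩
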